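/- Conventions. Let $\mathbb R$ be a regular category. For a fibration $\mathcal C:|\mathcal C|\to\mathbb R$ write $\mathcal C_I$ for the fiber over $I$; a map over an identity is vertical; a map of $|\mathcal C|$ is cover-cartesian if it is cartesian over a regular epimorphism. $\mathcal C$ is a pre-stack if for every regular epimorphism $e:J\to I$ with kernel pair $\partial_0,\partial_1$ and all $A,B\in\mathcal C_I$, $h\mapsto e^*h$ is a bijection from $\mathcal C_I(A,B)$ onto the maps $e^*A\to e^*B$ of $\mathcal C_J$ which are compatible with the canonical descent data over the kernel pair. It is a finite-limit pre-stack if moreover its fibers have finite limits, preserved by reindexing. A fibered pretopos is a pre-stack whose fibers are exact categories, whose reindexing functors preserve finite limits and regular epimorphisms, which is an opfibration, in which cocartesian maps are stable under pullback along arbitrary maps, and in which for every cocartesian $s:A\to B$ the diagonal $A\to A\times_BA$ is cocartesian. For a finite-limit pre-stack $\mathcal C$, a predicate on $A\in|\mathcal C|$ is a map into $A$, and $f\le g$ for $f:Y\to A$, $g:Z\to A$ if there are a cover-cartesian $e:Y'\to Y$ and $k:Y'\to Z$ with $gk=fe$ (the fibration of sieves; judgments $\vdash$ are interpreted in it). The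 fibration of presheaves $\widehat{\mathcal C}$ over $\mathbb R$ has as objects over $I$ the triples $(u:J\to I,\ C\in\mathcal C_J,\ \rho)$, where $\rho$ is an equivalence relation on $C$ in the fibration of sieves which factors through $C\times_IC$. A morphism $(u,C,\rho)\to(v,D,\sigma)$ over $w$ is represented by a span $C\xleftarrow{e}C^*\xrightarrow{f}D$ with $e$ cover-cartesian, $w\,u\,\mathcal C(e)=v\,\mathcal C(f)$ and $\rho(ex,ey)\vdash\sigma(fx,fy)$; two spans represent the same morphism over $w$ if they define the same relation $\exists x.\,ex=c\wedge\sigma(fx,d)$; composition is relational composition. The Yoneda embedding $Y:\mathcal C\to\widehat{\mathcal C}$ sends $C\in\mathcal C_I$ to $(\mathrm{id}_I,C,=)$. An object $P$ in the total category of a fibration is projective if for every cartesian $c:P^*\to P$, every $f:P^*\to B$ and every vertical $e:A\to B$ which is a regular epimorphism in its fiber, there are a cover-cartesian $d:Q\to P^*$ and $g:Q\to A$ with $eg=fd$. An object $D$ is indecomposable if for every cartesian $c:D^*\to D$, every $f:D^*\to S$ and every cocartesian $s:A\to S$ there is a unique $m:D^*\to A$ with $sm=f$. Lemma. (i) Let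 $\mathcal C$ be a finite-limit pre-stack on $\mathbb R$. (a) For every $C\in|\mathcal C|$, $YC$ is indecomposable and projective in $\widehat{\mathcal C}$. (b) For every indecomposable projective $A\in|\widehat{\mathcal C}|$ there are $C\in|\mathcal C|$ and a cover-cartesian map $YC\to A$. In other words, the co-restriction of $Y$ to the full subfibration of $\widehat{\mathcal C}$ on the indecomposable projectives is a weak equivalence of pre-stacks: it is a full and faithful fibered functor between pre-stacks, and every object of the target admits a cover-cartesian map from an object in the image. (ii) Let $\mathcal X$ be a fibered pretopos on $\mathbb R$, and let $\mathcal P\subseteq\mathcal X$ be its full subfibration on the indecomposable projectives. Then $\mathcal P$ is a finite-limit pre-stack (so that $\widehat{\mathcal P}$ is defined) and $\mathcal X$ is equivalent to $\widehat{\mathcal P}$ as a fibration over $\mathbb R$ if and only if $\mathcal P$ is closed under finite limits in the fibers of $\mathcal X$ and every $X\in|\mathcal X|$ can be covered as $A\xrightarrow{s}S\xrightarrow{e}X$ with $A$ indecomposable and projective, $s$ cocartesian, and $e$ vertical and a regular epimorphism in its fiber. -/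

import Mathlib

open CategoryTheory Category Limits

universe v₁ v₂ v₃ u₁ u₂ u₃

namespace FibPresheaf

/-! ### Fibrations and reindexing -/

section Reindexing

variable {R : Type u₁} [Category.{v₁} R] {X : Type u₂} [Category.{v₂} X]

/-- The reindexing functor `u^* : X_I ⥤ X_J` along `u : J ⟶ I` for a choice of cartesian liftings. -/
noncomputable def reindex (p : X ⥤ R) [p.IsFibered] {J I : R} (u : J ⟶ I) :
    p.Fiber I ⥤ p.Fiber J where
  obj A := ⟨Functor.IsPreFibered.pullbackObj A.2 u, Functor.IsPreFibered.pullbackObj_proj A.2 u⟩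
  map {A B} f :=
    haveI := f.2
    ⟨Functor.IsCartesian.map p u (Functor.IsPreFibered.pullbackMap B.2 u)
      (Functor.IsPreFibered.pullbackMap A.2 u ≫ f.1), inferInstance⟩
  map_id A := by
    apply Subtype.ext
    symm
    have h₁ : p.IsHomLift (𝟙 I) (𝟙 A.1) := IsHomLift.id A.2
    have h₂ : p.IsHomLift (𝟙 J) (𝟙 (Functor.IsPreFibered.pullbackObj A.2 u)) :=
      IsHomLift.id (Functor.IsPreFibered.pullbackObj_proj A.2 u)
    have h₃ : p.IsHomLift u (Functor.IsPreFibered.pullbackMap A.2 u ≫ 𝟙 A.1) := inferInstance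
    exact Functor.IsCartesian.map_uniq p u (Functor.IsPreFibered.pullbackMap A.2 u)
      (Functor.IsPreFibered.pullbackMap A.2 u ≫ 𝟙 A.1) (𝟙 _) (by simp)
  map_comp {A B C} f g := by
    apply Subtype.ext
    symm
    have h₁ := f.2
    have h₂ := g.2
    have h₃ : p.IsHomLift u (Functor.IsPreFibered.pullbackMap A.2 u ≫ f.1 ≫ g.1) := inferInstance
    exact Functor.IsCartesian.map_uniq p u (Functor.IsPreFibered.pullbackMap C.2 u)
      (Functor.IsPreFibered.pullbackMap A.2 u ≫ f.1 ≫ g.1)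
      (Functor.IsCartesian.map p u (Functor.IsPreFibered.pullbackMap B.2 u)
        (Functor.IsPreFibered.pullbackMap A.2 u ≫ f.1) ≫
        Functor.IsCartesian.map p u (Functor.IsPreFibered.pullbackMap C.2 u)
          (Functor.IsPreFibered.pullbackMap B.2 u ≫ g.1)) (by simp)

/-- The chosen cartesian lifting `u^* A ⟶ A`. -/
noncomputable def reindexLift (p : X ⥤ R) [p.IsFibered] {J I : R} (u : J ⟶ I) (A : p.Fiber I) :
    ((reindex p u).obj A).1 ⟶ A.1 :=
  Functor.IsPreFibered.pullbackMap A.2 u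

instance (p : X ⥤ R) [p.IsFibered] {J I : R} (u : J ⟶ I) (A : p.Fiber I) :
    p.IsCartesian u (reindexLift p u A) :=
  inferInstanceAs (p.IsCartesian u (Functor.IsPreFibered.pullbackMap A.2 u))

/-- For `d₀, d₁ : K ⟶ J` with `d₀ ≫ e = d₁ ≫ e`, the canonical comparison
`d₁^* e^* A ⟶ d₀^* e^* A` over `K` (the descent datum carried by `e^* A`). -/
noncomputable def canonicalDescentDatum (p : X ⥤ R) [p.IsFibered] {K J I : R} (d₀ d₁ : K ⟶ J)
    (e : J ⟶ I) (h : d₀ ≫ e = d₁ ≫ e) (A : p.Fiber I) :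
    (reindex p d₁).obj ((reindex p e).obj A) ⟶ (reindex p d₀).obj ((reindex p e).obj A) :=
  haveI : p.IsHomLift (d₀ ≫ e)
      (reindexLift p d₁ ((reindex p e).obj A) ≫ reindexLift p e A) := by
    rw [h]; infer_instance
  ⟨Functor.IsCartesian.map p (d₀ ≫ e)
      (reindexLift p d₀ ((reindex p e).obj A) ≫ reindexLift p e A)
      (reindexLift p d₁ ((reindex p e).obj A) ≫ reindexLift p e A), inferInstance⟩

/-- `f : A ⟶ B` is cartesian with respect to `p`. -/
def IsCart (p : X ⥤ R) {A B : X} (f : A ⟶ B) : Prop := p.IsStronglyCartesian (p.map f) f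

/-- `f : A ⟶ B` is cocartesian with respect to `p`. -/
def IsCocart (p : X ⥤ R) {A B : X} (f : A ⟶ B) : Prop := p.IsStronglyCocartesian (p.map f) f

/-- A cover-cartesian morphism is a cartesian morphism over a regular epimorphism. -/
def IsCoverCart (p : X ⥤ R) {A B : X} (f : A ⟶ B) : Prop :=
  IsRegularEpi (p.map f) ∧ IsCart p f

/-- `f` is vertical, and a regular epimorphism in the fiber in which it lies. -/
def IsVerticalRegularEpi (p : X ⥤ R) {A B : X} (f : A ⟶ B) : Prop :=
  ∃ (I : R) (_ : p.IsHomLift (𝟙 I) f), IsRegularEpi (Functor.Fiber.homMk p I f)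

end Reindexing

/-! ### Pre-stacks, finite-limit pre-stacks and fibered pretoposes -/

section Prestacks

variable {R : Type u₁} [Category.{v₁} R] [Regular R] {X : Type u₂} [Category.{v₂} X]

/-- A pre-stack for the regular topology: for every regular epimorphism `e : J ⟶ I` with kernel pair
`d₀, d₁`, reindexing along `e` identifies morphisms `A ⟶ B` over `I` with morphisms
`f : e^* A ⟶ e^* B` of descent data, i.e. with those satisfying `d₀^* f ∘ α_A = α_B ∘ d₁^* f`. -/
class IsPrestack (p : X ⥤ R) : Prop extends p.IsFibered where
  existsUnique_descent {J I : R} (e : J ⟶ I) [IsRegularEpi e] (A B : p.Fiber I)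
    (f : (reindex p e).obj A ⟶ (reindex p e).obj B)
    (hf : canonicalDescentDatum p (pullback.fst e e) (pullback.snd e e) e pullback.condition A ≫
          (reindex p (pullback.fst e e)).map f =
        (reindex p (pullback.snd e e)).map f ≫
          canonicalDescentDatum p (pullback.fst e e) (pullback.snd e e) e pullback.condition B) :
    ∃! h : A ⟶ B, (reindex p e).map h = f

/-- A finite-limit pre-stack: a pre-stack whose fibers have finite limits, and whose reindexing
functors preserve them. -/
class IsFiniteLimitPrestack (p : X ⥤ R) : Prop extends IsPrestack p where
  hasFiniteLimits (I : R) : HasFiniteLimits (p.Fiber I)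
  preservesFiniteLimits {J I : R} (u : J ⟶ I) : PreservesFiniteLimits (reindex p u)

/-- An exact category: a regular category in which every equivalence relation is a kernel pair. -/
class IsExactCategory (E : Type u₃) [Category.{v₃} E] : Prop extends Regular E where
  exists_isKernelPair {S A : E} (r₁ r₂ : S ⟶ A) [IsEquivalenceRelation r₁ r₂] :
    ∃ (B : E) (q : A ⟶ B), IsKernelPair q r₁ r₂

/-- A fibered pretopos: a pre-stack of exact categories with extensive internal sums. -/
class IsFiberedPretopos (p : X ⥤ R) : Prop extends IsFiniteLimitPrestack p where
  /-- the fibers are exact categories -/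
  exact (I : R) : IsExactCategory (p.Fiber I)
  /-- reindexing preserves regular epimorphisms (it preserves finite limits already) -/
  reindex_regularEpi {J I : R} (u : J ⟶ I) {A B : p.Fiber I} (f : A ⟶ B) [IsRegularEpi f] :
    IsRegularEpi ((reindex p u).map f)
  /-- internal sums exist: `p` is an opfibration -/
  exists_cocart (A : X) {I : R} (u : p.obj A ⟶ I) :
    ∃ (B : X) (s : A ⟶ B), p.IsStronglyCocartesian u s
  /-- internal sums are stable: cocartesian maps are stable under arbitrary pullback
  (in particular under pullback along cartesian maps, which is the Beck-Chevalley condition) -/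
  cocart_stable {P A B C : X} {f' : P ⟶ A} {s' : P ⟶ C} {s : A ⟶ B} {f : C ⟶ B}
    (h : IsPullback f' s' s f) (hs : IsCocart p s) : IsCocart p s'
  /-- internal sums are disjoint: the diagonal of a cocartesian map is cocartesian -/
  cocart_disjoint {K A B : X} {s : A ⟶ B} {k₁ k₂ : K ⟶ A} (h : IsKernelPair s k₁ k₂)
    (hs : IsCocart p s) (δ : A ⟶ K) (h₁ : δ ≫ k₁ = 𝟙 A) (h₂ : δ ≫ k₂ = 𝟙 A) : IsCocart p δ

end Prestacks

/-! ### Fibered functors, equivalences and weak equivalences -/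

section FiberedFunctors

variable {R : Type u₁} [Category.{v₁} R]
  {X : Type u₂} [Category.{v₂} X] {Y : Type u₃} [Category.{v₃} Y]

/-- A functor over the base is fibered if it preserves cartesian morphisms. -/
def IsFiberedFunctor {p : X ⥤ R} {q : Y ⥤ R}
    (F : BasedFunctor (BasedCategory.ofFunctor p) (BasedCategory.ofFunctor q)) : Prop :=
  ∀ ⦃A B : X⦄ (f : A ⟶ B), IsCart p f → IsCart q (F.toFunctor.map f)

/-- Equivalence of fibrations over `R`: fibered functors in both directions which are mutually
inverse up to vertical natural isomorphism. -/
def FibrationsEquivalent (p : X ⥤ R) (q : Y ⥤ R) : Prop :=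
  ∃ (F : BasedFunctor (BasedCategory.ofFunctor p) (BasedCategory.ofFunctor q))
    (G : BasedFunctor (BasedCategory.ofFunctor q) (BasedCategory.ofFunctor p)),
    IsFiberedFunctor F ∧ IsFiberedFunctor G ∧
    Nonempty (BasedFunctor.comp F G ≅ BasedFunctor.id _) ∧
    Nonempty (BasedFunctor.comp G F ≅ BasedFunctor.id _)

/-- A weak equivalence of pre-stacks: a full and faithful fibered functor such that every object of
the target admits a cover-cartesian map from an object in the image. -/
structure IsWeakEquivalence [Regular R] {p : X ⥤ R} {q : Y ⥤ R}
    (F : BasedFunctor (BasedCategory.ofFunctor p) (BasedCategory.ofFunctor q)) : Prop where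
  prestack_source : IsPrestack p
  prestack_target : IsPrestack q
  fibered : IsFiberedFunctor F
  full : F.toFunctor.Full
  faithful : F.toFunctor.Faithful
  exists_cover (D : Y) : ∃ (C : X) (e : F.toFunctor.obj C ⟶ D), IsCoverCart q e

end FiberedFunctors

/-! ### Indecomposable projectives -/

section IndecomposableProjective

variable {R : Type u₁} [Category.{v₁} R] {X : Type u₂} [Category.{v₂} X] (p : X ⥤ R)

/-- Projectivity: given `c : P' ⟶ P` cartesian, `f : P' ⟶ B` and a vertical regular epimorphism
`e : A ⟶ B`, the map `f` lifts along `e` after precomposition with a cover-cartesian map. -/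
def IsProj (P : X) : Prop :=
  ∀ ⦃P' A B : X⦄ (c : P' ⟶ P) (f : P' ⟶ B) (e : A ⟶ B), IsCart p c → IsVerticalRegularEpi p e →
    ∃ (Q : X) (d : Q ⟶ P') (g : Q ⟶ A), IsCoverCart p d ∧ g ≫ e = d ≫ f

/-- Indecomposability: given `c : D' ⟶ D` cartesian and `s : A ⟶ S` cocartesian, every
`f : D' ⟶ S` lifts uniquely along `s`. -/
def IsIndec (D : X) : Prop :=
  ∀ ⦃D' A S : X⦄ (c : D' ⟶ D) (f : D' ⟶ S) (s : A ⟶ S), IsCart p c → IsCocart p s →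
    ∃! m : D' ⟶ A, m ≫ s = f

/-- The indecomposable projective objects. -/
def indecProj : ObjectProperty X := fun A => IsIndec p A ∧ IsProj p A

/-- The (full) subfibration of indecomposable projectives. -/
abbrev indecProjFib : (indecProj p).FullSubcategory ⥤ R := (indecProj p).ι ⋙ p

/-- The subfibration of indecomposable projectives is closed under finite limits: in each fiber
the indecomposable projectives are closed under finite limits. -/
def IndecProjClosedUnderFiniteLimits : Prop :=
  ∀ (I : R) (K : Type) [SmallCategory K] [FinCategory K],
    ((indecProj p).inverseImage
      (Functor.Fiber.fiberInclusion : p.Fiber I ⥤ X)).IsClosedUnderLimitsOfShape K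

/-- Every object is covered by an indecomposable projective, via a cocartesian map followed by a
vertical regular epimorphism. -/
def CoveredByIndecProj : Prop :=
  ∀ B : X, ∃ (A S : X) (s : A ⟶ S) (e : S ⟶ B),
    indecProj p A ∧ IsCocart p s ∧ IsVerticalRegularEpi p e

end IndecomposableProjective

/-! ### Cover-cartesian maps: identities, composition, pullback -/

section CoverCart

variable {R : Type u₁} [Category.{v₁} R] {X : Type u₂} [Category.{v₂} X] {p : X ⥤ R}

lemma IsCoverCart.id (A : X) : IsCoverCart p (𝟙 A) :=
  ⟨by rw [p.map_id]; infer_instance, by unfold IsCart; infer_instance⟩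

variable [Regular R]

lemma IsCoverCart.comp {A B C : X} {f : A ⟶ B} {g : B ⟶ C} (hf : IsCoverCart p f)
    (hg : IsCoverCart p g) : IsCoverCart p (f ≫ g) := by
  obtain ⟨hf₁, hf₂⟩ := hf
  obtain ⟨hg₁, hg₂⟩ := hg
  unfold IsCart at hf₂ hg₂
  refine ⟨?_, ?_⟩
  · rw [p.map_comp]
    have h : StrongEpi (p.map f ≫ p.map g) := strongEpi_comp _ _
    have h' : ExtremalEpi (p.map f ≫ p.map g) := inferInstance
    infer_instance
  · unfold IsCart
    rw [p.map_comp]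
    infer_instance

lemma IsCoverCart.exists_pullback [p.IsFibered] {A B T : X} {e : A ⟶ B} (he : IsCoverCart p e) (t : T ⟶ B) :
    ∃ (T' : X) (e' : T' ⟶ T) (t' : T' ⟶ A), IsCoverCart p e' ∧ t' ≫ e = e' ≫ t := by
  obtain ⟨he₁, he₂⟩ := he
  unfold IsCart at he₂
  let d := pullback.snd (p.map e) (p.map t)
  obtain ⟨T', e', h⟩ := Functor.IsPreFibered.exists_isCartesian' (p := p) (a := T) d
  have h₂ : p.IsHomLift (pullback.fst (p.map e) (p.map t) ≫ p.map e) (e' ≫ t) := by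
    rw [pullback.condition]
    exact IsHomLift.comp p d (p.map t) e' t
  obtain ⟨t', ht', -⟩ := Functor.IsStronglyCartesian.universal_property p (p.map e) e
    (pullback.fst (p.map e) (p.map t)) _ rfl (e' ≫ t)
  refine ⟨T', e', t', ⟨?_, ?_⟩, ht'.2⟩
  · have hd : IsRegularEpi d := inferInstance
    have hlift : p.IsHomLift d e' := inferInstance
    have hT : p.obj T' = pullback (p.map e) (p.map t) := IsHomLift.domain_eq p d e'
    have : p.map e' = eqToHom hT ≫ d := by simpa using IsHomLift.fac' p d e'
    rw [this]
    have h : StrongEpi (eqToHom hT ≫ d) := strongEpi_comp _ _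
    have h' : ExtremalEpi (eqToHom hT ≫ d) := inferInstance
    infer_instance
  · unfold IsCart
    have : p.IsCartesian (p.map e') e' := by
      have key : ∀ {K L : R} (d : K ⟶ L), p.IsCartesian d e' → p.IsCartesian (p.map e') e' := by
        intro K L d hd
        subst_hom_lift p d e'
        exact hd
      exact key d h
    infer_instance

end CoverCart

/-! ### The fibration of sieves and the fibration of presheaves -/

section Presheaf

variable {R : Type u₁} [Category.{v₁} R] {X : Type u₂} [Category.{v₂} X]

/-- A binary predicate of the fibration of sieves on objects `C`, `D` of the total category:
a morphism `(fst, snd)` into the product of `C` and `D`. -/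
structure SieveRel (C D : X) where
  /-- the object representing the predicate -/
  dom : X
  /-- first component -/
  fst : dom ⟶ C
  /-- second component -/
  snd : dom ⟶ D

/-- `ρ(c, d)` holds for the generalized elements `c : T ⟶ C`, `d : T ⟶ D`: in the preorder of
sieves on the product of `C` and `D`, `(c, d) ≤ ρ`, i.e. after precomposition with a cover-cartesian
map, `(c, d)` factors through `ρ`. A judgment such as `ρ(x, y) ⊢ ρ(y, x)` of the fibration of
sieves amounts to the implication between the predicates `Holds` for all generalized elements. -/
def SieveRel.Holds (p : X ⥤ R) {C D : X} (ρ : SieveRel C D) {T : X} (c : T ⟶ C) (d : T ⟶ D) :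
    Prop :=
  ∃ (T' : X) (e : T' ⟶ T) (k : T' ⟶ ρ.dom),
    IsCoverCart p e ∧ k ≫ ρ.fst = e ≫ c ∧ k ≫ ρ.snd = e ≫ d

/-- An object `(u : J ⟶ I, C, ρ)` of the category of presheaves: `C` lies over `J`, and `ρ` is an
equivalence relation on `C` in the fibration of sieves which factors through `C ×_I C`. -/
structure Presheaf (p : X ⥤ R) where
  /-- the object `I` of the base over which the presheaf lives -/
  base : R
  /-- the object `C` whose sum along `u` is being divided by `ρ` -/
  obj : X
  /-- the map `u` along which the sum is formed -/
  struct : p.obj obj ⟶ base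
  /-- the equivalence relation `ρ` -/
  rel : SieveRel obj obj
  rel_struct : p.map rel.fst ≫ struct = p.map rel.snd ≫ struct
  refl : ∀ {T : X} (x : T ⟶ obj), rel.Holds p x x
  symm : ∀ {T : X} {x y : T ⟶ obj}, rel.Holds p x y → rel.Holds p y x
  trans : ∀ {T : X} {x y z : T ⟶ obj}, rel.Holds p x y → rel.Holds p y z → rel.Holds p x z

/-- A span `C ◁- C* ⟶ D`, with `e : C* ⟶ C` cover-cartesian, tracking a morphism
from `(u, C, ρ)` to `(v, D, σ)` over `w`. -/
structure TrackingSpan {p : X ⥤ R} (A B : Presheaf p) where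
  /-- the map in the base -/
  w : A.base ⟶ B.base
  /-- the apex `C*` of the span -/
  dom : X
  /-- the cover-cartesian leg -/
  e : dom ⟶ A.obj
  /-- the other leg -/
  f : dom ⟶ B.obj
  cover : IsCoverCart p e
  comm : p.map e ≫ A.struct ≫ w = p.map f ≫ B.struct
  compat : ∀ {T : X} (x y : T ⟶ dom),
    A.rel.Holds p (x ≫ e) (y ≫ e) → B.rel.Holds p (x ≫ f) (y ≫ f)

/-- The functional relation `φ(c, d) ⊣⊢ ∃ x. e x = c ∧ σ(f x, d)` tracked by a span. -/
def TrackingSpan.Graph {p : X ⥤ R} {A B : Presheaf p} (s : TrackingSpan A B) {T : X}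
    (c : T ⟶ A.obj) (d : T ⟶ B.obj) : Prop :=
  ∃ (T' : X) (t : T' ⟶ T) (x : T' ⟶ s.dom),
    IsCoverCart p t ∧ x ≫ s.e = t ≫ c ∧ B.rel.Holds p (x ≫ s.f) (t ≫ d)

/-- Two spans represent the same morphism if they lie over the same map in the base and track the
same functional relation. -/
instance TrackingSpan.setoid {p : X ⥤ R} (A B : Presheaf p) : Setoid (TrackingSpan A B) where
  r s s' := s.w = s'.w ∧ ∀ (T : X) (c : T ⟶ A.obj) (d : T ⟶ B.obj), s.Graph c d ↔ s'.Graph c d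
  iseqv :=
    { refl := fun _ => ⟨rfl, fun _ _ _ => Iff.rfl⟩
      symm := fun h => ⟨h.1.symm, fun T c d => (h.2 T c d).symm⟩
      trans := fun h h' => ⟨h.1.trans h'.1, fun T c d => (h.2 T c d).trans (h'.2 T c d)⟩ }

variable {p : X ⥤ R}

lemma holds_diag_iff (C : X) {T : X} (x y : T ⟶ C) :
    (SieveRel.mk C (𝟙 C) (𝟙 C)).Holds p x y ↔
      ∃ (T' : X) (e : T' ⟶ T), IsCoverCart p e ∧ e ≫ x = e ≫ y := by
  constructor
  · rintro ⟨T', e, k, he, h₁, h₂⟩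
    exact ⟨T', e, he, h₁.symm.trans h₂⟩
  · rintro ⟨T', e, he, h⟩
    exact ⟨T', e, e ≫ x, he, comp_id _, (comp_id _).trans h⟩

variable [Regular R]

lemma SieveRel.Holds.of_cover {C D : X} {ρ : SieveRel C D} {T : X} {c : T ⟶ C} {d : T ⟶ D}
    {U : X} {t : U ⟶ T} (ht : IsCoverCart p t) (h : ρ.Holds p (t ≫ c) (t ≫ d)) :
    ρ.Holds p c d := by
  obtain ⟨T', e, k, he, h₁, h₂⟩ := h
  exact ⟨T', e ≫ t, k, he.comp ht, by rw [h₁, assoc], by rw [h₂, assoc]⟩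

lemma TrackingSpan.graph_of_cover {A B : Presheaf p} (s : TrackingSpan A B) {T U : X} {t : U ⟶ T}
    (ht : IsCoverCart p t) {c : T ⟶ A.obj} {d : T ⟶ B.obj} (h : s.Graph (t ≫ c) (t ≫ d)) :
    s.Graph c d := by
  obtain ⟨T', r, x, hr, h₁, h₂⟩ := h
  exact ⟨T', r ≫ t, x, hr.comp ht, by rw [h₁, assoc], by rwa [assoc]⟩

namespace TrackingSpan

variable {A B C D : Presheaf p}

/-- The span `C = C ⟶ D` with trivial cover-cartesian leg (a strict tracking family). -/
def strict (w : A.base ⟶ B.base) (f : A.obj ⟶ B.obj) (comm : A.struct ≫ w = p.map f ≫ B.struct)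
    (compat : ∀ {T : X} (x y : T ⟶ A.obj), A.rel.Holds p x y → B.rel.Holds p (x ≫ f) (y ≫ f)) :
    TrackingSpan A B where
  w := w
  dom := A.obj
  e := 𝟙 _
  f := f
  cover := IsCoverCart.id _
  comm := by simpa using comm
  compat x y h := compat x y (by simpa using h)

lemma graph_strict (w : A.base ⟶ B.base) (f : A.obj ⟶ B.obj) (comm) (compat) {T : X}
    (c : T ⟶ A.obj) (d : T ⟶ B.obj) :
    (strict w f comm compat).Graph c d ↔ B.rel.Holds p (c ≫ f) d := by
  constructor
  · rintro ⟨T', t, x, ht, h₁, h₂⟩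
    dsimp [strict] at h₁ h₂ x
    obtain rfl : x = t ≫ c := by simpa using h₁
    rw [assoc] at h₂
    exact h₂.of_cover ht
  · intro h
    exact ⟨T, 𝟙 T, c, IsCoverCart.id T, by simp [strict], by simpa [strict] using h⟩

/-- The identity span. -/
def id (A : Presheaf p) : TrackingSpan A A :=
  strict (𝟙 _) (𝟙 _) (by simp) (fun x y h => by simpa using h)

end TrackingSpan

variable [p.IsFibered]

lemma SieveRel.Holds.precomp {C D : X} {ρ : SieveRel C D} {T : X} {c : T ⟶ C} {d : T ⟶ D}
    (h : ρ.Holds p c d) {U : X} (t : U ⟶ T) : ρ.Holds p (t ≫ c) (t ≫ d) := by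
  obtain ⟨T', e, k, he, h₁, h₂⟩ := h
  obtain ⟨U', e', t', he', ht⟩ := he.exists_pullback t
  exact ⟨U', e', t' ≫ k, he', by rw [assoc, h₁, ← assoc, ht, assoc],
    by rw [assoc, h₂, ← assoc, ht, assoc]⟩

namespace TrackingSpan

variable {A B C D : Presheaf p}

/-- The apex of a pullback of the cover-cartesian leg of `t` along `s.f`. -/
noncomputable def pbDom (s : TrackingSpan A B) (t : TrackingSpan B C) : X :=
  (t.cover.exists_pullback s.f).choose

/-- The first projection of the pullback; it is cover-cartesian. -/
noncomputable def pbFst (s : TrackingSpan A B) (t : TrackingSpan B C) : pbDom s t ⟶ s.dom :=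
  (t.cover.exists_pullback s.f).choose_spec.choose

/-- The second projection of the pullback. -/
noncomputable def pbSnd (s : TrackingSpan A B) (t : TrackingSpan B C) : pbDom s t ⟶ t.dom :=
  (t.cover.exists_pullback s.f).choose_spec.choose_spec.choose

lemma pbFst_cover (s : TrackingSpan A B) (t : TrackingSpan B C) : IsCoverCart p (pbFst s t) :=
  (t.cover.exists_pullback s.f).choose_spec.choose_spec.choose_spec.1

lemma pb_condition (s : TrackingSpan A B) (t : TrackingSpan B C) :
    pbSnd s t ≫ t.e = pbFst s t ≫ s.f :=
  (t.cover.exists_pullback s.f).choose_spec.choose_spec.choose_spec.2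

/-- The composite of two spans: pull back the cover-cartesian leg of the second one. -/
noncomputable def comp (s : TrackingSpan A B) (t : TrackingSpan B C) : TrackingSpan A C where
  w := s.w ≫ t.w
  dom := pbDom s t
  e := pbFst s t ≫ s.e
  f := pbSnd s t ≫ t.f
  cover := (pbFst_cover s t).comp s.cover
  comm := by
    rw [p.map_comp, p.map_comp, assoc, assoc, ← t.comm, ← assoc (p.map _) (p.map t.e),
      ← p.map_comp, pb_condition, p.map_comp, assoc, ← assoc (p.map s.f), ← s.comm]
    simp only [assoc]
  compat x y hxy := by
    have h₁ := s.compat (x ≫ pbFst s t) (y ≫ pbFst s t) (by simpa only [assoc] using hxy)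
    have h₂ := t.compat (x ≫ pbSnd s t) (y ≫ pbSnd s t)
      (by simpa only [assoc, pb_condition] using h₁)
    simpa only [assoc] using h₂

/-- The functional relation tracked by a composite is the relational composite. -/
lemma graph_comp (s : TrackingSpan A B) (t : TrackingSpan B C) {T : X} (a : T ⟶ A.obj)
    (c : T ⟶ C.obj) :
    (s.comp t).Graph a c ↔ ∃ (T' : X) (r : T' ⟶ T) (b : T' ⟶ B.obj),
      IsCoverCart p r ∧ s.Graph (r ≫ a) b ∧ t.Graph b (r ≫ c) := by
  constructor
  · rintro ⟨T', r, x, hr, h₁, h₂⟩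
    change T' ⟶ pbDom s t at x
    change x ≫ (pbFst s t ≫ s.e) = r ≫ a at h₁
    change C.rel.Holds p (x ≫ (pbSnd s t ≫ t.f)) (r ≫ c) at h₂
    refine ⟨T', r, x ≫ pbFst s t ≫ s.f, hr, ?_, ?_⟩
    · refine ⟨T', 𝟙 _, x ≫ pbFst s t, IsCoverCart.id _, ?_, ?_⟩
      · rw [id_comp, assoc, h₁]
      · rw [id_comp, assoc]
        exact B.refl _
    · refine ⟨T', 𝟙 _, x ≫ pbSnd s t, IsCoverCart.id _, ?_, ?_⟩
      · rw [id_comp, assoc, pb_condition]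
      · rw [id_comp, assoc]
        exact h₂
  · rintro ⟨T', r, b, hr, ⟨T₁, t₁, x₁, ht₁, h₁, h₂⟩, ⟨T₂, t₂, x₂, ht₂, h₃, h₄⟩⟩
    -- pass to a common refinement, and lift `x₁` to the apex of the composite span
    obtain ⟨U, q₁, q₂, hq₁, hq⟩ := ht₂.exists_pullback t₁
    obtain ⟨V, v, y, hv, hy⟩ := (pbFst_cover s t).exists_pullback (q₁ ≫ x₁)
    refine ⟨V, v ≫ q₁ ≫ t₁ ≫ r, y, hv.comp (hq₁.comp (ht₁.comp hr)), ?_, ?_⟩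
    · change y ≫ (pbFst s t ≫ s.e) = _
      rw [← assoc, hy]
      simp only [assoc, h₁]
    · change C.rel.Holds p (y ≫ (pbSnd s t ≫ t.f)) _
      have k₁ : B.rel.Holds p ((y ≫ pbSnd s t) ≫ t.e) ((v ≫ q₂ ≫ x₂) ≫ t.e) := by
        have e₁ : (y ≫ pbSnd s t) ≫ t.e = (v ≫ q₁) ≫ x₁ ≫ s.f := by
          rw [assoc, pb_condition, ← assoc, hy]
          simp only [assoc]
        have e₂ : (v ≫ q₂ ≫ x₂) ≫ t.e = (v ≫ q₁) ≫ t₁ ≫ b := by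
          simp only [assoc, h₃]
          rw [← assoc q₂, hq, assoc]
        rw [e₁, e₂]
        exact h₂.precomp _
      have k₂ := t.compat _ _ k₁
      have k₃ := h₄.precomp (v ≫ q₂)
      have e₃ : (v ≫ q₂) ≫ t₂ ≫ r ≫ c = (v ≫ q₁ ≫ t₁ ≫ r) ≫ c := by
        simp only [assoc]
        rw [← assoc q₂, hq]
        simp only [assoc]
      rw [e₃] at k₃
      refine C.trans ?_ k₃
      simpa only [assoc] using k₂

lemma graph_precomp (s : TrackingSpan A B) {T U : X} (t : U ⟶ T)
    {c : T ⟶ A.obj} {d : T ⟶ B.obj} (h : s.Graph c d) : s.Graph (t ≫ c) (t ≫ d) := by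
  obtain ⟨T', r, x, hr, h₁, h₂⟩ := h
  obtain ⟨U', r', t', hr', ht⟩ := hr.exists_pullback t
  refine ⟨U', r', t' ≫ x, hr', by rw [assoc, h₁, ← assoc, ht, assoc], ?_⟩
  have := h₂.precomp t'
  rwa [← assoc t' r, ht, ← assoc, assoc r'] at this

/-- The tracked relation respects the equivalence relation on the target. -/
lemma graph_congr_right (s : TrackingSpan A B) {T : X} {c : T ⟶ A.obj} {d d' : T ⟶ B.obj}
    (h : s.Graph c d) (hd : B.rel.Holds p d d') : s.Graph c d' := by
  obtain ⟨T', r, x, hr, h₁, h₂⟩ := h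
  exact ⟨T', r, x, hr, h₁, B.trans h₂ (hd.precomp r)⟩

/-- The tracked relation respects the equivalence relation on the source. -/
lemma graph_congr_left (s : TrackingSpan A B) {T : X} {c c' : T ⟶ A.obj} {d : T ⟶ B.obj}
    (h : s.Graph c d) (hc : A.rel.Holds p c c') : s.Graph c' d := by
  obtain ⟨T', r, x, hr, h₁, h₂⟩ := h
  obtain ⟨U, q, y, hq, hy⟩ := s.cover.exists_pullback (r ≫ c')
  refine ⟨U, q ≫ r, y, hq.comp hr, by rw [hy, assoc], ?_⟩
  have k : A.rel.Holds p (y ≫ s.e) ((q ≫ x) ≫ s.e) := by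
    rw [hy, assoc, h₁]
    simpa only [assoc] using A.symm (hc.precomp (q ≫ r))
  have k' := h₂.precomp q
  refine B.trans (s.compat _ _ k) ?_
  simpa only [assoc] using k'

end TrackingSpan

/-- The category of presheaves on `p`: the total category of the fibration of presheaves. -/
noncomputable instance : Category (Presheaf p) where
  Hom A B := Quotient (TrackingSpan.setoid A B)
  id A := ⟦TrackingSpan.id A⟧
  comp {A B C} := Quotient.map₂ (fun s t => s.comp t) (by
    rintro s s' ⟨hw, hs⟩ t t' ⟨hw', ht⟩
    refine ⟨?_, fun T c d => ?_⟩
    · change s.w ≫ t.w = s'.w ≫ t'.w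
      rw [hw, hw']
    · simp only [TrackingSpan.graph_comp, hs, ht])
  id_comp {A B} := by
    rintro ⟨s⟩
    refine Quotient.sound ⟨id_comp _, fun T c d => ?_⟩
    rw [TrackingSpan.graph_comp]
    constructor
    · rintro ⟨T', r, b, hr, h₁, h₂⟩
      rw [TrackingSpan.id, TrackingSpan.graph_strict, comp_id] at h₁
      exact s.graph_of_cover hr (s.graph_congr_left h₂ (A.symm h₁))
    · intro h
      refine ⟨T, 𝟙 T, c, IsCoverCart.id T, ?_, by simpa using h⟩
      rw [TrackingSpan.id, TrackingSpan.graph_strict]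
      simpa using A.refl c
  comp_id {A B} := by
    rintro ⟨s⟩
    refine Quotient.sound ⟨comp_id _, fun T c d => ?_⟩
    rw [TrackingSpan.graph_comp]
    constructor
    · rintro ⟨T', r, b, hr, h₁, h₂⟩
      rw [TrackingSpan.id, TrackingSpan.graph_strict, comp_id] at h₂
      exact s.graph_of_cover hr (s.graph_congr_right h₁ h₂)
    · intro h
      refine ⟨T, 𝟙 T, d, IsCoverCart.id T, by simpa using h, ?_⟩
      rw [TrackingSpan.id, TrackingSpan.graph_strict]
      simpa using B.refl d
  assoc {A B C D} := by
    rintro ⟨s⟩ ⟨t⟩ ⟨q⟩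
    refine Quotient.sound ⟨assoc _ _ _, fun T a d => ?_⟩
    simp only [TrackingSpan.graph_comp]
    constructor
    · rintro ⟨T₁, r₁, c, hr₁, ⟨T₂, r₂, b, hr₂, h₁, h₂⟩, h₃⟩
      refine ⟨T₂, r₂ ≫ r₁, b, hr₂.comp hr₁, by simpa only [assoc] using h₁,
        T₂, 𝟙 _, r₂ ≫ c, IsCoverCart.id _, by simpa using h₂, ?_⟩
      simpa using q.graph_precomp r₂ h₃
    · rintro ⟨T₁, r₁, b, hr₁, h₁, ⟨T₂, r₂, c, hr₂, h₂, h₃⟩⟩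
      refine ⟨T₂, r₂ ≫ r₁, c, hr₂.comp hr₁, ⟨T₂, 𝟙 _, r₂ ≫ b, IsCoverCart.id _, ?_,
        by simpa using h₂⟩, by simpa only [assoc] using h₃⟩
      simpa using s.graph_precomp r₂ h₁

variable (p)

/-- The fibration of presheaves on `p`: `(u : J ⟶ I, C, ρ)` lies over `I`. -/
noncomputable def presheafFib : Presheaf p ⥤ R where
  obj A := A.base
  map := fun {A B} => Quotient.lift (fun s : TrackingSpan A B => s.w) (fun _ _ h => h.1)
  map_id _ := rfl
  map_comp := by
    rintro A B C ⟨s⟩ ⟨t⟩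
    rfl

/-- `(𝟙, C, =)`, the presheaf represented by `C`. -/
abbrev representable (C : X) : Presheaf p where
  base := p.obj C
  obj := C
  struct := 𝟙 _
  rel := SieveRel.mk C (𝟙 C) (𝟙 C)
  rel_struct := rfl
  refl {T} x := (holds_diag_iff C x x).2 ⟨T, 𝟙 T, IsCoverCart.id T, rfl⟩
  symm {T x y} h := by
    obtain ⟨T', e, he, h⟩ := (holds_diag_iff C x y).1 h
    exact (holds_diag_iff C y x).2 ⟨T', e, he, h.symm⟩
  trans {T x y z} h h' := by
    obtain ⟨T₁, e₁, he₁, h₁⟩ := (holds_diag_iff C x y).1 h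
    obtain ⟨T₂, e₂, he₂, h₂⟩ := (holds_diag_iff C y z).1 h'
    obtain ⟨U, q₁, q₂, hq, hh⟩ := he₂.exists_pullback e₁
    refine (holds_diag_iff C x z).2 ⟨U, q₁ ≫ e₁, hq.comp he₁, ?_⟩
    rw [assoc, h₁, ← assoc, ← hh, assoc, h₂, ← assoc]

lemma representable_rel_holds_iff (C : X) {T : X} (x y : T ⟶ C) :
    (representable p C).rel.Holds p x y ↔
      ∃ (T' : X) (e : T' ⟶ T), IsCoverCart p e ∧ e ≫ x = e ≫ y :=
  holds_diag_iff C x y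

/-- The strict span between representables induced by a morphism. -/
def yonedaSpan {C D : X} (f : C ⟶ D) : TrackingSpan (representable p C) (representable p D) :=
  TrackingSpan.strict (A := representable p C) (B := representable p D) (p.map f) f
    ((id_comp _).trans (comp_id _).symm) (fun {T} x y h => by
      obtain ⟨T', e, he, h⟩ := (representable_rel_holds_iff p C x y).1 h
      refine (representable_rel_holds_iff p D (x ≫ f) (y ≫ f)).2 ⟨T', e, he, ?_⟩
      rw [← assoc, h, assoc])

lemma graph_yonedaSpan {C D : X} (f : C ⟶ D) {T : X} (c : T ⟶ C) (d : T ⟶ D) :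
    (yonedaSpan p f).Graph c d ↔ (representable p D).rel.Holds p (c ≫ f) d :=
  TrackingSpan.graph_strict (A := representable p C) (B := representable p D) _ _ _ _ c d

/-- The fibered Yoneda embedding `C ↦ (𝟙, C, =)`. -/
noncomputable def yonedaFunctor : X ⥤ Presheaf p where
  obj C := representable p C
  map f := ⟦yonedaSpan p f⟧
  map_id C := Quotient.sound ⟨p.map_id C, fun T c d => by
    change (yonedaSpan p (𝟙 C)).Graph (T := T) c d ↔ _
    rw [graph_yonedaSpan, TrackingSpan.id, TrackingSpan.graph_strict]⟩
  map_comp {C D E} f g := Quotient.sound ⟨p.map_comp f g, fun T c d => by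
    rw [TrackingSpan.graph_comp]
    change (yonedaSpan p (f ≫ g)).Graph (T := T) c d ↔ _
    rw [graph_yonedaSpan]
    constructor
    · intro h
      refine ⟨T, 𝟙 T, (show T ⟶ C from c) ≫ f, IsCoverCart.id T, ?_, ?_⟩
      · refine (graph_yonedaSpan p f _ _).2 ?_
        rw [id_comp]
        exact (representable p D).refl _
      · refine (graph_yonedaSpan p g _ _).2 ?_
        rw [id_comp, assoc]
        exact h
    · rintro ⟨T', r, b, hr, h₁, h₂⟩
      replace h₁ := (graph_yonedaSpan p f _ _).1 h₁
      replace h₂ := (graph_yonedaSpan p g _ _).1 h₂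
      have h₃ := (yonedaSpan p g).compat _ _
        (show (representable p D).rel.Holds p (((r ≫ c) ≫ f) ≫ 𝟙 D) (b ≫ 𝟙 D) by
          rw [comp_id, comp_id]
          exact h₁)
      have h₄ := (representable p E).trans h₃ h₂
      refine SieveRel.Holds.of_cover hr ?_
      change (representable p E).rel.Holds p (((r ≫ c) ≫ f) ≫ g) (r ≫ d) at h₄
      simpa only [assoc] using h₄⟩

/-- The fibered Yoneda embedding as a functor over the base. -/
noncomputable def yoneda :
    BasedFunctor (BasedCategory.ofFunctor p) (BasedCategory.ofFunctor (presheafFib p)) where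
  toFunctor := yonedaFunctor p
  w := rfl

/-- The co-restriction of the fibered Yoneda embedding to the subfibration of indecomposable
projectives, given that representables are indecomposable projectives. -/
noncomputable def yonedaCorestrict
    (h : ∀ C : X, indecProj (presheafFib p) ((yonedaFunctor p).obj C)) :
    BasedFunctor (BasedCategory.ofFunctor p)
      (BasedCategory.ofFunctor (indecProjFib (presheafFib p))) where
  toFunctor := (indecProj (presheafFib p)).lift (yonedaFunctor p) h
  w := rfl

end Presheaf

end FibPresheaf

universe w₁ w₂

namespace FibPresheaf

/-! ### Cartesian and cocartesian maps -/

section Cartesian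

variable {R : Type u₁} [Category.{v₁} R] {X : Type u₂} [Category.{v₂} X] {p : X ⥤ R}

/-! A presheaf (u, C, ρ) is the quotient by ρ of the internal sum along u of the representable YC.
Presheaves are handled through generalized elements: a map a : T → C gives `el A a : YT → A`; two
elements agree exactly when ρ relates them (`el_eq_el_iff`); every map out of a representable is an
element after restriction along a cover-cartesian map (`exists_el`); and a map out of A is a map,
defined on a cover of C, that respects ρ (`exists_hom_of_el`).

Part (i). Forming a sum changes only u, so a presheaf and its sums have the same elements, and YC is
indecomposable. A vertical map of presheaves has an image, with relation pulled back from the target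
(this uses finite limits). For a regular epimorphism the image is everything, so elements lift
locally and YC is projective. Conversely, A is a vertical quotient of a sum of a representable. If A
is indecomposable and projective, its identity lifts locally through the quotient and the sum, so
some cover Q of A is a vertical retract of a representable. The idempotent comes from a fiber of the
pre-stack, where it splits, so Q is itself representable (`exists_coverCart_of_indecProj`).

Part (ii), necessity. Both conditions are invariant under equivalence, so they are checked for
presheaves. Coverings are the canonical presentations. A finite diagram of indecomposable
projectives becomes a diagram of representables over a common cover of the base. Its limit is
represented and maps cover-cartesianly onto the given limit, and being an indecomposable projective
descends along such maps (`indecProj_of_coverCart`).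

Part (ii), sufficiency. A covering A → X, together with an indecomposable projective cover of its
kernel pair, presents X by a presheaf. Indecomposable projectives lift locally along coverings, so
maps between objects correspond to maps between their presentations. Conversely, a presheaf on the
indecomposable projectives yields an equivalence relation in an exact fiber and presents its
quotient (`exists_presentation_of_presheaf`). Choosing presentations thus gives a fully faithful,
vertically essentially surjective functor. -/

lemma isHomLift_iff_map_eq {A B : X} {g : p.obj A ⟶ p.obj B} {f : A ⟶ B} :
    p.IsHomLift g f ↔ p.map f = g :=
  ⟨fun _ => (IsHomLift.eq_of_isHomLift p g f).symm, by rintro rfl; infer_instance⟩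

lemma isCart_iff {A B : X} {f : A ⟶ B} :
    IsCart p f ↔ ∀ ⦃T : X⦄ (φ : T ⟶ B) (g : p.obj T ⟶ p.obj A), g ≫ p.map f = p.map φ →
      ∃! χ : T ⟶ A, p.map χ = g ∧ χ ≫ f = φ := by
  constructor
  · intro h T φ g hg
    unfold IsCart at h
    have : p.IsHomLift (g ≫ p.map f) φ := isHomLift_iff_map_eq.2 hg.symm
    simpa only [isHomLift_iff_map_eq] using h.universal_property' (p := p) g φ
  · intro h
    refine { universal_property' := fun {T} g φ hφ => ?_ }
    simpa only [isHomLift_iff_map_eq] using h φ g (isHomLift_iff_map_eq.1 hφ).symm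

lemma isCocart_iff {A B : X} {f : A ⟶ B} :
    IsCocart p f ↔ ∀ ⦃T : X⦄ (φ : A ⟶ T) (g : p.obj B ⟶ p.obj T), p.map f ≫ g = p.map φ →
      ∃! χ : B ⟶ T, p.map χ = g ∧ f ≫ χ = φ := by
  constructor
  · intro h T φ g hg
    unfold IsCocart at h
    have : p.IsHomLift (p.map f ≫ g) φ := isHomLift_iff_map_eq.2 hg.symm
    simpa only [isHomLift_iff_map_eq] using h.universal_property' (p := p) g φ
  · intro h
    refine { universal_property' := fun {T} g φ hφ => ?_ }
    simpa only [isHomLift_iff_map_eq] using h φ g (isHomLift_iff_map_eq.1 hφ).symm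

lemma IsCart.exists_lift {A B T : X} {f : A ⟶ B} (hf : IsCart p f) (φ : T ⟶ B)
    (g : p.obj T ⟶ p.obj A) (hg : g ≫ p.map f = p.map φ) :
    ∃ χ : T ⟶ A, p.map χ = g ∧ χ ≫ f = φ :=
  (isCart_iff.1 hf φ g hg).exists

lemma IsCart.hom_ext {A B T : X} {f : A ⟶ B} (hf : IsCart p f) {χ χ' : T ⟶ A}
    (h : p.map χ = p.map χ') (h' : χ ≫ f = χ' ≫ f) : χ = χ' :=
  (isCart_iff.1 hf (χ' ≫ f) (p.map χ') (p.map_comp _ _).symm).unique ⟨h, h'⟩ ⟨rfl, rfl⟩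

lemma IsCocart.exists_desc {A B T : X} {f : A ⟶ B} (hf : IsCocart p f) (φ : A ⟶ T)
    (g : p.obj B ⟶ p.obj T) (hg : p.map f ≫ g = p.map φ) :
    ∃ χ : B ⟶ T, p.map χ = g ∧ f ≫ χ = φ :=
  (isCocart_iff.1 hf φ g hg).exists

lemma IsCocart.hom_ext {A B T : X} {f : A ⟶ B} (hf : IsCocart p f) {χ χ' : B ⟶ T}
    (h : p.map χ = p.map χ') (h' : f ≫ χ = f ≫ χ') : χ = χ' :=
  (isCocart_iff.1 hf (f ≫ χ') (p.map χ') (p.map_comp _ _).symm).unique ⟨h, h'⟩ ⟨rfl, rfl⟩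

lemma IsCart.of_lift {A B : X} {I J : R} {u : J ⟶ I} {f : A ⟶ B}
    (h : p.IsStronglyCartesian u f) : IsCart p f := by
  subst_hom_lift p u f
  exact h

lemma IsCocart.of_lift {A B : X} {I J : R} {u : J ⟶ I} {f : A ⟶ B}
    (h : p.IsStronglyCocartesian u f) : IsCocart p f := by
  subst_hom_lift p u f
  exact h

lemma IsCart.comp {A B C : X} {f : A ⟶ B} {g : B ⟶ C} (hf : IsCart p f) (hg : IsCart p g) :
    IsCart p (f ≫ g) := by
  unfold IsCart at *
  rw [p.map_comp]
  infer_instance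

lemma IsCart.of_comp {A B C : X} {f : A ⟶ B} {g : B ⟶ C} (hg : IsCart p g)
    (hfg : IsCart p (f ≫ g)) : IsCart p f := by
  unfold IsCart at *
  rw [p.map_comp] at hfg
  exact Functor.IsStronglyCartesian.of_comp (p := p) (g := p.map g) (ψ := g)

lemma IsCart.of_isIso {A B : X} (f : A ⟶ B) [IsIso f] : IsCart p f := by
  unfold IsCart
  infer_instance

lemma IsCoverCart.of_isIso {A B : X} (f : A ⟶ B) [IsIso f] : IsCoverCart p f :=
  ⟨inferInstance, IsCart.of_isIso f⟩

lemma isRegularEpi_map_of_isHomLift {A B : X} {I J : R} {u : J ⟶ I} {f : A ⟶ B}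
    (h : p.IsHomLift u f) (hu : IsRegularEpi u) : IsRegularEpi (p.map f) := by
  subst_hom_lift p u f
  exact hu

lemma isRegularEpi_of_isHomLift {A B : X} {I J : R} {u : J ⟶ I} {f : A ⟶ B}
    (h : p.IsHomLift u f) (hf : IsRegularEpi (p.map f)) : IsRegularEpi u := by
  subst_hom_lift p u f
  exact hf

lemma exists_cart [p.IsFibered] (A : X) {J : R} (u : J ⟶ p.obj A) :
    ∃ (A' : X) (f : A' ⟶ A), p.IsHomLift u f ∧ IsCart p f := by
  obtain ⟨A', f, h⟩ := Functor.IsPreFibered.exists_isCartesian' (p := p) u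
  exact ⟨A', f, inferInstance, IsCart.of_lift (u := u) inferInstance⟩

lemma exists_cart_pullback [HasPullbacks R] [p.IsFibered] (A : X) {I I' : R} (u : p.obj A ⟶ I)
    (w : I' ⟶ I) : ∃ (A' : X) (c : A' ⟶ A) (s : p.obj A' ⟶ I'),
      IsCart p c ∧ IsPullback (p.map c) s u w := by
  obtain ⟨A', c, hc, hc'⟩ := exists_cart A (pullback.fst u w)
  have key : ∀ {J : R} (f : J ⟶ p.obj A) (s : J ⟶ I'), IsPullback f s u w → p.IsHomLift f c →
      ∃ s' : p.obj A' ⟶ I', IsPullback (p.map c) s' u w := by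
    intro J f s h hf
    have hJ : p.obj A' = J := IsHomLift.domain_eq p f c
    subst hJ
    rw [isHomLift_iff_map_eq.1 hf]
    exact ⟨s, h⟩
  obtain ⟨s, hs⟩ := key _ _ (IsPullback.of_hasPullback u w) hc
  exact ⟨A', c, s, hc', hs⟩

/-- The kernel pair is `A` reindexed along the kernel pair of `p.map e`. The second projection is
cartesian because its composite with the cartesian `e` equals that of the first. -/
lemma IsCart.exists_kernelPair [HasPullbacks R] [p.IsFibered] {A B : X} {e : A ⟶ B}
    (he : IsCart p e) : ∃ (K : X) (k₁ k₂ : K ⟶ A), IsCart p k₁ ∧ IsCart p k₂ ∧ k₁ ≫ e = k₂ ≫ e ∧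
      IsKernelPair (p.map e) (p.map k₁) (p.map k₂) ∧
      ∀ ⦃T : X⦄ (x y : T ⟶ A), x ≫ e = y ≫ e → ∃ z : T ⟶ K, z ≫ k₁ = x ∧ z ≫ k₂ = y := by
  obtain ⟨K, k₁, s, hk₁, hs⟩ := exists_cart_pullback A (p.map e) (p.map e)
  obtain ⟨k₂, rfl, h₂⟩ := he.exists_lift (k₁ ≫ e) s (by rw [p.map_comp, hs.w])
  refine ⟨K, k₁, k₂, hk₁, he.of_comp (h₂ ▸ hk₁.comp he), h₂.symm, hs, fun T x y hxy => ?_⟩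
  have hp : p.map x ≫ p.map e = p.map y ≫ p.map e := by rw [← p.map_comp, hxy, p.map_comp]
  obtain ⟨z, hz, hz'⟩ := hk₁.exists_lift x (hs.lift _ _ hp) (hs.lift_fst _ _ _)
  refine ⟨z, hz', he.hom_ext ?_ ?_⟩
  · rw [p.map_comp, hz, hs.lift_snd]
  · rw [assoc, h₂, ← assoc, hz', hxy]

/-- Cartesian test pairs suffice since the kernel pair of `e` has cartesian projections. This keeps
descent conditions inside a full subfibration. -/
lemma IsCart.coequalizes_of_cart [HasPullbacks R] [p.IsFibered] {A B C : X} {e : A ⟶ B}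
    (he : IsCart p e) {f : A ⟶ C}
    (h : ∀ ⦃K : X⦄ (x y : K ⟶ A), IsCart p x → IsCart p y → x ≫ e = y ≫ e → x ≫ f = y ≫ f)
    ⦃T : X⦄ (x y : T ⟶ A) (hxy : x ≫ e = y ≫ e) : x ≫ f = y ≫ f := by
  obtain ⟨K, k₁, k₂, h₁, h₂, hk, -, hK⟩ := he.exists_kernelPair
  obtain ⟨z, rfl, rfl⟩ := hK x y hxy
  rw [assoc, assoc, h k₁ k₂ h₁ h₂ hk]

lemma IsCoverCart.exists_base_desc [HasPullbacks R] [p.IsFibered] {A B C : X} {e : A ⟶ B}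
    (he : IsCoverCart p e) {f : A ⟶ C}
    (h : ∀ ⦃K : X⦄ (x y : K ⟶ A), IsCart p x → IsCart p y → x ≫ e = y ≫ e → x ≫ f = y ≫ f) :
    ∃ w : p.obj B ⟶ p.obj C, p.map e ≫ w = p.map f := by
  obtain ⟨K, k₁, k₂, h₁, h₂, hk, hK, -⟩ := he.2.exists_kernelPair
  have := he.1
  exact ⟨Cofork.IsColimit.desc (hK.toCoequalizer') (p.map f)
    (by rw [← p.map_comp, h _ _ h₁ h₂ hk, p.map_comp]), Cofork.IsColimit.π_desc hK.toCoequalizer'⟩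

/-- The pullback of a cover-cartesian map is cover-cartesian and universal. -/
lemma IsCart.exists_pullback_cart [HasPullbacks R] [p.IsFibered] {A B T : X} {e : A ⟶ B}
    (he : IsCart p e) (c : T ⟶ B) (hc : IsCart p c) : ∃ (T' : X) (e' : T' ⟶ T) (c' : T' ⟶ A),
      IsCart p e' ∧ IsCart p c' ∧ c' ≫ e = e' ≫ c ∧
        IsPullback (p.map e') (p.map c') (p.map c) (p.map e) := by
  obtain ⟨T', e', s, he', hs⟩ := exists_cart_pullback T (p.map c) (p.map e)
  obtain ⟨c', rfl, h⟩ := he.exists_lift (e' ≫ c) s (by rw [p.map_comp, hs.w])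
  exact ⟨T', e', c', he', he.of_comp (h ▸ he'.comp hc), h, hs⟩

lemma IsCoverCart.exists_pullback_cart [Regular R] [p.IsFibered] {A B T : X} {e : A ⟶ B}
    (he : IsCoverCart p e) (c : T ⟶ B) (hc : IsCart p c) :
    ∃ (T' : X) (e' : T' ⟶ T) (c' : T' ⟶ A),
      IsCoverCart p e' ∧ IsCart p c' ∧ c' ≫ e = e' ≫ c := by
  obtain ⟨T', e', c', he', hc', h, hs⟩ := he.2.exists_pullback_cart c hc
  exact ⟨T', e', c', ⟨Regular.regularEpiIsStableUnderBaseChange.of_isPullback hs.flip he.1, he'⟩,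
    hc', h⟩

end Cartesian

/-! ### Descent along cover-cartesian maps -/

section Descent

variable {R : Type u₁} [Category.{v₁} R] {X : Type u₂} [Category.{v₂} X] {p : X ⥤ R}

lemma reindex_map_lift [p.IsFibered] {J I : R} (u : J ⟶ I) {A B : p.Fiber I} (f : A ⟶ B) :
    ((reindex p u).map f).1 ≫ reindexLift p u B = reindexLift p u A ≫ f.1 := by
  have := f.2
  exact Functor.IsCartesian.fac p u (Functor.IsPreFibered.pullbackMap B.2 u)
    (Functor.IsPreFibered.pullbackMap A.2 u ≫ f.1)

lemma reindex_map_lift_assoc [p.IsFibered] {J I : R} (u : J ⟶ I) {A B : p.Fiber I} (f : A ⟶ B)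
    {Z : X} (h : B.1 ⟶ Z) :
    ((reindex p u).map f).1 ≫ reindexLift p u B ≫ h = reindexLift p u A ≫ f.1 ≫ h := by
  rw [← assoc, reindex_map_lift, assoc]

lemma canonicalDescentDatum_fac [p.IsFibered] {K J I : R} (d₀ d₁ : K ⟶ J) (e : J ⟶ I)
    (h : d₀ ≫ e = d₁ ≫ e) (A : p.Fiber I) :
    (canonicalDescentDatum p d₀ d₁ e h A).1 ≫ reindexLift p d₀ ((reindex p e).obj A) ≫
      reindexLift p e A = reindexLift p d₁ ((reindex p e).obj A) ≫ reindexLift p e A := by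
  have : p.IsHomLift (d₀ ≫ e) (reindexLift p d₁ ((reindex p e).obj A) ≫ reindexLift p e A) := by
    rw [h]; infer_instance
  exact Functor.IsCartesian.fac p (d₀ ≫ e)
    (reindexLift p d₀ ((reindex p e).obj A) ≫ reindexLift p e A) _

lemma fiber_hom_ext_of_cart [p.IsFibered] {K I : R} {u : K ⟶ I} {A B : p.Fiber K} {C : X}
    (c : B.1 ⟶ C) [p.IsCartesian u c] {f g : A ⟶ B} (h : f.1 ≫ c = g.1 ≫ c) : f = g := by
  have := f.2
  have := g.2
  exact Subtype.ext (Functor.IsCartesian.ext p u c _ _ h)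

variable [Regular R]

/-- Maps from `e^* A` to `e^* B` in the fiber are maps from `e^* A` to `B` over `e`. Compatibility
with the descent data then follows from coequalizing all pairs that `e` identifies. -/
lemma existsUnique_descent_vertical [IsPrestack p] {A' A : X} {e : A' ⟶ A}
    (he : IsCoverCart p e) (B : p.Fiber (p.obj A)) (f : A' ⟶ B.1) (hf : p.IsHomLift (p.map e) f)
    (h : ∀ ⦃T : X⦄ (x y : T ⟶ A'), x ≫ e = y ≫ e → x ≫ f = y ≫ f) :
    ∃! g : A ⟶ B.1, p.IsHomLift (𝟙 (p.obj A)) g ∧ e ≫ g = f := by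
  obtain ⟨he₁, he₂⟩ := he
  unfold IsCart at he₂
  let A₀ : p.Fiber (p.obj A) := ⟨A, rfl⟩
  let θ := Functor.IsCartesian.domainUniqueUpToIso p (p.map e) e (reindexLift p (p.map e) A₀)
  have hθ : θ.hom ≫ e = reindexLift p (p.map e) A₀ := Functor.IsCartesian.fac p (p.map e) e _
  let f' : (reindex p (p.map e)).obj A₀ ⟶ (reindex p (p.map e)).obj B :=
    ⟨Functor.IsCartesian.map p (p.map e) (reindexLift p (p.map e) B) (θ.hom ≫ f), inferInstance⟩
  have hf' : f'.1 ≫ reindexLift p (p.map e) B = θ.hom ≫ f :=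
    Functor.IsCartesian.fac p (p.map e) (reindexLift p (p.map e) B) (θ.hom ≫ f)
  have key := IsPrestack.existsUnique_descent (p.map e) A₀ B f' (by
    refine fiber_hom_ext_of_cart (u := pullback.fst (p.map e) (p.map e) ≫ p.map e)
      (reindexLift p _ ((reindex p (p.map e)).obj B) ≫ reindexLift p _ B) ?_
    change ((canonicalDescentDatum p _ _ _ _ A₀).1 ≫ ((reindex p _).map f').1) ≫ _ =
      (((reindex p _).map f').1 ≫ (canonicalDescentDatum p _ _ _ _ B).1) ≫ _
    rw [assoc, reindex_map_lift_assoc, assoc, canonicalDescentDatum_fac, reindex_map_lift_assoc,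
      hf', ← assoc (reindexLift p _ _) θ.hom, ← assoc (canonicalDescentDatum p _ _ _ _ A₀).1,
      ← assoc (reindexLift p _ _) θ.hom]
    apply h
    simp only [assoc, hθ]
    exact canonicalDescentDatum_fac _ _ _ _ A₀)
  have iff : ∀ g : A₀ ⟶ B, (reindex p (p.map e)).map g = f' ↔ e ≫ g.1 = f := by
    intro g
    rw [← cancel_epi θ.hom, ← assoc, hθ, ← hf', ← reindex_map_lift]
    exact ⟨fun h => by rw [h], fun h => fiber_hom_ext_of_cart (u := p.map e) _ h⟩
  obtain ⟨g, hg, hu⟩ := key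
  exact ⟨g.1, ⟨g.2, (iff g).1 hg⟩, fun g' hg' =>
    congrArg Subtype.val (hu ⟨g', hg'.1⟩ ((iff _).2 hg'.2))⟩

/-- In a pre-stack, morphisms descend along cover-cartesian maps. -/
lemma IsCoverCart.existsUnique_desc [IsPrestack p] {A' A B : X} {e : A' ⟶ A}
    (he : IsCoverCart p e) (f : A' ⟶ B)
    (h : ∀ ⦃T : X⦄ (x y : T ⟶ A'), IsCart p x → IsCart p y → x ≫ e = y ≫ e → x ≫ f = y ≫ f) :
    ∃! g : A ⟶ B, e ≫ g = f := by
  obtain ⟨w, hw⟩ := he.exists_base_desc h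
  have hall := he.2.coequalizes_of_cart h
  -- Reindexing `B` along the descended base map `w` reduces the problem to vertical descent.
  obtain ⟨B', b, hb, hb'⟩ := exists_cart B w
  have hB' : p.obj B' = p.obj A := IsHomLift.domain_eq p w b
  have hbw : p.map b = eqToHom hB' ≫ w := by simpa using IsHomLift.fac' p w b
  obtain ⟨f', hf', hf'b⟩ := hb'.exists_lift f (p.map e ≫ eqToHom hB'.symm)
    (by rw [hbw, assoc, eqToHom_trans_assoc, eqToHom_refl, id_comp, hw])
  have hlift : p.IsHomLift (p.map e) f' :=
    IsHomLift.of_fac' p _ _ rfl hB' (by rw [hf']; simp)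
  have hall' : ∀ ⦃T : X⦄ (x y : T ⟶ A'), x ≫ e = y ≫ e → x ≫ f' = y ≫ f' := fun T x y hxy => by
    refine hb'.hom_ext ?_ (by rw [assoc, hf'b, assoc, hf'b, hall x y hxy])
    rw [p.map_comp, p.map_comp, hf', ← assoc, ← assoc, ← p.map_comp, ← p.map_comp, hxy]
  obtain ⟨g, ⟨-, hg⟩, hu⟩ := existsUnique_descent_vertical he ⟨B', hB'⟩ f' hlift hall'
  refine ⟨g ≫ b, show e ≫ g ≫ b = f by rw [← assoc, hg, hf'b], fun g' hg' => ?_⟩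
  have := he.1
  have hpg' : p.map g' = w := by
    rw [← cancel_epi (p.map e), hw, ← p.map_comp, hg']
  obtain ⟨g'', hg'', rfl⟩ := hb'.exists_lift g' (eqToHom hB'.symm) (by rw [hbw, hpg']; simp)
  rw [hu g'' ⟨IsHomLift.of_fac' p _ _ rfl hB' (by rw [hg'']; simp), ?_⟩]
  refine hb'.hom_ext ?_ (by rw [assoc, hg', hf'b])
  rw [p.map_comp, hg'', hf']

lemma IsCoverCart.cancel [IsPrestack p] {A' A B : X} {e : A' ⟶ A}
    (he : IsCoverCart p e) {g g' : A ⟶ B} (h : e ≫ g = e ≫ g') : g = g' :=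
  (he.existsUnique_desc (e ≫ g') (fun T x y _ _ hxy => by rw [← assoc, hxy, assoc])).unique h rfl

/-- Descent of morphisms along cover-cartesian maps characterizes pre-stacks. -/
lemma IsPrestack.of_descent [p.IsFibered]
    (H : ∀ ⦃A' A B : X⦄ (e : A' ⟶ A) (f : A' ⟶ B), IsCoverCart p e →
      (∀ ⦃T : X⦄ (x y : T ⟶ A'), x ≫ e = y ≫ e → x ≫ f = y ≫ f) → ∃! g : A ⟶ B, e ≫ g = f) :
    IsPrestack p where
  existsUnique_descent {J I} e _ A B f hf := by
    have cov : IsCoverCart p (reindexLift p e A) :=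
      ⟨isRegularEpi_map_of_isHomLift (u := e) inferInstance inferInstance,
        IsCart.of_lift (u := e) inferInstance⟩
    have hf2 := f.2
    have key := H (reindexLift p e A) (f.1 ≫ reindexLift p e B) cov (by
      intro T x y hxy
      have hJ : p.obj ((reindex p e).obj A).1 = J := ((reindex p e).obj A).2
      have hx : p.IsHomLift (p.map x ≫ eqToHom hJ) x := inferInstance
      have hy : p.IsHomLift (p.map y ≫ eqToHom hJ) y := inferInstance
      have hl : p.map (reindexLift p e A) = eqToHom hJ ≫ e ≫ eqToHom A.2.symm :=
        IsHomLift.fac' p e (reindexLift p e A)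
      have hk : (p.map x ≫ eqToHom hJ) ≫ e = (p.map y ≫ eqToHom hJ) ≫ e := by
        have := congrArg (fun k => p.map k) hxy
        simp only [p.map_comp, hl] at this
        rw [← cancel_mono (eqToHom A.2.symm)]
        simpa [← assoc] using this
      -- The pair `x`, `y` factors over the kernel pair of `e` in the base. Below, `x'` and `y'` are
      -- its factorizations through the two reindexings of `e^* A`, which the canonical descent
      -- datum identifies.
      let k := pullback.lift _ _ hk
      have hx' : p.map x ≫ eqToHom hJ = k ≫ pullback.fst e e := (pullback.lift_fst _ _ _).symm
      have hy' : p.map y ≫ eqToHom hJ = k ≫ pullback.snd e e := (pullback.lift_snd _ _ _).symm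
      let l₀ := reindexLift p (pullback.fst e e) ((reindex p e).obj A)
      let l₁ := reindexLift p (pullback.snd e e) ((reindex p e).obj A)
      obtain ⟨x', ⟨hx₁, hx₂⟩, -⟩ := Functor.IsStronglyCartesian.universal_property p
        (pullback.fst e e) l₀ k _ hx' x
      obtain ⟨y', ⟨hy₁, hy₂⟩, -⟩ := Functor.IsStronglyCartesian.universal_property p
        (pullback.snd e e) l₁ k _ hy' y
      have hd := (canonicalDescentDatum p (pullback.fst e e) (pullback.snd e e) e
        pullback.condition A).2
      have hyx : y' ≫ (canonicalDescentDatum p (pullback.fst e e) (pullback.snd e e) e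
          pullback.condition A).1 = x' := by
        refine Functor.IsStronglyCartesian.ext p (pullback.fst e e ≫ e)
          (l₀ ≫ reindexLift p e A) k ?_
        rw [assoc, canonicalDescentDatum_fac, ← assoc x', hx₂, ← assoc y', hy₂, hxy]
      have hf' := congrArg (fun k => k.1 ≫
        reindexLift p _ ((reindex p e).obj B) ≫ reindexLift p _ B) hf
      change ((canonicalDescentDatum p _ _ _ _ A).1 ≫ ((reindex p _).map f).1) ≫ _ =
        (((reindex p _).map f).1 ≫ (canonicalDescentDatum p _ _ _ _ B).1) ≫ _ at hf'
      rw [assoc, reindex_map_lift_assoc, assoc, canonicalDescentDatum_fac,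
        reindex_map_lift_assoc] at hf'
      rw [← hx₂, ← hy₂, ← hyx]
      simp only [assoc]
      rw [← hf'])
    obtain ⟨g, hg, hu⟩ := key
    have iff : ∀ g : A ⟶ B, (reindex p e).map g = f ↔
        reindexLift p e A ≫ g.1 = f.1 ≫ reindexLift p e B := by
      intro g
      rw [← reindex_map_lift]
      exact ⟨fun h => by rw [h], fun h => fiber_hom_ext_of_cart (u := e) _ h⟩
    have hgl : p.IsHomLift (𝟙 I) g := by
      have h₁ : p.IsHomLift e (reindexLift p e A ≫ g) := by rw [hg]; infer_instance
      refine IsHomLift.of_fac' p _ _ A.2 B.2 ?_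
      have h₂ := IsHomLift.fac' p e (reindexLift p e A ≫ g)
      rw [p.map_comp, IsHomLift.fac' p e (reindexLift p e A)] at h₂
      simp only [assoc, eqToHom_comp_iff, cancel_epi] at h₂
      rw [h₂]
      simp
    exact ⟨⟨g, hgl⟩, (iff _).2 hg, fun g' hg' => Subtype.ext (hu g'.1 ((iff g').1 hg'))⟩

end Descent

/-! ### Finite limits in the fibers and maps of the total category -/

section FiberLimits

variable {R : Type u₁} [Category.{v₁} R] {X : Type u₂} [Category.{v₂} X] {p : X ⥤ R}

/-- A map from `T` over `t` is a vertical map into the reindexing along `t`. Preservation of the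
limit therefore upgrades it to a universal property against maps over `t`. -/
lemma existsUnique_lift_of_reindex [p.IsFibered] {L : R} {T : X} (t : p.obj T ⟶ L)
    {K : Type w₁} [Category.{w₂} K] [PreservesLimitsOfShape K (reindex p t)] {F : K ⥤ p.Fiber L}
    {c : Cone F} (hc : IsLimit c) (φ : ∀ k, T ⟶ (F.obj k).1) (hφ : ∀ k, p.IsHomLift t (φ k))
    (hn : ∀ ⦃k l : K⦄ (a : k ⟶ l), φ k ≫ (F.map a).1 = φ l) :
    ∃! ψ : T ⟶ c.pt.1, p.IsHomLift t ψ ∧ ∀ k, ψ ≫ (c.π.app k).1 = φ k := by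
  let T₀ : p.Fiber (p.obj T) := ⟨T, rfl⟩
  let φ' : ∀ k, T₀ ⟶ (reindex p t).obj (F.obj k) := fun k =>
    ⟨Functor.IsCartesian.map p t (reindexLift p t (F.obj k)) (φ k), inferInstance⟩
  have hφ' : ∀ k, (φ' k).1 ≫ reindexLift p t (F.obj k) = φ k := fun k =>
    Functor.IsCartesian.fac p t (reindexLift p t (F.obj k)) (φ k)
  let s : Cone (F ⋙ reindex p t) :=
    { pt := T₀
      π := { app := φ'
             naturality := fun k l a => by
              refine fiber_hom_ext_of_cart (u := t) (reindexLift p t (F.obj l)) ?_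
              change (𝟙 T ≫ (φ' l).1) ≫ _ = ((φ' k).1 ≫ ((reindex p t).map (F.map a)).1) ≫ _
              rw [id_comp, hφ', assoc, reindex_map_lift, ← assoc, hφ', hn] } }
  have hl := isLimitOfPreserves (reindex p t) hc
  have hfac : ∀ k, (hl.lift s).1 ≫ ((reindex p t).map (c.π.app k)).1 = (φ' k).1 := fun k =>
    congrArg Subtype.val (hl.fac s k)
  have h0 := (hl.lift s).2
  refine ⟨(hl.lift s).1 ≫ reindexLift p t c.pt, ⟨inferInstance, fun k => ?_⟩, ?_⟩
  · rw [assoc, ← reindex_map_lift, ← assoc]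
    exact (congrArg (· ≫ reindexLift p t (F.obj k)) (hfac k)).trans (hφ' k)
  · rintro ψ ⟨hψ, hψ'⟩
    let ψ' : T₀ ⟶ (reindex p t).obj c.pt :=
      ⟨Functor.IsCartesian.map p t (reindexLift p t c.pt) ψ, inferInstance⟩
    have hψ'' : ψ'.1 ≫ reindexLift p t c.pt = ψ :=
      Functor.IsCartesian.fac p t (reindexLift p t c.pt) ψ
    have : ψ' = hl.lift s := hl.hom_ext fun k => by
      rw [hl.fac]
      refine fiber_hom_ext_of_cart (u := t) (reindexLift p t (F.obj k)) ?_
      change (ψ'.1 ≫ ((reindex p t).map (c.π.app k)).1) ≫ _ = (φ' k).1 ≫ _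
      rw [assoc, reindex_map_lift, ← assoc]
      exact (congrArg (· ≫ (c.π.app k).1) hψ'').trans ((hψ' k).trans (hφ' k).symm)
    rw [← hψ'', this]

lemma fiber_hom_ext_of_cocart {K I : R} {u : K ⟶ I} {A : X} {B C : p.Fiber I} (s : A ⟶ B.1)
    [p.IsCocartesian u s] {f g : B ⟶ C} (h : s ≫ f.1 = s ≫ g.1) : f = g := by
  have := f.2
  have := g.2
  exact Subtype.ext (Functor.IsCocartesian.ext p u s _ _ h)

/-- Here sums replace preservation: a map from `T` over `t` is a vertical map out of the sum of `T`
along `t`, so any limit in a fiber is universal against such maps. -/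
lemma existsUnique_lift_of_cocart
    (H : ∀ (A : X) {I : R} (u : p.obj A ⟶ I), ∃ (B : X) (s : A ⟶ B), p.IsStronglyCocartesian u s)
    {L : R} {T : X} (t : p.obj T ⟶ L)
    {K : Type w₁} [Category.{w₂} K] {F : K ⥤ p.Fiber L}
    {c : Cone F} (hc : IsLimit c) (φ : ∀ k, T ⟶ (F.obj k).1) (hφ : ∀ k, p.IsHomLift t (φ k))
    (hn : ∀ ⦃k l : K⦄ (a : k ⟶ l), φ k ≫ (F.map a).1 = φ l) :
    ∃! ψ : T ⟶ c.pt.1, p.IsHomLift t ψ ∧ ∀ k, ψ ≫ (c.π.app k).1 = φ k := by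
  obtain ⟨B, σ, hσ⟩ := H T t
  let B₀ : p.Fiber L := ⟨B, IsHomLift.codomain_eq p t σ⟩
  let φ' : ∀ k, B₀ ⟶ F.obj k := fun k =>
    ⟨Functor.IsCocartesian.map p t σ (φ k), inferInstance⟩
  have hφ' : ∀ k, σ ≫ (φ' k).1 = φ k := fun k => Functor.IsCocartesian.fac p t σ (φ k)
  let s : Cone F :=
    { pt := B₀
      π := { app := φ'
             naturality := fun k l a => by
              refine fiber_hom_ext_of_cocart (B := B₀) (u := t) σ ?_
              change σ ≫ (𝟙 B ≫ (φ' l).1) = σ ≫ ((φ' k).1 ≫ (F.map a).1)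
              rw [id_comp, hφ', ← assoc, hφ', hn] } }
  have hfac : ∀ k, (hc.lift s).1 ≫ (c.π.app k).1 = (φ' k).1 := fun k =>
    congrArg Subtype.val (hc.fac s k)
  have h0 := (hc.lift s).2
  refine ⟨σ ≫ (hc.lift s).1, ⟨inferInstance, fun k => ?_⟩, ?_⟩
  · rw [assoc, hfac, hφ']
  · rintro ψ ⟨hψ, hψ'⟩
    let ψ' : B₀ ⟶ c.pt := ⟨Functor.IsCocartesian.map p t σ ψ, inferInstance⟩
    have hψ'' : σ ≫ ψ'.1 = ψ := Functor.IsCocartesian.fac p t σ ψ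
    have : ψ' = hc.lift s := hc.hom_ext fun k => by
      rw [hc.fac]
      refine fiber_hom_ext_of_cocart (B := B₀) (u := t) σ ?_
      change σ ≫ (ψ'.1 ≫ (c.π.app k).1) = σ ≫ (φ' k).1
      rw [← assoc, hφ']
      exact (congrArg (· ≫ (c.π.app k).1) hψ'').trans (hψ' k)
    rw [← hψ'', this]

/-- The total category of a finite-limit pre-stack has (weak) pullbacks. -/
lemma IsFiniteLimitPrestack.exists_weakPullback [Regular R] [IsFiniteLimitPrestack p] {A B C : X}
    (f : A ⟶ C) (g : B ⟶ C) : ∃ (P : X) (a : P ⟶ A) (b : P ⟶ B), a ≫ f = b ≫ g ∧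
      ∀ ⦃T : X⦄ (x : T ⟶ A) (y : T ⟶ B), x ≫ f = y ≫ g → ∃ z : T ⟶ P, z ≫ a = x ∧ z ≫ b = y := by
  let l₁ := pullback.fst (p.map f) (p.map g)
  let l₂ := pullback.snd (p.map f) (p.map g)
  have hl : l₁ ≫ p.map f = l₂ ≫ p.map g := pullback.condition
  let A₀ : p.Fiber (p.obj A) := ⟨A, rfl⟩
  let B₀ : p.Fiber (p.obj B) := ⟨B, rfl⟩
  let C₀ : p.Fiber (p.obj C) := ⟨C, rfl⟩
  let rA := reindexLift p l₁ A₀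
  let rB := reindexLift p l₂ B₀
  let rC := reindexLift p (l₁ ≫ p.map f) C₀
  have hA : p.IsHomLift (l₁ ≫ p.map f) (rA ≫ f) := inferInstance
  have hB : p.IsHomLift (l₁ ≫ p.map f) (rB ≫ g) := by rw [hl]; infer_instance
  let f' : (reindex p l₁).obj A₀ ⟶ (reindex p (l₁ ≫ p.map f)).obj C₀ :=
    ⟨Functor.IsCartesian.map p (l₁ ≫ p.map f) rC (rA ≫ f), inferInstance⟩
  let g' : (reindex p l₂).obj B₀ ⟶ (reindex p (l₁ ≫ p.map f)).obj C₀ :=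
    ⟨Functor.IsCartesian.map p (l₁ ≫ p.map f) rC (rB ≫ g), inferInstance⟩
  have hf' : f'.1 ≫ rC = rA ≫ f :=
    Functor.IsCartesian.fac p (l₁ ≫ p.map f) rC (rA ≫ f)
  have hg' : g'.1 ≫ rC = rB ≫ g :=
    Functor.IsCartesian.fac p (l₁ ≫ p.map f) rC (rB ≫ g)
  have := IsFiniteLimitPrestack.hasFiniteLimits (p := p) (pullback (p.map f) (p.map g))
  -- The pullback is formed in the fiber over the pullback of the base maps. Its universality
  -- against `T` comes from reindexing the square along the base map `t` of `T`.
  have sq := IsPullback.of_hasPullback f' g'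
  let a := pullback.fst f' g'
  let b := pullback.snd f' g'
  have hab : a.1 ≫ f'.1 = b.1 ≫ g'.1 := congrArg Subtype.val sq.w
  refine ⟨(pullback f' g').1, a.1 ≫ rA, b.1 ≫ rB, ?_, fun T x y hxy => ?_⟩
  · rw [assoc, ← hf', ← assoc, hab, assoc, assoc, hg']
  · let t : p.obj T ⟶ pullback (p.map f) (p.map g) :=
      pullback.lift (p.map x) (p.map y) (by rw [← p.map_comp, hxy, p.map_comp])
    obtain ⟨x', ⟨hx₁, hx₂⟩, -⟩ := Functor.IsStronglyCartesian.universal_property p l₁ rA t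
      (p.map x) (pullback.lift_fst _ _ _).symm x
    obtain ⟨y', ⟨hy₁, hy₂⟩, -⟩ := Functor.IsStronglyCartesian.universal_property p l₂ rB t
      (p.map y) (pullback.lift_snd _ _ _).symm y
    have hf'2 := f'.2
    have hg'2 := g'.2
    have hxy' : x' ≫ f'.1 = y' ≫ g'.1 := by
      refine Functor.IsStronglyCartesian.ext p (l₁ ≫ p.map f) rC t ?_
      rw [assoc, hf', ← assoc, hx₂, assoc, hg', ← assoc, hy₂, hxy]
    have := IsFiniteLimitPrestack.preservesFiniteLimits (p := p) t
    have sq' := sq.map (reindex p t)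
    let T₀ : p.Fiber (p.obj T) := ⟨T, rfl⟩
    let x₀ : T₀ ⟶ (reindex p t).obj ((reindex p l₁).obj A₀) :=
      ⟨Functor.IsCartesian.map p t (reindexLift p t _) x', inferInstance⟩
    let y₀ : T₀ ⟶ (reindex p t).obj ((reindex p l₂).obj B₀) :=
      ⟨Functor.IsCartesian.map p t (reindexLift p t _) y', inferInstance⟩
    have hx₀ : x₀.1 ≫ reindexLift p t _ = x' :=
      Functor.IsCartesian.fac p t (reindexLift p t _) x'
    have hy₀ : y₀.1 ≫ reindexLift p t _ = y' :=
      Functor.IsCartesian.fac p t (reindexLift p t _) y'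
    have h₀ : x₀ ≫ (reindex p t).map f' = y₀ ≫ (reindex p t).map g' := by
      refine fiber_hom_ext_of_cart (u := t) (reindexLift p t _) ?_
      change (x₀.1 ≫ ((reindex p t).map f').1) ≫ _ = (y₀.1 ≫ ((reindex p t).map g').1) ≫ _
      rw [assoc, reindex_map_lift, ← assoc, hx₀, assoc, reindex_map_lift, ← assoc, hy₀, hxy']
    have e₁ : (sq'.lift x₀ y₀ h₀).1 ≫ ((reindex p t).map a).1 = x₀.1 :=
      congrArg Subtype.val (sq'.lift_fst x₀ y₀ h₀)
    have e₂ : (sq'.lift x₀ y₀ h₀).1 ≫ ((reindex p t).map b).1 = y₀.1 :=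
      congrArg Subtype.val (sq'.lift_snd x₀ y₀ h₀)
    refine ⟨(sq'.lift x₀ y₀ h₀).1 ≫ reindexLift p t _, ?_, ?_⟩
    · rw [assoc, ← reindex_map_lift_assoc, ← assoc, e₁, ← assoc, hx₀, hx₂]
    · rw [assoc, ← reindex_map_lift_assoc, ← assoc, e₂, ← assoc, hy₀, hy₂]

end FiberLimits

/-! ### Full subfibrations -/

section FullSubfibration

variable {R : Type u₁} [Category.{v₁} R] {X : Type u₂} [Category.{v₂} X] {p : X ⥤ R}

lemma IsCart.of_map {Y : Type u₃} [Category.{v₃} Y] (F : Y ⥤ X) [F.Full] [F.Faithful] {A B : Y}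
    {f : A ⟶ B} (h : IsCart p (F.map f)) : IsCart (F ⋙ p) f := by
  rw [isCart_iff] at h ⊢
  intro T φ g hg
  obtain ⟨χ, ⟨h₁, h₂⟩, hu⟩ := h (F.map φ) g hg
  refine ⟨F.preimage χ, ⟨by simpa using h₁, F.map_injective (by simpa using h₂)⟩, fun χ' hχ' => ?_⟩
  apply F.map_injective
  rw [F.map_preimage]
  exact hu _ ⟨hχ'.1, by rw [← F.map_comp, hχ'.2]⟩

lemma IsCart.exists_iso {A B C : X} {f : A ⟶ C} {g : B ⟶ C} (hf : IsCart p f) (hg : IsCart p g)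
    (i : p.obj A ≅ p.obj B) (hi : i.hom ≫ p.map g = p.map f) :
    ∃ θ : A ≅ B, p.map θ.hom = i.hom ∧ θ.hom ≫ g = f := by
  obtain ⟨a, ha, ha'⟩ := hg.exists_lift f i.hom hi
  obtain ⟨b, hb, hb'⟩ := hf.exists_lift g i.inv (by rw [← hi, Iso.inv_hom_id_assoc])
  exact ⟨⟨a, b, hf.hom_ext (by simp [ha, hb]) (by rw [assoc, hb', ha', id_comp]),
    hg.hom_ext (by simp [ha, hb]) (by rw [assoc, ha', hb', id_comp])⟩, ha, ha'⟩

variable (P : ObjectProperty X) (hP : ∀ ⦃A' A : X⦄ (f : A' ⟶ A), IsCart p f → P A → P A')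

-- A map cartesian in the subfibration is compared with an ambient cartesian lift. That lift stays
-- in the subfibration by `hP`, so the two are isomorphic.
include hP in
lemma isCart_fullSubcategory_iff [p.IsFibered] {A B : P.FullSubcategory} (f : A ⟶ B) :
    IsCart (P.ι ⋙ p) f ↔ IsCart p f.hom := by
  refine ⟨fun h => ?_, fun h => IsCart.of_map P.ι h⟩
  obtain ⟨A', c, hc, hc'⟩ := exists_cart B.obj (p.map f.hom)
  let A'' : P.FullSubcategory := ⟨A', hP c hc' B.2⟩
  let c' : A'' ⟶ B := ObjectProperty.homMk c
  have hA' : p.obj A' = p.obj A.obj := IsHomLift.domain_eq p (p.map f.hom) c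
  obtain ⟨θ, hθ, hθ'⟩ := h.exists_iso (f := f) (g := c') (IsCart.of_map P.ι hc')
    (eqToIso hA'.symm) (by
      have := IsHomLift.fac' p (p.map f.hom) c
      change eqToHom hA'.symm ≫ p.map c = p.map f.hom
      rw [this]
      simp)
  rw [← hθ']
  exact (IsCart.of_isIso (p := p) θ.hom.hom).comp hc'

include hP in
lemma isCoverCart_fullSubcategory_iff [p.IsFibered] {A B : P.FullSubcategory} (f : A ⟶ B) :
    IsCoverCart (P.ι ⋙ p) f ↔ IsCoverCart p f.hom :=
  and_congr Iff.rfl (isCart_fullSubcategory_iff P hP f)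

include hP in
lemma isFibered_fullSubcategory [p.IsFibered] : (P.ι ⋙ p).IsFibered :=
  Functor.IsFibered.of_exists_isStronglyCartesian fun A J u => by
    obtain ⟨A', c, hc, hc'⟩ := exists_cart A.obj u
    let A'' : P.FullSubcategory := ⟨A', hP c hc' A.2⟩
    let c' : A'' ⟶ A := ObjectProperty.homMk c
    refine ⟨A'', c', ?_⟩
    have h : IsCart (P.ι ⋙ p) c' := IsCart.of_map P.ι hc'
    have hc'' : (P.ι ⋙ p).IsHomLift u c' :=
      IsHomLift.of_fac' (P.ι ⋙ p) u c' (IsHomLift.domain_eq p u c) rfl (IsHomLift.fac' p u c)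
    unfold IsCart at h
    have key : ∀ {K L : R} (d : K ⟶ L), (P.ι ⋙ p).IsHomLift d c' →
        (P.ι ⋙ p).IsStronglyCartesian d c' := by
      intro K L d hd
      subst_hom_lift (P.ι ⋙ p) d c'
      exact h
    exact key u hc''

include hP in
lemma isPrestack_fullSubcategory [Regular R] [IsPrestack p] : IsPrestack (P.ι ⋙ p) := by
  have := isFibered_fullSubcategory P hP
  refine IsPrestack.of_descent fun A' A B e f he h => ?_
  have he' := (isCoverCart_fullSubcategory_iff P hP e).1 he
  -- Only cartesian test pairs are needed, and `hP` puts their source in the subfibration.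
  obtain ⟨g, hg, hu⟩ := he'.existsUnique_desc f.hom fun T x y hx _ hxy =>
    congrArg InducedCategory.Hom.hom (h (T := ⟨T, hP x hx A'.2⟩) (ObjectProperty.homMk x)
      (ObjectProperty.homMk y) (ObjectProperty.hom_ext _ hxy))
  exact ⟨ObjectProperty.homMk g, ObjectProperty.hom_ext _ hg, fun g' hg' =>
    ObjectProperty.hom_ext _ (hu g'.hom (congrArg InducedCategory.Hom.hom hg'))⟩

end FullSubfibration

/-! ### Stability of indecomposable projectives -/

section IndecProj

variable {R : Type u₁} [Category.{v₁} R] {X : Type u₂} [Category.{v₂} X] {p : X ⥤ R}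

/-- Automatic because both properties quantify over all cartesian maps into the object. -/
lemma indecProj_of_cart ⦃A' A : X⦄ (f : A' ⟶ A) (hf : IsCart p f) (hA : indecProj p A) :
    indecProj p A' :=
  ⟨fun _ _ _ c g s hc hs => hA.1 (c ≫ f) g s (hc.comp hf) hs,
    fun _ _ _ c g e hc he => hA.2 (c ≫ f) g e (hc.comp hf) he⟩

/-- Liftings along cocartesian maps exist on the cover, and their uniqueness makes them agree on
pairs identified by it, so they descend. Projectivity asks only for local liftings, so composing
with the cover is enough. -/
lemma indecProj_of_coverCart [Regular R] [IsPrestack p] {A' A : X} {e : A' ⟶ A}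
    (he : IsCoverCart p e) (hA : indecProj p A') : indecProj p A := by
  constructor
  · intro D B S c f s hc hs
    obtain ⟨D', e', c', he', hc', -⟩ := he.exists_pullback_cart c hc
    obtain ⟨m, hm, -⟩ := hA.1 c' (e' ≫ f) s hc' hs
    obtain ⟨n, hn, -⟩ := he'.existsUnique_desc m fun T x y hx hy hxy =>
      (hA.1 (x ≫ c') (x ≫ e' ≫ f) s (hx.comp hc') hs).unique (by rw [assoc, hm])
        (by rw [assoc, hm, ← assoc, ← assoc, hxy])
    refine ⟨n, he'.cancel (by rw [← assoc, hn, hm]), fun n' hn' => he'.cancel ?_⟩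
    exact (hA.1 c' (e' ≫ f) s hc' hs).unique (by rw [assoc, hn']) (by rw [hn, hm])
  · intro D A B c f v hc hv
    obtain ⟨D', e', c', he', hc', -⟩ := he.exists_pullback_cart c hc
    obtain ⟨Q, d, g, hd, hg⟩ := hA.2 c' (e' ≫ f) v hc' hv
    exact ⟨Q, d ≫ e', g, hd.comp he', by rw [hg, assoc]⟩

scoped instance isFibered_indecProjFib [p.IsFibered] : (indecProjFib p).IsFibered :=
  isFibered_fullSubcategory _ indecProj_of_cart

lemma isPrestack_indecProjFib [Regular R] [IsPrestack p] : IsPrestack (indecProjFib p) :=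
  isPrestack_fullSubcategory _ indecProj_of_cart

lemma isCoverCart_indecProjFib_iff [p.IsFibered] {A B : (indecProj p).FullSubcategory}
    (f : A ⟶ B) : IsCoverCart (indecProjFib p) f ↔ IsCoverCart p f.hom :=
  isCoverCart_fullSubcategory_iff _ indecProj_of_cart f

end IndecProj

/-! ### Generalized elements of presheaves -/

section Elements

variable {R : Type u₁} [Category.{v₁} R] {X : Type u₂} [Category.{v₂} X] {p : X ⥤ R}

lemma Presheaf.base_eq_of_rel {A : Presheaf p} {T : X} {x y : T ⟶ A.obj}
    (h : A.rel.Holds p x y) : p.map x ≫ A.struct = p.map y ≫ A.struct := by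
  obtain ⟨T', e, k, he, h₁, h₂⟩ := h
  have := he.1
  rw [← cancel_epi (p.map e), ← assoc, ← assoc, ← p.map_comp, ← p.map_comp, ← h₁, ← h₂,
    p.map_comp, p.map_comp, assoc, assoc, A.rel_struct]

variable [Regular R] [p.IsFibered]

namespace TrackingSpan

variable {A B C : Presheaf p}

/-- The morphism tracked by a span. -/
def hom (s : TrackingSpan A B) : A ⟶ B := Quotient.mk _ s

lemma hom_eq_iff {s s' : TrackingSpan A B} : s.hom = s'.hom ↔
    s.w = s'.w ∧ ∀ (T : X) (c : T ⟶ A.obj) (d : T ⟶ B.obj), s.Graph c d ↔ s'.Graph c d :=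
  Quotient.eq

lemma hom_comp_hom (s : TrackingSpan A B) (t : TrackingSpan B C) :
    s.hom ≫ t.hom = (s.comp t).hom := rfl

lemma exists_hom_eq (φ : A ⟶ B) : ∃ s : TrackingSpan A B, s.hom = φ := Quotient.exists_rep φ

end TrackingSpan

/-- The action of the Yoneda embedding on morphisms. -/
noncomputable def yMap {C D : X} (f : C ⟶ D) : representable p C ⟶ representable p D :=
  (yonedaFunctor p).map f

lemma yMap_id (C : X) : yMap (𝟙 C) = 𝟙 (representable p C) := (yonedaFunctor p).map_id C

lemma yMap_comp {C D E : X} (f : C ⟶ D) (g : D ⟶ E) :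
    yMap (p := p) (f ≫ g) = yMap f ≫ yMap g := (yonedaFunctor p).map_comp f g

/-- The component in the base of a morphism of presheaves. -/
noncomputable def baseMap {A B : Presheaf p} (φ : A ⟶ B) : A.base ⟶ B.base :=
  (presheafFib p).map φ

lemma baseMap_id (A : Presheaf p) : baseMap (𝟙 A) = 𝟙 A.base := rfl

lemma baseMap_comp {A B C : Presheaf p} (φ : A ⟶ B) (ψ : B ⟶ C) :
    baseMap (φ ≫ ψ) = baseMap φ ≫ baseMap ψ := (presheafFib p).map_comp φ ψ

lemma baseMap_yMap {C D : X} (f : C ⟶ D) : baseMap (yMap (p := p) f) = p.map f := rfl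

lemma isCart_presheaf_iff {A B : Presheaf p} {m : A ⟶ B} :
    IsCart (presheafFib p) m ↔ ∀ ⦃T : Presheaf p⦄ (φ : T ⟶ B) (g : T.base ⟶ A.base),
      g ≫ baseMap m = baseMap φ → ∃! χ : T ⟶ A, baseMap χ = g ∧ χ ≫ m = φ :=
  isCart_iff

lemma isCocart_presheaf_iff {A B : Presheaf p} {m : A ⟶ B} :
    IsCocart (presheafFib p) m ↔ ∀ ⦃T : Presheaf p⦄ (φ : A ⟶ T) (g : B.base ⟶ T.base),
      baseMap m ≫ g = baseMap φ → ∃! χ : B ⟶ T, baseMap χ = g ∧ m ≫ χ = φ :=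
  isCocart_iff

/-- The span of a generalized element `a : T ⟶ A.obj` of a presheaf. -/
def elSpan (A : Presheaf p) {T : X} (a : T ⟶ A.obj) :
    TrackingSpan (representable p T) A :=
  TrackingSpan.strict (A := representable p T) (B := A) (p.map a ≫ A.struct) a (id_comp _)
    fun {U} x y h => by
      obtain ⟨U', e, he, h⟩ := (representable_rel_holds_iff p T x y).1 h
      refine SieveRel.Holds.of_cover he ?_
      rw [← assoc, h, assoc]
      exact A.refl _

/-- The morphism from a representable presheaf given by a generalized element. -/
noncomputable def el (A : Presheaf p) {T : X} (a : T ⟶ A.obj) : representable p T ⟶ A :=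
  (elSpan A a).hom

lemma baseMap_el (A : Presheaf p) {T : X} (a : T ⟶ A.obj) :
    baseMap (el A a) = p.map a ≫ A.struct := rfl

lemma graph_elSpan (A : Presheaf p) {T U : X} (a : T ⟶ A.obj) (c : U ⟶ T) (d : U ⟶ A.obj) :
    (elSpan A a).Graph c d ↔ A.rel.Holds p (c ≫ a) d :=
  TrackingSpan.graph_strict (A := representable p T) (B := A) _ _ _ _ c d

lemma graph_elSpan_comp {A B : Presheaf p} (s : TrackingSpan A B) {T U : X} (a : T ⟶ A.obj)
    (c : U ⟶ T) (d : U ⟶ B.obj) : ((elSpan A a).comp s).Graph c d ↔ s.Graph (c ≫ a) d := by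
  rw [TrackingSpan.graph_comp]
  constructor
  · rintro ⟨T', r, b, hr, h₁, h₂⟩
    have h₁' := (graph_elSpan A a _ _).1 h₁
    have h₃ := s.graph_congr_left h₂ (A.symm h₁')
    have : (show T' ⟶ T from r ≫ c) ≫ a = r ≫ c ≫ a := assoc _ _ _
    exact s.graph_of_cover hr (this ▸ h₃)
  · intro h
    refine ⟨U, 𝟙 U, c ≫ a, IsCoverCart.id U, (graph_elSpan A a _ _).2 ?_, by simpa using h⟩
    have : (𝟙 U ≫ c) ≫ a = c ≫ a := by rw [id_comp]
    exact this ▸ A.refl _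

/-- Evaluating both graphs at the identity of `T` recovers the relation. Judgments about the
relation thereby become equations between morphisms. -/
lemma el_eq_el_iff (A : Presheaf p) {T : X} (a b : T ⟶ A.obj) :
    el A a = el A b ↔ A.rel.Holds p a b := by
  constructor
  · intro h
    have := ((TrackingSpan.hom_eq_iff.1 h).2 T (𝟙 T) b).2
      ((graph_elSpan A b (𝟙 T) b).2 (by rw [id_comp]; exact A.refl b))
    simpa using (graph_elSpan A a (𝟙 T) b).1 this
  · intro h
    refine TrackingSpan.hom_eq_iff.2 ⟨Presheaf.base_eq_of_rel h, fun U c d => ?_⟩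
    change U ⟶ T at c
    rw [graph_elSpan, graph_elSpan]
    exact ⟨fun h' => A.trans (A.symm (h.precomp c)) h', fun h' => A.trans (h.precomp c) h'⟩

lemma yMap_eq_el {C D : X} (f : C ⟶ D) :
    yMap f = el (representable p D) f := by
  change (yonedaSpan p f).hom = (elSpan (representable p D) f).hom
  refine TrackingSpan.hom_eq_iff.2 ⟨(comp_id _).symm, fun T c d => ?_⟩
  change T ⟶ C at c
  rw [graph_yonedaSpan, graph_elSpan]

lemma yMap_comp_el {A : Presheaf p} {T U : X} (f : U ⟶ T) (a : T ⟶ A.obj) :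
    yMap f ≫ el A a = el A (f ≫ a) := by
  rw [yMap_eq_el]
  change (elSpan (representable p T) f).hom ≫ (elSpan A a).hom = (elSpan A (f ≫ a)).hom
  rw [TrackingSpan.hom_comp_hom]
  refine TrackingSpan.hom_eq_iff.2 ⟨?_, fun V c d => ?_⟩
  · change (p.map f ≫ 𝟙 _) ≫ p.map a ≫ A.struct = p.map (f ≫ a) ≫ A.struct
    simp
  · change V ⟶ U at c
    rw [graph_elSpan_comp (A := representable p T), graph_elSpan]
    rw [graph_elSpan, assoc]

lemma yMap_comp_el_assoc {A B : Presheaf p} {T U : X} (f : U ⟶ T) (a : T ⟶ A.obj) (φ : A ⟶ B) :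
    yMap f ≫ el A a ≫ φ = el A (f ≫ a) ≫ φ := by
  rw [← assoc, yMap_comp_el]

lemma el_comp_strict {A B : Presheaf p} (w : A.base ⟶ B.base) (f : A.obj ⟶ B.obj) (comm)
    (compat) {T : X} (a : T ⟶ A.obj) :
    el A a ≫ (TrackingSpan.strict w f comm compat).hom = el B (a ≫ f) := by
  change (elSpan A a).hom ≫ _ = (elSpan B (a ≫ f)).hom
  rw [TrackingSpan.hom_comp_hom]
  refine TrackingSpan.hom_eq_iff.2 ⟨?_, fun V c d => ?_⟩
  · change (p.map a ≫ A.struct) ≫ w = p.map (a ≫ f) ≫ B.struct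
    rw [assoc, comm, p.map_comp, assoc]
  · change V ⟶ T at c
    rw [graph_elSpan_comp, TrackingSpan.graph_strict, graph_elSpan, assoc]

lemma el_comp_hom {A B : Presheaf p} (s : TrackingSpan A B) : el A s.e ≫ s.hom = el B s.f := by
  change (elSpan A s.e).hom ≫ _ = (elSpan B s.f).hom
  rw [TrackingSpan.hom_comp_hom]
  refine TrackingSpan.hom_eq_iff.2 ⟨?_, fun V c d => ?_⟩
  · exact (assoc _ _ _).trans s.comm
  · change V ⟶ s.dom at c
    rw [graph_elSpan_comp, graph_elSpan]
    constructor
    · rintro ⟨T', t, x, ht, h₁, h₂⟩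
      refine SieveRel.Holds.of_cover ht (B.trans ?_ h₂)
      rw [← assoc]
      apply s.compat
      rw [h₁, assoc]
      exact A.refl _
    · intro h
      exact ⟨V, 𝟙 V, c, IsCoverCart.id V, (id_comp _).symm, by simpa using h⟩

/-- Morphisms of presheaves agree if they agree over the base and on a generic element. -/
lemma hom_ext_of_el {A B : Presheaf p} {φ φ' : A ⟶ B}
    (hw : baseMap φ = baseMap φ') {T : X} {t : T ⟶ A.obj}
    (ht : IsCoverCart p t) (h : el A t ≫ φ = el A t ≫ φ') : φ = φ' := by
  obtain ⟨s, rfl⟩ := TrackingSpan.exists_hom_eq φ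
  obtain ⟨s', rfl⟩ := TrackingSpan.exists_hom_eq φ'
  refine TrackingSpan.hom_eq_iff.2 ⟨hw, fun U c d => ?_⟩
  have h' := (TrackingSpan.hom_eq_iff (s := (elSpan A t).comp s) (s' := (elSpan A t).comp s')).1 h
  obtain ⟨V, e, c', he, hc⟩ := ht.exists_pullback c
  have key := h'.2 V c' (e ≫ d)
  rw [graph_elSpan_comp, graph_elSpan_comp, hc] at key
  exact ⟨fun h => s'.graph_of_cover he (key.1 (s.graph_precomp e h)),
    fun h => s.graph_of_cover he (key.2 (s'.graph_precomp e h))⟩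

lemma yoneda_cancel {T' T : X} {t : T' ⟶ T} (ht : IsCoverCart p t) {A : Presheaf p}
    {ψ ψ' : representable p T ⟶ A}
    (h : yMap t ≫ ψ = yMap t ≫ ψ') : ψ = ψ' := by
  have := ht.1
  refine hom_ext_of_el ?_ (A := representable p T) (t := t) ht ?_
  · have := congrArg (fun k => baseMap k) h
    simp only [baseMap_comp] at this
    exact (cancel_epi (p.map t)).1 this
  · rw [← yMap_eq_el, h]

lemma exists_el_of_hom {A B : Presheaf p} (φ : A ⟶ B) : ∃ (T : X) (t : T ⟶ A.obj)
    (b : T ⟶ B.obj), IsCoverCart p t ∧ el A t ≫ φ = el B b := by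
  obtain ⟨s, rfl⟩ := TrackingSpan.exists_hom_eq φ
  exact ⟨s.dom, s.e, s.f, s.cover, el_comp_hom s⟩

/-- Morphisms from representables are locally given by generalized elements. -/
lemma exists_el {T : X} {A : Presheaf p} (ψ : representable p T ⟶ A) :
    ∃ (T' : X) (t : T' ⟶ T) (a : T' ⟶ A.obj), IsCoverCart p t ∧
      yMap t ≫ ψ = el A a := by
  obtain ⟨T', t, a, ht, h⟩ := exists_el_of_hom ψ
  exact ⟨T', t, a, ht, by rw [yMap_eq_el]; exact h⟩

/-- The universal property of a presheaf as a quotient of a sum of representables. -/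
lemma exists_hom_of_el {A B : Presheaf p} {T : X} {t : T ⟶ A.obj} (ht : IsCoverCart p t)
    (w : A.base ⟶ B.base) (ψ : representable p T ⟶ B)
    (hψ : baseMap ψ = p.map t ≫ A.struct ≫ w)
    (h : ∀ ⦃U : X⦄ (x y : U ⟶ T), A.rel.Holds p (x ≫ t) (y ≫ t) →
      yMap x ≫ ψ = yMap y ≫ ψ) :
    ∃ φ : A ⟶ B, baseMap φ = w ∧ el A t ≫ φ = ψ := by
  -- `ψ` is an element of `B` only locally, so the apex of the tracking span is a cover `E` of `T`.
  obtain ⟨E, e, f, he, hf⟩ := exists_el ψ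
  let s : TrackingSpan A B :=
    { w := w
      dom := E
      e := e ≫ t
      f := f
      cover := he.comp ht
      comm := by
        rw [← baseMap_el, ← hf, baseMap_comp, hψ, p.map_comp, assoc, baseMap_yMap]
      compat := fun {U} x y hxy => by
        rw [← el_eq_el_iff, ← yMap_comp_el, ← yMap_comp_el, ← hf, ← assoc, ← assoc,
          ← yMap_comp, ← yMap_comp]
        apply h
        simpa only [assoc] using hxy }
  refine ⟨s.hom, rfl, yoneda_cancel he ?_⟩
  rw [yMap_comp_el_assoc, hf]
  exact el_comp_hom s

/-- No descent in `p` is needed: the relation of a representable is equality up to a cover. The base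
component descends because a regular epimorphism is the coequalizer of its kernel pair. -/
lemma exists_yoneda_desc {C' C : X} {c : C' ⟶ C} (hc : IsCoverCart p c) {B : Presheaf p}
    (ψ : representable p C' ⟶ B)
    (h : ∀ ⦃U : X⦄ (x y : U ⟶ C'), x ≫ c = y ≫ c →
      yMap x ≫ ψ = yMap y ≫ ψ) :
    ∃ φ : representable p C ⟶ B, yMap c ≫ φ = ψ := by
  obtain ⟨K, k₁, k₂, -, -, hk, hK, -⟩ := hc.2.exists_kernelPair
  have hreg := hc.1
  have hb := congrArg (fun k => baseMap k) (h k₁ k₂ hk)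
  simp only [baseMap_comp] at hb
  let w := Cofork.IsColimit.desc (hK.toCoequalizer') (baseMap ψ) hb
  have hw : p.map c ≫ w = baseMap ψ := Cofork.IsColimit.π_desc hK.toCoequalizer'
  obtain ⟨φ, -, hφ⟩ := exists_hom_of_el (A := representable p C) (t := c) hc w ψ
    (by rw [← hw]; exact congrArg _ (id_comp w).symm) (fun U x y hxy => by
      obtain ⟨V, e, he, hxy⟩ := (representable_rel_holds_iff p C _ _).1 hxy
      refine yoneda_cancel he ?_
      rw [← assoc, ← assoc, ← yMap_comp, ← yMap_comp]
      exact h _ _ (by simpa only [assoc] using hxy))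
  exact ⟨φ, by rw [yMap_eq_el]; exact hφ⟩

/-- A morphism which reflects the equivalence relations is a monomorphism relative to the base. -/
lemma hom_ext_of_reflects {A B : Presheaf p} {m : A ⟶ B}
    (hm : ∀ ⦃T : X⦄ (x y : T ⟶ A.obj), el A x ≫ m = el A y ≫ m →
      p.map x ≫ A.struct = p.map y ≫ A.struct → A.rel.Holds p x y)
    {Z : Presheaf p} {χ χ' : Z ⟶ A} (hw : baseMap χ = baseMap χ')
    (h : χ ≫ m = χ' ≫ m) : χ = χ' := by
  obtain ⟨T, t, a, ht, ha⟩ := exists_el_of_hom χ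
  obtain ⟨T', t', a', ht', ha'⟩ := exists_el (el Z t ≫ χ')
  rw [yMap_comp_el_assoc] at ha'
  have ha'' : el Z (t' ≫ t) ≫ χ = el A (t' ≫ a) := by
    rw [← yMap_comp_el_assoc, ha, yMap_comp_el]
  refine hom_ext_of_el hw (ht'.comp ht) ?_
  rw [ha', ha'', el_eq_el_iff]
  refine hm _ _ ?_ ?_
  · rw [← ha', ← ha'', assoc, assoc, h]
  · rw [← baseMap_el, ← baseMap_el, ← ha', ← ha'', baseMap_comp, baseMap_comp, hw]

/-- A factorization is built from a lift `hl` of a generic element. By `hm` the relation of `A` is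
detected by the images in `B` together with the base components, which makes the factorization well
defined and unique. -/
lemma isCart_of_el {A B : Presheaf p} {m : A ⟶ B}
    (hm : ∀ ⦃T : X⦄ (x y : T ⟶ A.obj), el A x ≫ m = el A y ≫ m →
      p.map x ≫ A.struct = p.map y ≫ A.struct → A.rel.Holds p x y)
    (hl : ∀ ⦃T : X⦄ (b : T ⟶ B.obj) (g : p.obj T ⟶ A.base),
      g ≫ baseMap m = p.map b ≫ B.struct → ∃ a : T ⟶ A.obj,
        el A a ≫ m = el B b ∧ p.map a ≫ A.struct = g) : IsCart (presheafFib p) m := by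
  rw [isCart_presheaf_iff]
  intro Z φ g hg
  obtain ⟨T, t, b, ht, hb⟩ := exists_el_of_hom φ
  obtain ⟨a, ha, ha'⟩ := hl b (p.map t ≫ Z.struct ≫ g) (by
    rw [← baseMap_el, ← hb, baseMap_comp, ← hg, assoc, assoc, baseMap_el, assoc])
  obtain ⟨χ, hχ, hχ'⟩ := exists_hom_of_el (A := Z) ht g (el A a) ha' (fun U x y hxy => by
    rw [yMap_comp_el, yMap_comp_el, el_eq_el_iff]
    refine hm _ _ ?_ ?_
    · rw [← yMap_comp_el, ← yMap_comp_el, assoc, ha, assoc, ha, ← hb,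
        yMap_comp_el_assoc, yMap_comp_el_assoc, (el_eq_el_iff Z _ _).2 hxy]
    · rw [p.map_comp, assoc, ha', p.map_comp, assoc, ha']
      simpa only [p.map_comp, assoc] using
        congrArg (fun k : p.obj U ⟶ Z.base => k ≫ g) (Presheaf.base_eq_of_rel hxy))
  have hχφ : χ ≫ m = φ := by
    refine hom_ext_of_el (by rw [baseMap_comp, hχ, hg]) ht ?_
    rw [← assoc, hχ', ha, hb]
  refine ⟨χ, ⟨hχ, hχφ⟩, fun χ' hχ'' => ?_⟩
  exact hom_ext_of_reflects hm (hχ''.1.trans hχ.symm) (hχ''.2.trans hχφ.symm)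

end Elements

/-! ### The fibration of presheaves is a pre-stack and an opfibration -/

section PresheafFibration

variable {R : Type u₁} [Category.{v₁} R] [Regular R] {X : Type u₂} [Category.{v₂} X]
  {p : X ⥤ R} [p.IsFibered]

lemma isCart_yMap {C D : X} {f : C ⟶ D} (hf : IsCart p f) :
    IsCart (presheafFib p) (yMap (p := p) f) := by
  refine isCart_of_el ?_ ?_
  · intro T x y h h'
    rw [comp_id, comp_id] at h'
    rw [← yMap_eq_el, ← yMap_eq_el, ← yMap_comp, ← yMap_comp, yMap_eq_el, yMap_eq_el, el_eq_el_iff,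
      representable_rel_holds_iff] at h
    obtain ⟨T', t, ht, h⟩ := h
    refine (representable_rel_holds_iff p C x y).2 ⟨T', t, ht, hf.hom_ext ?_ ?_⟩
    · rw [p.map_comp, p.map_comp, h']
    · simpa only [assoc] using h
  · intro T b g hg
    rw [comp_id, baseMap_yMap] at hg
    obtain ⟨a, ha, ha'⟩ := hf.exists_lift b g hg
    exact ⟨a, by rw [← yMap_eq_el, ← yMap_comp, ha', yMap_eq_el], (comp_id _).trans ha⟩

lemma isCoverCart_yMap {C D : X} {f : C ⟶ D} (hf : IsCoverCart p f) :
    IsCoverCart (presheafFib p) (yMap f) :=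
  ⟨hf.1, isCart_yMap hf.2⟩

/-- The carrier is `ρ.dom` pulled back to `I'`, so related elements must also have the same
component in `I'`. -/
lemma SieveRel.exists_reindex {C C' : X} (ρ : SieveRel C C) {I I' : R} {u : p.obj C ⟶ I}
    (hρ : p.map ρ.fst ≫ u = p.map ρ.snd ≫ u) {w : I' ⟶ I} {c : C' ⟶ C} (hc : IsCart p c)
    {s : p.obj C' ⟶ I'} (hs : IsPullback (p.map c) s u w) :
    ∃ ρ' : SieveRel C' C', p.map ρ'.fst ≫ s = p.map ρ'.snd ≫ s ∧
      ∀ {T : X} (x y : T ⟶ C'), ρ'.Holds p x y ↔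
        ρ.Holds p (x ≫ c) (y ≫ c) ∧ p.map x ≫ s = p.map y ≫ s := by
  obtain ⟨D', d, r, hd, hr⟩ := exists_cart_pullback ρ.dom (p.map ρ.fst ≫ u) w
  obtain ⟨a, ha, ha'⟩ := hc.exists_lift (d ≫ ρ.fst)
    (hs.lift (p.map (d ≫ ρ.fst)) r (by rw [p.map_comp, assoc, hr.w])) (hs.lift_fst _ _ _)
  obtain ⟨b, hb, hb'⟩ := hc.exists_lift (d ≫ ρ.snd)
    (hs.lift (p.map (d ≫ ρ.snd)) r (by rw [p.map_comp, assoc, ← hρ, hr.w])) (hs.lift_fst _ _ _)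
  have has : p.map a ≫ s = r := by rw [ha, hs.lift_snd]
  have hbs : p.map b ≫ s = r := by rw [hb, hs.lift_snd]
  refine ⟨⟨D', a, b⟩, has.trans hbs.symm, fun {T} x y => ⟨?_, ?_⟩⟩
  · rintro ⟨T', t, k, ht, h₁, h₂⟩
    dsimp at k h₁ h₂
    refine ⟨⟨T', t, k ≫ d, ht, ?_, ?_⟩, ?_⟩
    · rw [assoc, ← ha', ← assoc, h₁, assoc]
    · rw [assoc, ← hb', ← assoc, h₂, assoc]
    · have := ht.1
      rw [← cancel_epi (p.map t), ← assoc, ← assoc, ← p.map_comp, ← p.map_comp, ← h₁, ← h₂,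
        p.map_comp, p.map_comp, assoc, assoc, has, hbs]
  · rintro ⟨⟨T', t, k, ht, h₁, h₂⟩, hxy⟩
    obtain ⟨k', hk, hk'⟩ := hd.exists_lift k
      (hr.lift (p.map k) (p.map t ≫ p.map x ≫ s) (by
        rw [← assoc, ← p.map_comp, h₁, p.map_comp, p.map_comp]
        simp only [assoc, hs.w])) (hr.lift_fst _ _ _)
    refine ⟨T', t, k', ht, hc.hom_ext (hs.hom_ext ?_ ?_) ?_, hc.hom_ext (hs.hom_ext ?_ ?_) ?_⟩
    · rw [← p.map_comp, ← p.map_comp, assoc, ha', ← assoc, hk', h₁, assoc]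
    · rw [p.map_comp, assoc, has, hk, hr.lift_snd, p.map_comp, assoc]
    · rw [assoc, ha', ← assoc, hk', h₁, assoc]
    · rw [← p.map_comp, ← p.map_comp, assoc, hb', ← assoc, hk', h₂, assoc]
    · rw [p.map_comp, assoc, hbs, hk, hr.lift_snd, p.map_comp, assoc, hxy]
    · rw [assoc, hb', ← assoc, hk', h₂, assoc]

/-- Reindexing pulls the generating object back along `w` and keeps the relation between elements
with the same component in the new base. -/
lemma exists_cart_presheaf (A : Presheaf p) {I' : R} (w : I' ⟶ A.base) :
    ∃ (A' : Presheaf p) (m : A' ⟶ A), (presheafFib p).IsHomLift w m ∧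
      IsCart (presheafFib p) m := by
  obtain ⟨C', c, s, hc, hs⟩ := exists_cart_pullback A.obj A.struct w
  obtain ⟨ρ', hρ', hiff⟩ := A.rel.exists_reindex A.rel_struct hc hs
  let A' : Presheaf p :=
    { base := I'
      obj := C'
      struct := s
      rel := ρ'
      rel_struct := hρ'
      refl := fun x => (hiff x x).2 ⟨A.refl _, rfl⟩
      symm := fun {T x y} h => (hiff y x).2 ⟨A.symm ((hiff x y).1 h).1, ((hiff x y).1 h).2.symm⟩
      trans := fun {T x y z} h h' => (hiff x z).2 ⟨A.trans ((hiff x y).1 h).1 ((hiff y z).1 h').1,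
        ((hiff x y).1 h).2.trans ((hiff y z).1 h').2⟩ }
  let m : A' ⟶ A := (TrackingSpan.strict (A := A') (B := A) w c hs.w.symm
    (fun {T} x y h => ((hiff x y).1 h).1)).hom
  have hel : ∀ {T : X} (a : T ⟶ C'), el A' a ≫ m = el A (a ≫ c) := fun {T} a =>
    el_comp_strict (A := A') (B := A) w c _ _ a
  refine ⟨A', m, (isHomLift_iff_map_eq (p := presheafFib p)).2 rfl, isCart_of_el ?_ ?_⟩
  · intro T x y h h'
    rw [hel, hel, el_eq_el_iff] at h
    exact (hiff x y).2 ⟨h, h'⟩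
  · intro T b g hg
    change g ≫ w = _ at hg
    obtain ⟨a, ha, ha'⟩ := hc.exists_lift b (hs.lift (p.map b) g hg.symm) (hs.lift_fst _ _ _)
    refine ⟨a, by rw [hel, ha'], ?_⟩
    change p.map a ≫ s = g
    rw [ha, hs.lift_snd]

instance isFibered_presheafFib : (presheafFib p).IsFibered :=
  Functor.IsFibered.of_exists_isStronglyCartesian fun A I' w => by
    obtain ⟨A', m, hm, hm'⟩ := exists_cart_presheaf A w
    refine ⟨A', m, ?_⟩
    have key : ∀ {K L : R} (d : K ⟶ L), (presheafFib p).IsHomLift d m →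
        (presheafFib p).IsStronglyCartesian d m := by
      intro K L d hd
      subst_hom_lift (presheafFib p) d m
      exact hm'
    exact key w hm

/-- The sum of a presheaf along a map in the base. -/
abbrev pushforward (A : Presheaf p) {I : R} (w : A.base ⟶ I) : Presheaf p where
  base := I
  obj := A.obj
  struct := A.struct ≫ w
  rel := A.rel
  rel_struct := by rw [← assoc, A.rel_struct, assoc]
  refl := A.refl
  symm := A.symm
  trans := A.trans

/-- The cocartesian map into the sum. -/
noncomputable def toPushforward (A : Presheaf p) {I : R} (w : A.base ⟶ I) :
    A ⟶ pushforward A w :=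
  (TrackingSpan.strict (A := A) (B := pushforward A w) w (𝟙 _) (by simp)
    (fun x y h => by simpa using h)).hom

lemma baseMap_toPushforward (A : Presheaf p) {I : R} (w : A.base ⟶ I) :
    baseMap (toPushforward A w) = w := rfl

lemma el_comp_toPushforward (A : Presheaf p) {I : R} (w : A.base ⟶ I) {T : X} (a : T ⟶ A.obj) :
    el A a ≫ toPushforward A w = el (pushforward A w) a := by
  have := el_comp_strict (A := A) (B := pushforward A w) w (𝟙 _) (by simp)
    (fun x y h => by simpa using h) a
  rwa [comp_id] at this

/-- Source and target have the same elements and the same relation, so maps out of them are given by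
the same data apart from the base component. -/
lemma isCocart_toPushforward (A : Presheaf p) {I : R} (w : A.base ⟶ I) :
    IsCocart (presheafFib p) (toPushforward A w) := by
  rw [isCocart_presheaf_iff]
  intro B φ g hg
  obtain ⟨T, t, b, ht, hb⟩ := exists_el_of_hom φ
  rw [baseMap_toPushforward] at hg
  obtain ⟨χ, hχ, hχ'⟩ := exists_hom_of_el (A := pushforward A w) ht g (el B b) (by
    rw [← hb, baseMap_comp, baseMap_el, ← hg]
    simp only [assoc]) (fun U x y hxy => by
      rw [← hb, yMap_comp_el_assoc, yMap_comp_el_assoc, (el_eq_el_iff A _ _).2 hxy])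
  refine ⟨χ, ⟨hχ, ?_⟩, fun χ' hχ'' => ?_⟩
  · refine hom_ext_of_el ?_ ht ?_
    · rw [baseMap_comp, baseMap_toPushforward, hχ, hg]
    · rw [← assoc, el_comp_toPushforward, hχ', hb]
  · refine hom_ext_of_el (A := pushforward A w) (hχ''.1.trans hχ.symm) ht ?_
    rw [hχ', ← el_comp_toPushforward, assoc, hχ''.2, hb]

lemma exists_cocart_presheaf (A : Presheaf p) {I : R} (w : (presheafFib p).obj A ⟶ I) :
    ∃ (B : Presheaf p) (s : A ⟶ B), (presheafFib p).IsStronglyCocartesian w s :=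
  ⟨_, toPushforward A w, isCocart_toPushforward A w⟩

instance isPrestack_presheafFib : IsPrestack (presheafFib p) := by
  refine IsPrestack.of_descent fun A' A B e f he h => ?_
  obtain ⟨w, hw⟩ : ∃ w : A.base ⟶ B.base, baseMap e ≫ w = baseMap f :=
    he.exists_base_desc (f := f) (fun T x y _ _ hxy => h x y hxy)
  have hreg : IsRegularEpi (baseMap e) := he.1
  -- a cover of the generic element of `A` by elements of `A'`
  obtain ⟨C', c, s, hc, hs⟩ := exists_cart_pullback A.obj A.struct (baseMap e)
  have hc' : IsCoverCart p c :=
    ⟨Regular.regularEpiIsStableUnderBaseChange.of_isPullback hs.flip he.1, hc⟩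
  obtain ⟨t, ht, ht'⟩ : ∃ t : representable p C' ⟶ A', baseMap t = s ∧ t ≫ e = el A c :=
    he.2.exists_lift (el A c) s hs.w.symm
  have hrel : ∀ {T : X} (x y : T ⟶ C'), A.rel.Holds p (x ≫ c) (y ≫ c) →
      yMap x ≫ t ≫ f = yMap y ≫ t ≫ f := by
    intro T x y hxy
    rw [← assoc, ← assoc]
    apply h
    rw [assoc, assoc, ht', yMap_comp_el, yMap_comp_el, el_eq_el_iff]
    exact hxy
  obtain ⟨g, hg, hg'⟩ := exists_hom_of_el (A := A) hc' w (t ≫ f) (by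
    rw [baseMap_comp, ht, ← hw, ← assoc, ← hs.w, assoc]) (fun U x y hxy => hrel x y hxy)
  refine ⟨g, ?_, fun g' hg'' => ?_⟩
  -- A generic element of `A'` is refined until its image in `A` factors through `c`. It then has
  -- the same image under `e` as an element factoring through `t`, so `h` identifies their images
  -- under `f`.
  · obtain ⟨Z, z, b, hz, hb⟩ := exists_el_of_hom e
    obtain ⟨Z', c', b', hc'', hb'⟩ := hc'.exists_pullback b
    refine hom_ext_of_el (by rw [baseMap_comp, hg, hw]) (hc''.comp hz) ?_
    have h₁ : el A' (c' ≫ z) ≫ e = (yMap b' ≫ t) ≫ e := by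
      rw [assoc, ht', yMap_comp_el, hb', ← yMap_comp_el c' z, assoc, hb,
        yMap_comp_el]
    rw [← assoc, h₁, h _ _ h₁, assoc, assoc, assoc, ← assoc t, ht', hg']
  · refine hom_ext_of_el (A := A) ?_ hc' ?_
    · rw [hg, ← cancel_epi (baseMap e), hw, ← baseMap_comp, hg'']
    · rw [hg', ← ht', assoc, hg'']

end PresheafFibration

/-! ### The Yoneda embedding -/

section Yoneda

variable {R : Type u₁} [Category.{v₁} R] [Regular R] {X : Type u₂} [Category.{v₂} X]
  {p : X ⥤ R}

/-- In a pre-stack, equality after a cover-cartesian map is equality. -/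
lemma yMap_injective [IsPrestack p] {C D : X} {f g : C ⟶ D}
    (h : yMap (p := p) f = yMap g) : f = g := by
  rw [yMap_eq_el, yMap_eq_el, el_eq_el_iff, representable_rel_holds_iff] at h
  obtain ⟨T, e, he, h⟩ := h
  exact he.cancel h

/-- A map between representables is locally a map of `X`. By faithfulness the local map coequalizes
pairs identified by the cover, so it descends. -/
lemma exists_yMap_eq [IsPrestack p] {C D : X} (ψ : representable p C ⟶ representable p D) :
    ∃ f : C ⟶ D, yMap f = ψ := by
  obtain ⟨T, t, a, ht, ha⟩ := exists_el ψ
  rw [← yMap_eq_el] at ha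
  obtain ⟨f, hf, -⟩ := ht.existsUnique_desc a fun U x y _ _ hxy => yMap_injective (p := p) <| by
    rw [yMap_comp, yMap_comp, ← ha, ← assoc, ← assoc, ← yMap_comp, ← yMap_comp, hxy]
  exact ⟨f, yoneda_cancel ht (by rw [ha, ← yMap_comp, hf])⟩

instance full_yonedaFunctor [IsPrestack p] : (yonedaFunctor p).Full :=
  ⟨fun ψ => exists_yMap_eq ψ⟩

instance faithful_yonedaFunctor [IsPrestack p] : (yonedaFunctor p).Faithful :=
  ⟨fun h => yMap_injective h⟩

/-! ### Representables are indecomposable and projective. -/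

/-- `yMap` preserves cartesian maps, and these are unique up to isomorphism. In testing
indecomposability and projectivity, the source of the cartesian map may thus be taken representable.
-/
lemma exists_iso_of_cart_representable [p.IsFibered] {C : X} {D : Presheaf p}
    {c : D ⟶ representable p C} (hc : IsCart (presheafFib p) c) :
    ∃ (C' : X) (f : C' ⟶ C) (θ : representable p C' ≅ D), IsCart p f ∧ θ.hom ≫ c = yMap f := by
  obtain ⟨C', f, hf, hf'⟩ := exists_cart C (baseMap c)
  have hb : p.obj C' = D.base := IsHomLift.domain_eq p (baseMap c) f
  obtain ⟨θ, -, hθ⟩ := (isCart_yMap hf').exists_iso hc (eqToIso hb) (by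
      have := IsHomLift.fac' p (baseMap c) f
      simp only [eqToHom_refl, comp_id] at this
      exact this.symm)
  exact ⟨C', f, θ, hf', hθ⟩

/-- An element of the sum is an element of `A`, subject to the same relation. Hence local lifts
exist, glue, and are unique. -/
lemma existsUnique_lift_toPushforward [p.IsFibered] {C : X} {A : Presheaf p} {I : R}
    (w : A.base ⟶ I) (f : representable p C ⟶ pushforward A w) :
    ∃! m : representable p C ⟶ A, m ≫ toPushforward A w = f := by
  refine existsUnique_of_exists_of_unique ?_ ?_
  · obtain ⟨T, t, a, ht, ha⟩ := exists_el f
    obtain ⟨m, hm⟩ := exists_yoneda_desc ht (el A a) fun U x y hxy => by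
      rw [yMap_comp_el, yMap_comp_el, el_eq_el_iff]
      have : el (pushforward A w) (x ≫ a) = el (pushforward A w) (y ≫ a) := by
        rw [← yMap_comp_el, ← yMap_comp_el, ← ha, ← assoc, ← assoc, ← yMap_comp, ← yMap_comp, hxy]
      exact (el_eq_el_iff (pushforward A w) _ _).1 this
    exact ⟨m, yoneda_cancel ht (by rw [← assoc, hm, ha, el_comp_toPushforward])⟩
  · intro m m' hm hm'
    obtain ⟨T, t, a, ht, ha⟩ := exists_el m
    obtain ⟨T', t', a', ht', ha'⟩ := exists_el (yMap t ≫ m')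
    refine yoneda_cancel (ht'.comp ht) ?_
    rw [yMap_comp, assoc, ha, assoc, ha', yMap_comp_el, el_eq_el_iff]
    have : el (pushforward A w) (t' ≫ a) = el (pushforward A w) a' := by
      rw [← el_comp_toPushforward, ← el_comp_toPushforward, ← ha', ← yMap_comp_el, ← ha]
      simp only [assoc, hm, hm']
    exact (el_eq_el_iff (pushforward A w) _ _).1 this

lemma isIndec_representable [p.IsFibered] (C : X) :
    IsIndec (presheafFib p) (representable p C) := by
  intro D A S c f s hc hs
  obtain ⟨C', -, θ, -, -⟩ := exists_iso_of_cart_representable hc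
  -- The cocartesian `s` is compared with the canonical sum of `A` along the same base map.
  obtain ⟨σ, hσ, hσ'⟩ : ∃ σ : S ⟶ pushforward A (baseMap s), baseMap σ = 𝟙 S.base ∧
      s ≫ σ = toPushforward A (baseMap s) :=
    hs.exists_desc (toPushforward A (baseMap s)) (𝟙 S.base) (comp_id _)
  obtain ⟨τ, hτ, hτ'⟩ : ∃ τ : pushforward A (baseMap s) ⟶ S, baseMap τ = 𝟙 S.base ∧
      toPushforward A (baseMap s) ≫ τ = s :=
    (isCocart_toPushforward A (baseMap s)).exists_desc s (𝟙 S.base) (comp_id _)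
  have hστ : σ ≫ τ = 𝟙 S := hs.hom_ext (by
    change baseMap (σ ≫ τ) = baseMap (𝟙 S)
    rw [baseMap_comp, hσ, hτ, comp_id, baseMap_id]) (by rw [← assoc, hσ', hτ', comp_id])
  obtain ⟨m, hm, hu⟩ := existsUnique_lift_toPushforward (baseMap s) (θ.hom ≫ f ≫ σ)
  refine ⟨θ.inv ≫ m, ?_, fun m' hm' => ?_⟩
  · have : m ≫ s = θ.hom ≫ f := by
      rw [← hτ', ← assoc, hm, assoc, assoc, hστ, comp_id]
    change (θ.inv ≫ m) ≫ s = f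
    rw [assoc, this, Iso.inv_hom_id_assoc]
  · rw [← hu (θ.hom ≫ m'), Iso.inv_hom_id_assoc]
    change (θ.hom ≫ m') ≫ _ = _
    rw [assoc, ← hm', ← hσ', assoc]

/-- The two variables are pulled back one after the other. Weak pullbacks suffice because a relation
matters only through the pairs that factor through it. -/
lemma SieveRel.exists_pullback [IsFiniteLimitPrestack p] {C E : X} (ρ : SieveRel C C)
    (f : E ⟶ C) : ∃ ρ' : SieveRel E E, ∀ {T : X} (x y : T ⟶ E),
      ρ'.Holds p x y ↔ ρ.Holds p (x ≫ f) (y ≫ f) := by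
  obtain ⟨P, a, b, hab, hP⟩ := IsFiniteLimitPrestack.exists_weakPullback (p := p) ρ.fst f
  obtain ⟨Q, c, d, hcd, hQ⟩ := IsFiniteLimitPrestack.exists_weakPullback (p := p) (a ≫ ρ.snd) f
  refine ⟨⟨Q, c ≫ b, d⟩, fun {T} x y => ⟨?_, ?_⟩⟩
  · rintro ⟨T', e, k, he, h₁, h₂⟩
    dsimp at k h₁ h₂
    refine ⟨T', e, k ≫ c ≫ a, he, ?_, ?_⟩
    · rw [← assoc e, ← h₁]
      simp only [assoc, hab]
    · rw [← assoc e, ← h₂]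
      simp only [assoc, hcd]
  · rintro ⟨T', e, k, he, h₁, h₂⟩
    obtain ⟨k', hk₁, hk₂⟩ := hP k (e ≫ x) (by rw [h₁, assoc])
    obtain ⟨k'', hk₃, hk₄⟩ := hQ k' (e ≫ y) (by rw [← assoc, hk₁, h₂, assoc])
    exact ⟨T', e, k'', he, by rw [← assoc, hk₃, hk₂], hk₄⟩

/-- Vertical regular epimorphisms of presheaves are locally surjective. -/
lemma exists_el_of_isVerticalRegularEpi [IsFiniteLimitPrestack p] {A B : Presheaf p} {e : A ⟶ B}
    (he : IsVerticalRegularEpi (presheafFib p) e) {T : X} (b₀ : T ⟶ B.obj) :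
    ∃ (T' : X) (t : T' ⟶ T) (a : T' ⟶ A.obj), IsCoverCart p t ∧
      el A a ≫ e = el B (t ≫ b₀) := by
  obtain ⟨I, hI, hreg⟩ := he
  have hBI : B.base = I := IsHomLift.codomain_eq (presheafFib p) (𝟙 I) e
  subst hBI
  obtain ⟨E, t, b, ht, hb⟩ := exists_el_of_hom e
  -- the image of `e`
  obtain ⟨ρ', hρ'⟩ := B.rel.exists_pullback (p := p) b
  let B' : Presheaf p :=
    { base := B.base
      obj := E
      struct := p.map b ≫ B.struct
      rel := ρ'
      rel_struct := by
        have := Presheaf.base_eq_of_rel ((hρ' ρ'.fst ρ'.snd).1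
          ⟨_, 𝟙 _, 𝟙 _, IsCoverCart.id _, rfl, rfl⟩)
        simpa only [p.map_comp, assoc] using this
      refl := fun x => (hρ' x x).2 (B.refl _)
      symm := fun {T x y} h => (hρ' y x).2 (B.symm ((hρ' x y).1 h))
      trans := fun {T x y z} h h' => (hρ' x z).2 (B.trans ((hρ' x y).1 h) ((hρ' y z).1 h')) }
  let m : B' ⟶ B := (TrackingSpan.strict (A := B') (B := B) (𝟙 _) b (comp_id _)
    (fun {T} x y h => (hρ' x y).1 h)).hom
  have hel : ∀ {T : X} (a : T ⟶ E), el B' a ≫ m = el B (a ≫ b) := fun {T} a =>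
    el_comp_strict (A := B') (B := B) _ b _ _ a
  have hmb : baseMap m = 𝟙 B.base := rfl
  let wE : A.base ⟶ B.base := baseMap e
  obtain ⟨e', he', he''⟩ := exists_hom_of_el (A := A) (B := B') ht wE (el B' (𝟙 E)) (by
    have := congrArg (fun k => baseMap k) hb
    simp only [baseMap_comp, baseMap_el, assoc] at this
    rw [baseMap_el, p.map_id, id_comp]
    exact this.symm) (fun U x y hxy => by
      rw [yMap_comp_el, yMap_comp_el, el_eq_el_iff, comp_id, comp_id]
      refine (hρ' x y).2 ?_
      rw [← el_eq_el_iff, ← yMap_comp_el, ← yMap_comp_el, ← hb, yMap_comp_el_assoc,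
        yMap_comp_el_assoc, (el_eq_el_iff A _ _).2 hxy])
  have hem : e' ≫ m = e := by
    refine hom_ext_of_el ?_ ht ?_
    · change baseMap (e' ≫ m) = baseMap e
      rw [baseMap_comp, he', hmb, comp_id]
    · rw [← assoc, he'', hel, hb, id_comp]
  have hm : (presheafFib p).IsHomLift (𝟙 B.base) m :=
    (isHomLift_iff_map_eq (p := presheafFib p)).2 rfl
  have he₂ : (presheafFib p).IsHomLift (𝟙 B.base) e' :=
    IsHomLift.of_fac' (presheafFib p) _ _ (IsHomLift.domain_eq (presheafFib p) (𝟙 B.base) e) rfl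
      (he'.trans (IsHomLift.fac' (presheafFib p) (𝟙 B.base) e))
  -- The relation of the image `B'` is inherited from `B`, so `m` is monic in the fiber. A regular
  -- epimorphism is extremal, hence `m` is invertible.
  have hmono : Mono (Functor.Fiber.homMk (presheafFib p) B.base m) := ⟨fun {Z} x y hxy => by
    refine Subtype.ext (hom_ext_of_reflects (m := m) ?_ ?_ (congrArg Subtype.val hxy))
    · intro U x y h _
      rw [hel, hel, el_eq_el_iff] at h
      exact (hρ' x y).2 h
    · have hx := x.2
      have hy := y.2
      exact (IsHomLift.fac' (presheafFib p) (𝟙 B.base) x.1).trans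
        (IsHomLift.fac' (presheafFib p) (𝟙 B.base) y.1).symm⟩
  have hext : ExtremalEpi (Functor.Fiber.homMk (presheafFib p) B.base e) := inferInstance
  have hiso : IsIso (Functor.Fiber.homMk (presheafFib p) B.base m) :=
    hext.isIso (Functor.Fiber.homMk (presheafFib p) B.base e') _ (Subtype.ext hem)
  let n : B ⟶ B' := (inv (Functor.Fiber.homMk (presheafFib p) B.base m)).1
  have hn : n ≫ m = 𝟙 B := congrArg Subtype.val
    (IsIso.inv_hom_id (Functor.Fiber.homMk (presheafFib p) B.base m))
  -- Through the inverse of `m`, an element of `B` is locally a map into `E`, and `t` carries that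
  -- to an element of `A`.
  obtain ⟨T', t', z, ht', hz⟩ := exists_el (el B b₀ ≫ n)
  refine ⟨T', t', z ≫ t, ht', ?_⟩
  rw [← yMap_comp_el, assoc, hb, yMap_comp_el, ← yMap_comp_el t' b₀, ← comp_id (el B b₀), ← hn,
    ← assoc (el B b₀), ← assoc (yMap t'), hz]
  exact (hel z).symm

lemma isProj_representable [IsFiniteLimitPrestack p] (C : X) :
    IsProj (presheafFib p) (representable p C) := by
  intro P A B c f e hc he
  obtain ⟨C', -, θ, -, -⟩ := exists_iso_of_cart_representable hc
  obtain ⟨T, t, b, ht, hb⟩ := exists_el (θ.hom ≫ f)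
  obtain ⟨T', t', a, ht', ha⟩ := exists_el_of_isVerticalRegularEpi he b
  refine ⟨representable p T', yMap (t' ≫ t) ≫ θ.hom, el A a,
    (isCoverCart_yMap (ht'.comp ht)).comp (IsCoverCart.of_isIso _), ?_⟩
  rw [ha, ← yMap_comp_el, ← hb, yMap_comp]
  simp only [assoc]

lemma indecProj_representable [IsFiniteLimitPrestack p] (C : X) :
    indecProj (presheafFib p) (representable p C) :=
  ⟨isIndec_representable C, isProj_representable C⟩

/-! ### Every presheaf is covered by a representable -/

section Cover

variable [p.IsFibered]

/-- The map of sums of representables induced by a map of the total category. -/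
noncomputable def pushforwardMap {C D : X} {I : R} {u : p.obj C ⟶ I} {v : p.obj D ⟶ I} (f : C ⟶ D)
    (hf : p.map f ≫ v = u) :
    pushforward (representable p C) u ⟶ pushforward (representable p D) v :=
  (TrackingSpan.strict (A := pushforward (representable p C) u)
    (B := pushforward (representable p D) v) (𝟙 I) f
    (by
      change (𝟙 _ ≫ u) ≫ 𝟙 I = p.map f ≫ 𝟙 _ ≫ v
      rw [id_comp, id_comp, comp_id, hf]) (fun {T} x y h => by
      obtain ⟨T', e, he, h⟩ := (holds_diag_iff C x y).1 h
      exact (holds_diag_iff D _ _).2 ⟨T', e, he, by rw [← assoc, h, assoc]⟩)).hom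

lemma el_comp_pushforwardMap {C D : X} {I : R} {u : p.obj C ⟶ I} {v : p.obj D ⟶ I} (f : C ⟶ D)
    (hf : p.map f ≫ v = u) {T : X} (a : T ⟶ C) :
    el (pushforward (representable p C) u) a ≫ pushforwardMap f hf =
      el (pushforward (representable p D) v) (a ≫ f) :=
  el_comp_strict (A := pushforward (representable p C) u)
    (B := pushforward (representable p D) v) _ f _ _ a

/-- The quotient map from the sum of a representable. -/
noncomputable def quotientMap (A : Presheaf p) :
    pushforward (representable p A.obj) A.struct ⟶ A :=
  (TrackingSpan.strict (A := pushforward (representable p A.obj) A.struct) (B := A) (𝟙 _) (𝟙 _)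
    (by simp) (fun {T} x y h => by
      obtain ⟨T', e, he, h⟩ := (holds_diag_iff A.obj x y).1 h
      refine SieveRel.Holds.of_cover he ?_
      rw [comp_id, comp_id, h]
      exact A.refl _)).hom

lemma el_comp_quotientMap (A : Presheaf p) {T : X} (a : T ⟶ A.obj) :
    el (pushforward (representable p A.obj) A.struct) a ≫ quotientMap A = el A a := by
  have := el_comp_strict (A := pushforward (representable p A.obj) A.struct) (B := A) (𝟙 _) (𝟙 _)
    (by simp) (fun {T} x y h => by
      obtain ⟨T', e, he, h⟩ := (holds_diag_iff A.obj x y).1 h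
      refine SieveRel.Holds.of_cover he ?_
      rw [comp_id, comp_id, h]
      exact A.refl _) a
  exact this.trans (congrArg (el A) (comp_id a))

lemma quotientMap_cancel (A : Presheaf p) {B : Presheaf p} {g g' : A ⟶ B}
    (h : quotientMap A ≫ g = quotientMap A ≫ g') : g = g' := by
  refine hom_ext_of_el (A := A) ?_ (IsCoverCart.id _) ?_
  · have := congrArg (fun k => baseMap k) h
    simp only [baseMap_comp] at this
    exact (id_comp _).symm.trans (this.trans (id_comp _))
  · rw [← el_comp_quotientMap, assoc, h, assoc]

/-- Related elements factor, after a cover, through `A.rel.dom`, where `hπ` applies. So `π` respects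
the relation and descends. -/
lemma exists_desc_quotientMap (A : Presheaf p) {B : Presheaf p}
    (π : pushforward (representable p A.obj) A.struct ⟶ B)
    (hπ : pushforwardMap (p := p) (u := p.map A.rel.fst ≫ A.struct) (v := A.struct) A.rel.fst rfl ≫
      π = pushforwardMap A.rel.snd A.rel_struct.symm ≫ π) :
    ∃ g : A ⟶ B, quotientMap A ≫ g = π := by
  let w : A.base ⟶ B.base :=
    show (pushforward (representable p A.obj) A.struct).base ⟶ B.base from baseMap π
  obtain ⟨g, hg, hg'⟩ := exists_hom_of_el (A := A) (IsCoverCart.id _) w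
    (el (pushforward (representable p A.obj) A.struct) (𝟙 _) ≫ π) (by
      rw [baseMap_comp, baseMap_el]
      exact (congrArg (fun k => (p.map (𝟙 A.obj) ≫ k) ≫ w) (id_comp A.struct)).trans
        (assoc _ _ _)) (fun U x y hxy => by
        obtain ⟨V, e, k, he, h₁, h₂⟩ := hxy
        refine yoneda_cancel he ?_
        rw [comp_id] at h₁ h₂
        rw [yMap_comp_el_assoc, yMap_comp_el_assoc, yMap_comp_el_assoc, yMap_comp_el_assoc,
          comp_id, comp_id, ← h₁, ← h₂]
        have e₁ := el_comp_pushforwardMap (p := p) (u := p.map A.rel.fst ≫ A.struct)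
          (v := A.struct) A.rel.fst rfl k
        have e₂ := el_comp_pushforwardMap (p := p) (u := p.map A.rel.fst ≫ A.struct)
          (v := A.struct) A.rel.snd A.rel_struct.symm k
        rw [← e₁, ← e₂, assoc, assoc]
        exact congrArg (fun z => el _ k ≫ z) hπ)
  refine ⟨g, hom_ext_of_el ?_ (IsCoverCart.id _) ?_⟩
  · exact (baseMap_comp _ _).trans ((id_comp _).trans hg)
  · rw [← assoc, el_comp_quotientMap, hg']

lemma isVerticalRegularEpi_quotientMap (A : Presheaf p) :
    IsVerticalRegularEpi (presheafFib p) (quotientMap A) := by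
  have hq : (presheafFib p).IsHomLift (𝟙 A.base) (quotientMap A) :=
    (isHomLift_iff_map_eq (p := presheafFib p)).2 rfl
  let l := pushforwardMap (p := p) (u := p.map A.rel.fst ≫ A.struct) (v := A.struct) A.rel.fst rfl
  let r := pushforwardMap (p := p) (u := p.map A.rel.fst ≫ A.struct) (v := A.struct) A.rel.snd
    A.rel_struct.symm
  have hl : (presheafFib p).IsHomLift (𝟙 A.base) l :=
    (isHomLift_iff_map_eq (p := presheafFib p)).2 rfl
  have hr : (presheafFib p).IsHomLift (𝟙 A.base) r :=
    (isHomLift_iff_map_eq (p := presheafFib p)).2 rfl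
  have hlr : l ≫ quotientMap A = r ≫ quotientMap A := by
    refine hom_ext_of_el rfl (IsCoverCart.id _) ?_
    rw [← assoc, el_comp_pushforwardMap, el_comp_quotientMap, ← assoc, el_comp_pushforwardMap,
      el_comp_quotientMap, el_eq_el_iff]
    exact ⟨_, 𝟙 _, 𝟙 _, IsCoverCart.id _, by simp, by simp⟩
  refine ⟨A.base, hq, ⟨⟨
    { W := ⟨pushforward (representable p A.rel.dom) (p.map A.rel.fst ≫ A.struct), rfl⟩
      left := Functor.Fiber.homMk (presheafFib p) A.base l
      right := Functor.Fiber.homMk (presheafFib p) A.base r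
      w := Subtype.ext hlr
      isColimit := ?_ }⟩⟩⟩
  refine Cofork.IsColimit.mk' _ fun s => ?_
  let B : Presheaf p := s.pt.1
  let π : pushforward (representable p A.obj) A.struct ⟶ B := s.π.1
  have hπ : (presheafFib p).IsHomLift (𝟙 A.base) π := s.π.2
  have key := exists_desc_quotientMap A π (congrArg Subtype.val s.condition)
  have hg := key.choose_spec
  have hgl : (presheafFib p).IsHomLift (𝟙 A.base) key.choose := by
    have h₁ : (presheafFib p).map π = eqToHom _ ≫ 𝟙 A.base ≫ eqToHom _ :=
      IsHomLift.fac' (presheafFib p) (𝟙 A.base) π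
    exact IsHomLift.of_fac' (presheafFib p) _ _ rfl s.pt.2 ((id_comp _).symm.trans
      ((baseMap_comp _ _).symm.trans ((congrArg (fun k => baseMap k) hg).trans h₁)))
  refine ⟨⟨key.choose, hgl⟩, Subtype.ext hg, fun {m} hm => Subtype.ext ?_⟩
  exact quotientMap_cancel A ((congrArg Subtype.val hm).trans hg.symm)

lemma toPushforward_comp_quotientMap (A : Presheaf p) :
    toPushforward (representable p A.obj) A.struct ≫ quotientMap A = el A (𝟙 _) := by
  refine hom_ext_of_el (A := representable p A.obj) ?_ (IsCoverCart.id _) ?_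
  · change A.struct ≫ 𝟙 _ = p.map (𝟙 _) ≫ A.struct
    simp
  · rw [← assoc, el_comp_toPushforward, el_comp_quotientMap, ← yMap_eq_el, yMap_id, id_comp]

lemma exists_representable_cover (A : Presheaf p) :
    ∃ (S : Presheaf p) (s : representable p A.obj ⟶ S) (e : S ⟶ A),
      IsCocart (presheafFib p) s ∧ IsVerticalRegularEpi (presheafFib p) e ∧
        s ≫ e = el A (𝟙 _) :=
  ⟨_, _, _, isCocart_toPushforward _ _, isVerticalRegularEpi_quotientMap A,
    toPushforward_comp_quotientMap A⟩

end Cover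

/-! ### Coverings by representables and the weak equivalence. -/

lemma coveredByIndecProj_presheafFib [IsFiniteLimitPrestack p] :
    CoveredByIndecProj (presheafFib p) := fun A => by
  obtain ⟨S, s, e, hs, he, -⟩ := exists_representable_cover A
  exact ⟨_, S, s, e, indecProj_representable _, hs, he⟩

/-- A retract argument: lifting the identity of `A` through its canonical presentation makes a cover
`Q` of `A` a vertical retract of a representable, and the resulting idempotent splits in a fiber of
`p`. -/
lemma exists_coverCart_of_indecProj [IsFiniteLimitPrestack p] {A : Presheaf p}
    (hA : indecProj (presheafFib p) A) :
    ∃ (C : X) (e : representable p C ⟶ A), IsCoverCart (presheafFib p) e := by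
  obtain ⟨S, s, κ, hs, hκ, hsκ⟩ := exists_representable_cover A
  obtain ⟨Q, d, g, hd, hg⟩ := hA.2 (𝟙 A) (𝟙 A) κ (IsCart.of_isIso _) hκ
  rw [comp_id] at hg
  obtain ⟨m, hm, -⟩ := hA.1 d g s hd.2 hs
  have hmd : m ≫ el A (𝟙 _) = d := by rw [← hsκ, ← assoc, hm, hg]
  have hbd : baseMap d = baseMap m ≫ A.struct := by
    rw [← hmd, baseMap_comp, baseMap_el, p.map_id, id_comp]
  -- `m` need not be vertical. Reindexing `A.obj` along its base component gives a representable
  -- over the base of `Q`. The retraction `r` exists because `d` is cartesian, and the section `σ`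
  -- because `yMap c` is.
  obtain ⟨C', c, hc, hc'⟩ := exists_cart A.obj (baseMap m)
  have hC' : p.obj C' = Q.base := IsHomLift.domain_eq p (baseMap m) c
  have hpc : p.map c = eqToHom hC' ≫ baseMap m := by
    simpa using IsHomLift.fac' p (baseMap m) c
  obtain ⟨r, hr, hr'⟩ : ∃ r : representable p C' ⟶ Q, baseMap r = eqToHom hC' ∧ r ≫ d = el A c :=
    hd.2.exists_lift (el A c) (eqToHom hC') (by
      change eqToHom hC' ≫ baseMap d = p.map c ≫ A.struct
      rw [hbd, hpc, assoc])
  obtain ⟨σ, hσ, hσ'⟩ : ∃ σ : Q ⟶ representable p C', baseMap σ = eqToHom hC'.symm ∧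
      σ ≫ yMap c = m :=
    (isCart_yMap hc').exists_lift m (eqToHom hC'.symm) (by
      change eqToHom hC'.symm ≫ p.map c = baseMap m
      rw [hpc, eqToHom_trans_assoc, eqToHom_refl, id_comp])
  have hσr : σ ≫ r = 𝟙 Q := by
    refine hd.2.hom_ext ?_ ?_
    · change baseMap (σ ≫ r) = baseMap (𝟙 Q)
      rw [baseMap_comp, hσ, hr, eqToHom_trans, eqToHom_refl, baseMap_id]
    · have : el A c = yMap c ≫ el A (𝟙 _) := by rw [yMap_comp_el, comp_id]
      rw [assoc, hr', this, ← assoc, hσ', hmd, id_comp]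
  obtain ⟨ε, hε⟩ := exists_yMap_eq (r ≫ σ)
  have hpε : p.map ε = 𝟙 _ := by
    rw [← baseMap_yMap (p := p) ε, hε, baseMap_comp, hr, hσ, eqToHom_trans, eqToHom_refl]
  have hεε : ε ≫ ε = ε := yMap_injective (p := p) (by
    rw [yMap_comp, hε, assoc, ← assoc σ, hσr, id_comp])
  have := IsFiniteLimitPrestack.hasFiniteLimits (p := p) (p.obj C')
  -- An idempotent is split by its equalizer with the identity.
  have hidem : IsIdempotentComplete (p.Fiber (p.obj C')) :=
    (Idempotents.isIdempotentComplete_iff_hasEqualizer_of_id_and_idempotent _).2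
      fun _ _ _ => inferInstance
  let C₀ : p.Fiber (p.obj C') := ⟨C', rfl⟩
  let ε₀ : C₀ ⟶ C₀ := ⟨ε, isHomLift_iff_map_eq.2 hpε⟩
  obtain ⟨E, i, k, hik, hki⟩ := hidem.idempotents_split C₀ ε₀ (Subtype.ext hεε)
  have hik' : i.1 ≫ k.1 = 𝟙 E.1 := congrArg Subtype.val hik
  have hki' : k.1 ≫ i.1 = ε := congrArg Subtype.val hki
  obtain ⟨θ⟩ : Nonempty (representable p E.1 ≅ Q) := ⟨
    { hom := yMap i.1 ≫ r
      inv := σ ≫ yMap k.1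
      hom_inv_id := by
        rw [assoc, ← assoc r, ← hε, ← hki', ← yMap_comp, ← yMap_comp, assoc, hik', comp_id, hik',
          yMap_id]
      inv_hom_id := by
        have : yMap (p := p) k.1 ≫ yMap i.1 = r ≫ σ := by rw [← yMap_comp, hki', hε]
        rw [assoc, ← assoc (yMap _), this, assoc, hσr, comp_id, hσr] }⟩
  exact ⟨E.1, θ.hom ≫ d, (IsCoverCart.of_isIso (p := presheafFib p) θ.hom).comp hd⟩

lemma isWeakEquivalence_yonedaCorestrict [IsFiniteLimitPrestack p]
    (h : ∀ C : X, indecProj (presheafFib p) ((yonedaFunctor p).obj C)) :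
    IsWeakEquivalence (yonedaCorestrict p h) where
  prestack_source := inferInstance
  prestack_target := isPrestack_indecProjFib
  fibered _ _ _ hf := IsCart.of_map (indecProj (presheafFib p)).ι (isCart_yMap hf)
  full := inferInstanceAs ((indecProj (presheafFib p)).lift (yonedaFunctor p) h).Full
  faithful := inferInstanceAs ((indecProj (presheafFib p)).lift (yonedaFunctor p) h).Faithful
  exists_cover D := by
    obtain ⟨C, e, he⟩ := exists_coverCart_of_indecProj D.2
    exact ⟨C, ObjectProperty.homMk e, (isCoverCart_indecProjFib_iff _).2 he⟩

end Yoneda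

/-! ### Indecomposable projective presheaves are closed under finite limits -/

section Closure

variable {R : Type u₁} [Category.{v₁} R] {X : Type u₂} [Category.{v₂} X] {p : X ⥤ R}

lemma exists_common_cover [Regular R] {I : R} {K : Type*} [Finite K] {J : K → R}
    (u : ∀ k, J k ⟶ I) (hu : ∀ k, IsRegularEpi (u k)) :
    ∃ (L : R) (e : L ⟶ I) (h : ∀ k, L ⟶ J k), IsRegularEpi e ∧ ∀ k, h k ≫ u k = e := by
  classical
  have := Fintype.ofFinite K
  suffices H : ∀ s : Finset K, ∃ (L : R) (e : L ⟶ I), IsRegularEpi e ∧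
      ∀ k ∈ s, ∃ h : L ⟶ J k, h ≫ u k = e by
    obtain ⟨L, e, he, h⟩ := H Finset.univ
    choose h hh using fun k => h k (Finset.mem_univ k)
    exact ⟨L, e, h, he, hh⟩
  intro s
  induction s using Finset.induction with
  | empty => exact ⟨I, 𝟙 I, inferInstance, by simp⟩
  | insert k s _ ih =>
    obtain ⟨L, e, he, h⟩ := ih
    have := hu k
    have h₁ : StrongEpi (pullback.snd (u k) e ≫ e) := strongEpi_comp _ _
    have h₂ : ExtremalEpi (pullback.snd (u k) e ≫ e) := inferInstance
    refine ⟨pullback (u k) e, pullback.snd (u k) e ≫ e, inferInstance, fun l hl => ?_⟩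
    rcases Finset.mem_insert.1 hl with rfl | hl
    · exact ⟨pullback.fst _ _, pullback.condition⟩
    · obtain ⟨g, hg⟩ := h l hl
      exact ⟨pullback.snd _ _ ≫ g, by rw [assoc, hg]⟩

lemma isStronglyCartesian_of_isHomLift {I J : R} {u : J ⟶ I} {A B : X} {f : A ⟶ B}
    (h : p.IsHomLift u f) (hf : IsCart p f) : p.IsStronglyCartesian u f := by
  subst_hom_lift p u f
  exact hf

variable [Regular R]

lemma isHomLift_presheaf_iff [p.IsFibered] {T B : Presheaf p} {I : R} (h : B.base = I)
    {g : T.base ⟶ I} {φ : T ⟶ B} :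
    (presheafFib p).IsHomLift g φ ↔ baseMap φ = g ≫ eqToHom h.symm := by
  subst h
  rw [eqToHom_refl, comp_id]
  exact isHomLift_iff_map_eq (p := presheafFib p)

lemma isHomLift_baseMap [p.IsFibered] {T B : Presheaf p} (φ : T ⟶ B) {I : R} (h : B.base = I) :
    (presheafFib p).IsHomLift (baseMap φ ≫ eqToHom h) φ :=
  (isHomLift_presheaf_iff h).2 (by simp)

lemma isHomLift_yMap [p.IsFibered] {I J : R} {f : J ⟶ I} {C D : X} {a : C ⟶ D}
    (h : p.IsHomLift f a) : (presheafFib p).IsHomLift f (yMap a) :=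
  IsHomLift.of_fac' (presheafFib p) _ _ (IsHomLift.domain_eq p f a) (IsHomLift.codomain_eq p f a)
    (IsHomLift.fac' p f a)

lemma isHomLift_of_yMap [p.IsFibered] {I J : R} {f : J ⟶ I} {C D : X} {a : C ⟶ D}
    (h : (presheafFib p).IsHomLift f (yMap a)) : p.IsHomLift f a :=
  IsHomLift.of_fac' p _ _ (IsHomLift.domain_eq (presheafFib p) f (yMap a))
    (IsHomLift.codomain_eq (presheafFib p) f (yMap a)) (IsHomLift.fac' (presheafFib p) f (yMap a))

variable [IsFiniteLimitPrestack p]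

/-- The Yoneda embedding turns limits in the fibers into limits with respect to all maps of the
total category of presheaves. -/
lemma existsUnique_lift_representable {J : R} {K : Type} [SmallCategory K] [FinCategory K]
    {D : K ⥤ p.Fiber J} {c : Cone D} (hc : IsLimit c) (T : Presheaf p) (g : T.base ⟶ J)
    (φ : ∀ k, T ⟶ representable p (D.obj k).1)
    (hφ : ∀ k, (presheafFib p).IsHomLift g (φ k))
    (hn : ∀ ⦃k l : K⦄ (a : k ⟶ l), φ k ≫ yMap (D.map a).1 = φ l) :
    ∃! ψ : T ⟶ representable p c.pt.1, (presheafFib p).IsHomLift g ψ ∧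
      ∀ k, ψ ≫ yMap (c.π.app k).1 = φ k := by
  have hpres : ∀ {U : X} (t : p.obj U ⟶ J), PreservesLimitsOfShape K (reindex p t) := fun t =>
    have := IsFiniteLimitPrestack.preservesFiniteLimits (p := p) t
    inferInstance
  have hel : ∀ {U : X} (x : U ⟶ T.obj), (presheafFib p).IsHomLift (p.map x ≫ T.struct) (el T x) :=
    fun x => (isHomLift_iff_map_eq (p := presheafFib p)).2 rfl
  -- By fullness, the cone evaluated at the generic element of `T` consists of maps of the total
  -- category, to which the limit in the fiber applies.
  choose x hx using fun k => exists_yMap_eq (el T (𝟙 T.obj) ≫ φ k)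
  have hxU : ∀ {U : X} (y : U ⟶ T.obj) k, yMap (y ≫ x k) = el T y ≫ φ k := fun y k => by
    rw [yMap_comp, hx, yMap_comp_el_assoc, comp_id]
  have hxl : ∀ {U : X} (y : U ⟶ T.obj) k, p.IsHomLift ((p.map y ≫ T.struct) ≫ g) (y ≫ x k) :=
    fun y k => isHomLift_of_yMap (by
      rw [hxU]
      have := hel y
      have := hφ k
      infer_instance)
  have hxn : ∀ {U : X} (y : U ⟶ T.obj) ⦃k l : K⦄ (a : k ⟶ l),
      (y ≫ x k) ≫ (D.map a).1 = y ≫ x l := fun y k l a => yMap_injective (p := p) <| by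
    rw [yMap_comp, hxU, hxU, assoc, hn]
  -- Uniqueness against maps from any `U` makes the lift `z` respect the relation of `T`, and later
  -- gives uniqueness of `ψ`.
  have uniq : ∀ {U : X} (t : p.obj U ⟶ J) (z z' : U ⟶ c.pt.1), p.IsHomLift t z →
      p.IsHomLift t z' → (∀ k, z ≫ (c.π.app k).1 = z' ≫ (c.π.app k).1) → z = z' := by
    intro U t z z' hz hz' h
    have := hpres t
    have hπ : ∀ k, p.IsHomLift (𝟙 J) (c.π.app k).1 := fun k => (c.π.app k).2
    refine (existsUnique_lift_of_reindex t hc (fun k => z' ≫ (c.π.app k).1)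
      (fun k => inferInstance) (fun k l a => ?_)).unique ⟨hz, h⟩ ⟨hz', fun _ => rfl⟩
    rw [assoc]
    exact congrArg (fun m => z' ≫ m.1) (c.w a)
  have := hpres ((p.map (𝟙 T.obj) ≫ T.struct) ≫ g)
  obtain ⟨z, ⟨hz, hz'⟩, -⟩ := existsUnique_lift_of_reindex _ hc (fun k => 𝟙 T.obj ≫ x k)
    (fun k => hxl (𝟙 _) k) (fun k l a => hxn (𝟙 _) a)
  have hzl : ∀ {U : X} (y : U ⟶ T.obj), p.IsHomLift ((p.map y ≫ T.struct) ≫ g) (y ≫ z) := by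
    intro U y
    rw [p.map_id, id_comp] at hz
    rw [assoc]
    infer_instance
  obtain ⟨ψ, hψ, hψ'⟩ := exists_hom_of_el (A := T) (IsCoverCart.id _)
    (g ≫ eqToHom c.pt.2.symm) (yMap z) (by
      rw [baseMap_yMap]
      have h₁ := IsHomLift.fac' p ((p.map (𝟙 T.obj) ≫ T.struct) ≫ g) z
      rw [h₁]
      simp) (fun U y y' h => by
        rw [comp_id, comp_id] at h
        rw [← yMap_comp, ← yMap_comp]
        refine congrArg _ (uniq _ _ _ (hzl y) (Presheaf.base_eq_of_rel h ▸ hzl y') fun k => ?_)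
        rw [assoc, hz', assoc, hz', id_comp]
        refine yMap_injective (p := p) ?_
        rw [hxU, hxU, (el_eq_el_iff T y y').2 h])
  have hψl : (presheafFib p).IsHomLift g ψ :=
    (isHomLift_presheaf_iff (B := representable p c.pt.1) c.pt.2).2 hψ
  refine ⟨ψ, ⟨hψl, fun k => ?_⟩, ?_⟩
  · have hb := fun k => (c.π.app k).2
    have h₁ := isHomLift_yMap (hb k)
    have h₂ := hφ k
    have h₃ : (presheafFib p).IsHomLift g (ψ ≫ yMap (c.π.app k).1) := inferInstance
    refine hom_ext_of_el (A := T) ?_ (IsCoverCart.id _) ?_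
    · exact (IsHomLift.fac' (presheafFib p) g _).trans (IsHomLift.fac' (presheafFib p) g (φ k)).symm
    · rw [← assoc, hψ', ← yMap_comp, hz', hxU]
  · rintro ψ' ⟨h, h'⟩
    obtain ⟨z', hz''⟩ := exists_yMap_eq (el T (𝟙 T.obj) ≫ ψ')
    have hz₂ : p.IsHomLift ((p.map (𝟙 T.obj) ≫ T.struct) ≫ g) z' := isHomLift_of_yMap (by
      rw [hz'']
      have := hel (𝟙 T.obj)
      infer_instance)
    refine hom_ext_of_el (A := T) ?_ (IsCoverCart.id _) ?_
    · exact ((isHomLift_presheaf_iff (B := representable p c.pt.1) c.pt.2).1 h).trans hψ.symm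
    · rw [hψ', ← hz'']
      refine congrArg _ (uniq _ _ _ hz₂ hz fun k => ?_)
      rw [hz']
      refine yMap_injective (p := p) ?_
      rw [hxU, yMap_comp, hz'', assoc, h']

lemma existsUnique_lift_of_isLimit_presheaf {J I : R} (t : J ⟶ I) (T : (presheafFib p).Fiber J)
    {K : Type} [SmallCategory K] {F : K ⥤ (presheafFib p).Fiber I}
    {c : Cone F} (hc : IsLimit c) (φ : ∀ k, T.1 ⟶ (F.obj k).1)
    (hφ : ∀ k, (presheafFib p).IsHomLift t (φ k))
    (hn : ∀ ⦃k l : K⦄ (a : k ⟶ l), φ k ≫ (F.map a).1 = φ l) :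
    ∃! ψ : T.1 ⟶ c.pt.1, (presheafFib p).IsHomLift t ψ ∧ ∀ k, ψ ≫ (c.π.app k).1 = φ k := by
  obtain ⟨T, rfl⟩ := T
  exact existsUnique_lift_of_cocart exists_cocart_presheaf t hc φ hφ hn

/-- A diagram of indecomposable projective presheaves over `I` is, locally on `I`, a diagram of
representables. -/
lemma exists_representable_diagram {I : R} {K : Type} [SmallCategory K] [FinCategory K]
    (F : K ⥤ (presheafFib p).Fiber I) (hF : ∀ k, indecProj (presheafFib p) (F.obj k).1) :
    ∃ (J : R) (e : J ⟶ I) (D : K ⥤ p.Fiber J) (δ : ∀ k, representable p (D.obj k).1 ⟶ (F.obj k).1),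
      IsRegularEpi e ∧ (∀ k, (presheafFib p).IsStronglyCartesian e (δ k)) ∧
        ∀ ⦃k l⦄ (a : k ⟶ l), yMap (D.map a).1 ≫ δ l = δ k ≫ (F.map a).1 := by
  choose C d hd using fun k => exists_coverCart_of_indecProj (hF k)
  have hd' : ∀ k, (presheafFib p).IsHomLift (baseMap (d k) ≫ eqToHom (F.obj k).2) (d k) := fun k =>
    isHomLift_baseMap (d k) (F.obj k).2
  obtain ⟨J, e, h, he, hh⟩ := exists_common_cover (fun k => baseMap (d k) ≫ eqToHom (F.obj k).2)
    (fun k => isRegularEpi_of_isHomLift (hd' k) (hd k).1)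
  choose E c hc hc' using fun k => exists_cart (C k) (h k)
  let E' : ∀ k, p.Fiber J := fun k => ⟨E k, IsHomLift.domain_eq p (h k) (c k)⟩
  let δ : ∀ k, representable p (E' k).1 ⟶ (F.obj k).1 := fun k => yMap (c k) ≫ d k
  have hδ : ∀ k, (presheafFib p).IsStronglyCartesian e (δ k) := fun k => by
    refine isStronglyCartesian_of_isHomLift (p := presheafFib p) ?_ ((isCart_yMap (hc' k)).comp (hd k).2)
    rw [← hh k]
    have h₁ := isHomLift_yMap (hc k)
    have h₂ := hd' k
    exact IsHomLift.comp (presheafFib p) _ _ _ _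
  have key : ∀ {k l : K} (a : k ⟶ l), ∃ m : E' k ⟶ E' l, yMap m.1 ≫ δ l = δ k ≫ (F.map a).1 := by
    intro k l a
    have h₁ := (F.map a).2
    have h₂ : (presheafFib p).IsHomLift e (δ k ≫ (F.map a).1) := inferInstance
    obtain ⟨m, hm⟩ := exists_yMap_eq (p := p)
      (Functor.IsCartesian.map (presheafFib p) e (δ l) (δ k ≫ (F.map a).1))
    refine ⟨⟨m, isHomLift_of_yMap ?_⟩, ?_⟩
    · rw [hm]
      infer_instance
    · exact (congrArg (· ≫ δ l) hm).trans (Functor.IsCartesian.fac _ _ _ _)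
  -- Uniqueness of factorizations through the cartesian `δ l`, with faithfulness of Yoneda, makes
  -- the transition maps functorial.
  have key' : ∀ {k l : K} (m m' : E' k ⟶ E' l), yMap m.1 ≫ δ l = yMap m'.1 ≫ δ l → m = m' := by
    intro k l m m' hmm
    have h₁ := isHomLift_yMap m.2
    have h₂ := isHomLift_yMap m'.2
    exact Subtype.ext (yMap_injective (p := p)
      (Functor.IsCartesian.ext (presheafFib p) e (δ l) _ _ hmm))
  choose m hm using @key
  refine ⟨J, e,
    { obj := E'
      map := m
      map_id := fun k => key' _ _ ?_
      map_comp := fun {k l n} a b => key' _ _ ?_ }, δ, he, hδ, fun k l a => hm a⟩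
  · rw [hm, F.map_id]
    change δ k ≫ 𝟙 _ = yMap (𝟙 _) ≫ δ k
    rw [yMap_id, id_comp, comp_id]
  · rw [hm, F.map_comp]
    change δ k ≫ (F.map a).1 ≫ (F.map b).1 = yMap ((m a).1 ≫ (m b).1) ≫ δ n
    have h₁ : (yMap (m a).1 ≫ yMap (m b).1) ≫ δ n = yMap (m a).1 ≫ δ l ≫ (F.map b).1 :=
      (assoc _ _ _).trans (congrArg (yMap (m a).1 ≫ ·) (hm b))
    have h₂ : yMap (m a).1 ≫ δ l ≫ (F.map b).1 = (δ k ≫ (F.map a).1) ≫ (F.map b).1 :=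
      (assoc _ _ _).symm.trans (congrArg (· ≫ (F.map b).1) (hm a))
    exact ((congrArg (· ≫ δ n) (yMap_comp _ _)).trans (h₁.trans (h₂.trans (assoc _ _ _)))).symm

/-- Over a cover `e` of the base the diagram is represented by some `D`. The comparison `ψ` from the
presheaf represented by the limit of `D` to the given limit is cartesian over `e`, so the property
descends along it. -/
lemma indecProjClosedUnderFiniteLimits_presheafFib :
    IndecProjClosedUnderFiniteLimits (presheafFib p) := fun I K _ _ => ⟨fun A ⟨pres⟩ => by
  obtain ⟨J, e, D, δ, he, hδ, hn⟩ := exists_representable_diagram pres.diag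
    (fun k => pres.prop_diag_obj k)
  have := IsFiniteLimitPrestack.hasFiniteLimits (p := p) J
  let c := limit.cone D
  have hc : IsLimit c := limit.isLimit D
  let cA : Cone pres.diag := Cone.mk A pres.π
  have hcA : IsLimit cA := pres.isLimit
  have hπ : ∀ k, (presheafFib p).IsHomLift (𝟙 J) (yMap (p := p) (c.π.app k).1) := fun k =>
    isHomLift_yMap (c.π.app k).2
  have hπA : ∀ k, (presheafFib p).IsHomLift (𝟙 I) (cA.π.app k).1 := fun k => (cA.π.app k).2
  let L : (presheafFib p).Fiber J := ⟨representable p c.pt.1, c.pt.2⟩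
  obtain ⟨ψ, hψ, hψ'⟩ : ∃ ψ : representable p c.pt.1 ⟶ cA.pt.1, (presheafFib p).IsHomLift e ψ ∧
      ∀ k, ψ ≫ (cA.π.app k).1 = yMap (c.π.app k).1 ≫ δ k :=
    (existsUnique_lift_of_isLimit_presheaf e L hcA
      (fun k => yMap (c.π.app k).1 ≫ δ k) (fun k => inferInstance) (fun k l a => by
        rw [assoc, ← hn, ← assoc, ← yMap_comp]
        exact congrArg (fun m => yMap m.1 ≫ δ l) (c.w a))).exists
  refine indecProj_of_coverCart (p := presheafFib p) (e := ψ) ⟨isRegularEpi_map_of_isHomLift hψ he,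
    IsCart.of_lift (u := e) ?_⟩ (indecProj_representable c.pt.1)
  -- A map into the limit over `g ≫ e` is a compatible family of maps into the diagram. Since each
  -- `δ k` is cartesian, this is a family over `g` into the representables, hence a map over `g`
  -- into the presheaf represented by the limit of `D`.
  refine { toIsHomLift := hψ, universal_property' := fun {T} g (φ : T ⟶ cA.pt.1) hφ => ?_ }
  replace hφ : (presheafFib p).IsHomLift (g ≫ e) φ := hφ
  have hT : ∀ k, (presheafFib p).IsHomLift (g ≫ e) (φ ≫ (cA.π.app k).1) := fun k => inferInstance
  let φ' : ∀ k, T ⟶ representable p (D.obj k).1 := fun k =>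
    Functor.IsStronglyCartesian.map (presheafFib p) e (δ k) (rfl : g ≫ e = g ≫ e)
      (φ ≫ (cA.π.app k).1)
  have hφ' : ∀ k, φ' k ≫ δ k = φ ≫ (cA.π.app k).1 := fun k =>
    Functor.IsStronglyCartesian.fac (presheafFib p) e (δ k) rfl _
  have hφl : ∀ k, (presheafFib p).IsHomLift g (φ' k) := fun k => inferInstance
  have hA : ∀ {χ : T ⟶ cA.pt.1}, (presheafFib p).IsHomLift (g ≫ e) χ →
      (∀ k, χ ≫ (cA.π.app k).1 = φ ≫ (cA.π.app k).1) → χ = φ := fun {χ} h₁ h₂ =>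
    (existsUnique_lift_of_isLimit_presheaf (g ≫ e) ⟨T, rfl⟩ hcA _ hT (fun k l a => by
      rw [assoc]
      exact congrArg (fun m => φ ≫ m.1) (cA.w a))).unique ⟨h₁, h₂⟩ ⟨hφ, fun _ => rfl⟩
  obtain ⟨χ, ⟨hχ, hχ'⟩, hu⟩ := existsUnique_lift_representable hc T g φ' hφl (fun k l a => by
    have h₁ := isHomLift_yMap (D.map a).2
    refine Functor.IsStronglyCartesian.ext (presheafFib p) e (δ l) g ?_
    rw [assoc, hn, ← assoc, hφ', assoc, hφ']
    exact congrArg (fun m => φ ≫ m.1) (cA.w a))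
  replace hχ : (presheafFib p).IsHomLift g χ := hχ
  have hχl : (presheafFib p).IsHomLift (g ≫ e) (χ ≫ ψ) := inferInstance
  have hχψ : ∀ k, (χ ≫ ψ) ≫ (cA.π.app k).1 = φ ≫ (cA.π.app k).1 := fun k => by
    rw [assoc, hψ', ← assoc, hχ', hφ']
  refine ⟨χ, ⟨hχ, hA hχl hχψ⟩, fun χ' ⟨h₁, h₂⟩ => ?_⟩
  · change T ⟶ representable p c.pt.1 at χ'
    replace h₁ : (presheafFib p).IsHomLift g χ' := h₁
    replace h₂ : χ' ≫ ψ = φ := h₂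
    refine hu χ' ⟨h₁, fun k => Functor.IsStronglyCartesian.ext (presheafFib p) e (δ k) g ?_⟩
    rw [assoc, ← hψ', ← assoc, h₂, hφ']⟩

end Closure

/-! ### Invariance under equivalence of fibrations -/

section Transport

variable {R : Type u₁} [Category.{v₁} R] {X : Type u₂} [Category.{v₂} X]
  {Y : Type u₃} [Category.{v₃} Y]

/-- Every object of the target is vertically isomorphic to one in the image. -/
def VerticallyEssSurj (F : X ⥤ Y) (q : Y ⥤ R) : Prop :=
  ∀ B : Y, ∃ (A : X) (i : F.obj A ≅ B), q.IsHomLift (𝟙 (q.obj B)) i.hom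

section Functor

variable {F : X ⥤ Y} {q : Y ⥤ R}

lemma isHomLift_comp_iff {I J : R} {u : J ⟶ I} {A B : X} {f : A ⟶ B} :
    (F ⋙ q).IsHomLift u f ↔ q.IsHomLift u (F.map f) :=
  ⟨fun _ => IsHomLift.of_fac' q _ _ (IsHomLift.domain_eq (F ⋙ q) u f)
    (IsHomLift.codomain_eq (F ⋙ q) u f) (IsHomLift.fac' (F ⋙ q) u f),
  fun _ => IsHomLift.of_fac' (F ⋙ q) _ _ (IsHomLift.domain_eq q u (F.map f))
    (IsHomLift.codomain_eq q u (F.map f)) (IsHomLift.fac' q u (F.map f))⟩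

lemma IsCart.map_of_isEquivalence [F.IsEquivalence] {A B : X} {f : A ⟶ B}
    (hf : IsCart (F ⋙ q) f) : IsCart q (F.map f) := by
  rw [isCart_iff] at hf ⊢
  intro T φ g hg
  -- This isomorphism need not be vertical, so the base map `g` is corrected by `q.map i.hom`.
  let i := F.objObjPreimageIso T
  obtain ⟨χ, ⟨h₁, h₂⟩, hu⟩ := hf (F.preimage (i.hom ≫ φ)) (q.map i.hom ≫ g) (by
    simp only [Functor.comp_map, Functor.comp_obj, assoc, F.map_preimage, q.map_comp] at hg ⊢
    rw [hg])
  have h₁' : q.map (F.map χ) = q.map i.hom ≫ g := h₁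
  refine ⟨i.inv ≫ F.map χ, ⟨?_, ?_⟩, fun χ' ⟨h₃, h₄⟩ => ?_⟩
  · rw [q.map_comp, h₁', ← assoc, ← q.map_comp, Iso.inv_hom_id, q.map_id, id_comp]
  · rw [assoc, ← F.map_comp, h₂, F.map_preimage, Iso.inv_hom_id_assoc]
  · rw [← hu (F.preimage (i.hom ≫ χ')) ⟨by simp [h₃], F.map_injective (by simp [h₄])⟩]
    simp

lemma IsCocart.map_of_isEquivalence [F.IsEquivalence] {A B : X} {f : A ⟶ B}
    (hf : IsCocart (F ⋙ q) f) : IsCocart q (F.map f) := by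
  rw [isCocart_iff] at hf ⊢
  intro T φ g hg
  let i := F.objObjPreimageIso T
  obtain ⟨χ, ⟨h₁, h₂⟩, hu⟩ := hf (F.preimage (φ ≫ i.inv)) (g ≫ q.map i.inv) (by
    simp only [Functor.comp_map, Functor.comp_obj, F.map_preimage, q.map_comp] at hg ⊢
    rw [← assoc, hg])
  have h₁' : q.map (F.map χ) = g ≫ q.map i.inv := h₁
  refine ⟨F.map χ ≫ i.hom, ⟨?_, ?_⟩, fun χ' ⟨h₃, h₄⟩ => ?_⟩
  · rw [q.map_comp, h₁', assoc, ← q.map_comp, Iso.inv_hom_id, q.map_id, comp_id]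
  · rw [← assoc, ← F.map_comp, h₂, F.map_preimage, assoc, Iso.inv_hom_id, comp_id]
  · rw [← hu (F.preimage (χ' ≫ i.inv)) ⟨by simp [h₃], F.map_injective (by simp [reassoc_of% h₄])⟩]
    simp

/-- The functor on fibers induced by a functor over the base. -/
def fiberMap (F : X ⥤ Y) (q : Y ⥤ R) (I : R) : (F ⋙ q).Fiber I ⥤ q.Fiber I where
  obj A := ⟨F.obj A.1, A.2⟩
  map f := ⟨F.map f.1, isHomLift_comp_iff.1 f.2⟩
  map_id A := Subtype.ext (F.map_id A.1)
  map_comp f g := Subtype.ext (F.map_comp f.1 g.1)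

/-- Fibers see only vertical isomorphisms, so essential surjectivity of `F` would not by itself give
it on fibers. -/
lemma isEquivalence_fiberMap [F.IsEquivalence] (hs : VerticallyEssSurj F q) (I : R) :
    (fiberMap F q I).IsEquivalence where
  faithful := ⟨fun h => Subtype.ext (F.map_injective (congrArg Subtype.val h))⟩
  full := ⟨fun f => ⟨⟨F.preimage f.1, isHomLift_comp_iff.2
    ((F.map_preimage f.1).symm ▸ f.2)⟩, Subtype.ext (F.map_preimage f.1)⟩⟩
  essSurj := ⟨fun B => by
    obtain ⟨B, rfl⟩ := B
    obtain ⟨A, i, hi⟩ := hs B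
    have hi' := IsHomLift.lift_id_inv q (q.obj B) i
    exact ⟨⟨A, IsHomLift.domain_eq q (𝟙 (q.obj B)) i.hom⟩, ⟨⟨⟨i.hom, hi⟩, ⟨i.inv, hi'⟩,
      Subtype.ext i.hom_inv_id, Subtype.ext i.inv_hom_id⟩⟩⟩⟩

lemma IsVerticalRegularEpi.map_of_isEquivalence [F.IsEquivalence] (hs : VerticallyEssSurj F q)
    {A B : X} {e : A ⟶ B} (he : IsVerticalRegularEpi (F ⋙ q) e) :
    IsVerticalRegularEpi q (F.map e) := by
  obtain ⟨I, h, hreg⟩ := he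
  have := isEquivalence_fiberMap hs I
  have he' := IsRegularEpi.getStruct (Functor.Fiber.homMk (F ⋙ q) I e)
  refine ⟨I, isHomLift_comp_iff.1 h, ⟨⟨(fiberMap F q I).obj he'.W, (fiberMap F q I).map he'.left,
    (fiberMap F q I).map he'.right, ((fiberMap F q I).map_comp _ _).symm.trans
      ((congrArg (fiberMap F q I).map he'.w).trans ((fiberMap F q I).map_comp _ _)),
    isColimitCoforkMapOfIsColimit (fiberMap F q I) he'.w he'.isColimit⟩⟩⟩

/-- `F` carries lifting problems to lifting problems, and full faithfulness brings solutions back,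
once the covering object `Q` is replaced by an isomorphic one in the image. -/
lemma indecProj_of_isEquivalence [F.IsEquivalence] (hs : VerticallyEssSurj F q) {A : X}
    (hA : indecProj q (F.obj A)) : indecProj (F ⋙ q) A := by
  constructor
  · intro D A' S c f s hc hs
    obtain ⟨m, hm, hu⟩ := hA.1 (F.map c) (F.map f) (F.map s) hc.map_of_isEquivalence
      hs.map_of_isEquivalence
    exact ⟨F.preimage m, F.map_injective (by simpa using hm), fun m' hm' => F.map_injective (by
      rw [F.map_preimage]
      exact hu _ (show F.map m' ≫ F.map s = F.map f by rw [← F.map_comp, hm']))⟩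
  · intro D A' S c f e hc he
    obtain ⟨Q, d, g, hd, hg⟩ := hA.2 (F.map c) (F.map f) (F.map e) hc.map_of_isEquivalence
      (he.map_of_isEquivalence hs)
    let i := F.objObjPreimageIso Q
    refine ⟨_, F.preimage (i.hom ≫ d), F.preimage (i.hom ≫ g), ⟨?_, IsCart.of_map F ?_⟩,
      F.map_injective (by simp [hg])⟩
    · rw [Functor.comp_map, F.map_preimage, q.map_comp]
      have := hd.1
      exact (MorphismProperty.cancel_left_of_respectsIso (.regularEpi R) (q.map i.hom) (q.map d)).2 this
    · rw [F.map_preimage]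
      exact (IsCart.of_isIso (p := q) i.hom).comp hd.2

end Functor

lemma FibrationsEquivalent.exists_functor {p : X ⥤ R} {q : Y ⥤ R} (h : FibrationsEquivalent p q) :
    ∃ (F : X ⥤ Y) (G : Y ⥤ X), F ⋙ q = p ∧ G ⋙ p = q ∧ F.IsEquivalence ∧ G.IsEquivalence ∧
      (∀ A, ∃ i : G.obj (F.obj A) ≅ A, p.IsHomLift (𝟙 (p.obj A)) i.hom) ∧
      ∀ B, ∃ i : F.obj (G.obj B) ≅ B, q.IsHomLift (𝟙 (q.obj B)) i.hom := by
  obtain ⟨F, G, -, -, ⟨η⟩, ⟨ε⟩⟩ := h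
  let η' : F.toFunctor ⋙ G.toFunctor ≅ 𝟭 X := (BasedNatTrans.forgetful _ _).mapIso η
  let ε' : G.toFunctor ⋙ F.toFunctor ≅ 𝟭 Y := (BasedNatTrans.forgetful _ _).mapIso ε
  let E : X ≌ Y := CategoryTheory.Equivalence.mk F.toFunctor G.toFunctor η'.symm ε'
  have hE : F.toFunctor.IsEquivalence := E.isEquivalence_functor
  have hE' : G.toFunctor.IsEquivalence := E.isEquivalence_inverse
  exact ⟨F.toFunctor, G.toFunctor, F.w, G.w, hE, hE',
    fun A => ⟨η'.app A, η.hom.isHomLift' A⟩, fun B => ⟨ε'.app B, ε.hom.isHomLift' B⟩⟩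

lemma IsVerticalRegularEpi.comp_iso {p : X ⥤ R} {A B C : X} {e : A ⟶ B}
    (he : IsVerticalRegularEpi p e) (i : B ≅ C) (hi : p.IsHomLift (𝟙 (p.obj C)) i.hom) :
    IsVerticalRegularEpi p (e ≫ i.hom) := by
  obtain ⟨I, h, hreg⟩ := he
  obtain rfl : p.obj C = I := by
    rw [← IsHomLift.domain_eq p (𝟙 (p.obj C)) i.hom]
    exact IsHomLift.codomain_eq p (𝟙 I) e
  have := IsHomLift.lift_id_inv p (p.obj C) i
  refine ⟨p.obj C, inferInstance, ?_⟩
  let j : Functor.Fiber.mk (IsHomLift.codomain_eq p (𝟙 (p.obj C)) e) ≅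
      Functor.Fiber.mk (IsHomLift.codomain_eq p (𝟙 (p.obj C)) i.hom) :=
    ⟨⟨i.hom, hi⟩, ⟨i.inv, this⟩, Subtype.ext i.hom_inv_id, Subtype.ext i.inv_hom_id⟩
  have hj : IsIso j.hom := ⟨j.inv, j.hom_inv_id, j.inv_hom_id⟩
  exact (@MorphismProperty.cancel_right_of_respectsIso _ _ (.regularEpi _) _ _ _ _
    (Functor.Fiber.homMk p (p.obj C) e) j.hom hj).2 hreg

/-- Both functors reflect indecomposable projectives. Preservation by one follows from reflection by
the other, as the composites are isomorphic to the identities. -/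
lemma FibrationsEquivalent.exists_functor_indecProj {p : X ⥤ R} {q : Y ⥤ R}
    (h : FibrationsEquivalent p q) :
    ∃ (F : X ⥤ Y) (G : Y ⥤ X), F ⋙ q = p ∧ G ⋙ p = q ∧ F.IsEquivalence ∧ G.IsEquivalence ∧
      VerticallyEssSurj F q ∧ VerticallyEssSurj G p ∧
      (∀ A, ∃ i : G.obj (F.obj A) ≅ A, p.IsHomLift (𝟙 (p.obj A)) i.hom) ∧
      (∀ A, indecProj q (F.obj A) ↔ indecProj p A) ∧ ∀ B, indecProj q B → indecProj p (G.obj B) := by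
  obtain ⟨F, G, hF, hG, hFe, hGe, hη, hε⟩ := h.exists_functor
  have hFs : VerticallyEssSurj F q := fun B => ⟨_, hε B⟩
  have hGs : VerticallyEssSurj G p := fun A => ⟨_, hη A⟩
  have hFp : ∀ A, indecProj q (F.obj A) → indecProj p A := fun A hA => by
    rw [← hF]
    exact indecProj_of_isEquivalence hFs hA
  refine ⟨F, G, hF, hG, hFe, hGe, hFs, hGs, hη, fun A => ⟨hFp A, fun hA => ?_⟩, fun B hB => ?_⟩
  · obtain ⟨i, -⟩ := hη A
    rw [← hG]
    exact indecProj_of_isEquivalence hGs (indecProj_of_cart i.hom (IsCart.of_isIso _) hA)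
  · obtain ⟨i, -⟩ := hε B
    exact hFp _ (indecProj_of_cart i.hom (IsCart.of_isIso _) hB)

lemma FibrationsEquivalent.coveredByIndecProj {p : X ⥤ R} {q : Y ⥤ R}
    (h : FibrationsEquivalent p q) (hq : CoveredByIndecProj q) : CoveredByIndecProj p := by
  obtain ⟨F, G, hF, rfl, hFe, hGe, hFs, hGs, hη, -, hi⟩ := h.exists_functor_indecProj
  intro B
  obtain ⟨A, S, s, e, hA, hs, he⟩ := hq (F.obj B)
  obtain ⟨i, hiB⟩ := hη B
  exact ⟨G.obj A, G.obj S, G.map s, G.map e ≫ i.hom, hi A hA, hs.map_of_isEquivalence,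
    (he.map_of_isEquivalence hGs).comp_iso i hiB⟩

lemma FibrationsEquivalent.indecProjClosedUnderFiniteLimits {p : X ⥤ R} {q : Y ⥤ R}
    (h : FibrationsEquivalent p q) (hq : IndecProjClosedUnderFiniteLimits q) :
    IndecProjClosedUnderFiniteLimits p := by
  obtain ⟨F, G, rfl, -, hFe, -, hFs, -, -, h₁, -⟩ := h.exists_functor_indecProj
  refine fun I K _ _ => ⟨fun A ⟨pres⟩ => (h₁ _).1 ?_⟩
  have := isEquivalence_fiberMap hFs I
  have := hq I K
  exact ObjectProperty.prop_of_isLimit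
    ((indecProj q).inverseImage (Functor.Fiber.fiberInclusion : q.Fiber I ⥤ Y))
    (isLimitOfPreserves (fiberMap F q I) pres.isLimit) fun k => (h₁ _).2 (pres.prop_diag_obj k)

end Transport

/-! ### Finite limits of indecomposable projectives -/

section IndecProjLimits

variable {R : Type u₁} [Category.{v₁} R] {X : Type u₂} [Category.{v₂} X] {p : X ⥤ R}

instance full_fiberMap {Y : Type u₃} [Category.{v₃} Y] (F : Y ⥤ X) [F.Full] [F.Faithful] (I : R) :
    (fiberMap F p I).Full :=
  ⟨fun f => ⟨⟨F.preimage f.1, isHomLift_comp_iff.2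
    ((F.map_preimage f.1).symm ▸ f.2)⟩, Subtype.ext (F.map_preimage f.1)⟩⟩

instance faithful_fiberMap {Y : Type u₃} [Category.{v₃} Y] (F : Y ⥤ X) [F.Faithful] (I : R) :
    (fiberMap F p I).Faithful :=
  ⟨fun h => Subtype.ext (F.map_injective (congrArg Subtype.val h))⟩

/-- Reindexing in the subfibration of indecomposable projectives agrees with reindexing in the
ambient fibration. -/
lemma exists_reindex_indecProjFib_iso [p.IsFibered] {I J : R} (u : J ⟶ I) :
    Nonempty (reindex (indecProjFib p) u ⋙ fiberMap (indecProj p).ι p J ≅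
      fiberMap (indecProj p).ι p I ⋙ reindex p u) := by
  let P := (indecProj p).ι
  let b : ∀ A : (indecProjFib p).Fiber I,
      ((fiberMap P p J).obj ((reindex (indecProjFib p) u).obj A)).1 ⟶ ((fiberMap P p I).obj A).1 :=
    fun A => P.map (reindexLift (indecProjFib p) u A)
  have hb : ∀ A, p.IsStronglyCartesian u (b A) := fun A =>
    isStronglyCartesian_of_isHomLift (isHomLift_comp_iff.1 inferInstance)
      ((isCart_fullSubcategory_iff _ indecProj_of_cart _).1
        (IsCart.of_lift (p := indecProjFib p) (u := u)
          (f := reindexLift (indecProjFib p) u A) inferInstance))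
  let c : ∀ A : (indecProjFib p).Fiber I,
      ((reindex p u).obj ((fiberMap P p I).obj A)).1 ⟶ ((fiberMap P p I).obj A).1 :=
    fun A => reindexLift p u ((fiberMap P p I).obj A)
  have hc : ∀ A, p.IsStronglyCartesian u (c A) := fun A => by
    dsimp only [c]
    infer_instance
  let f : ∀ A, (fiberMap P p J).obj ((reindex (indecProjFib p) u).obj A) ⟶
      (reindex p u).obj ((fiberMap P p I).obj A) := fun A =>
    ⟨Functor.IsCartesian.map p u (c A) (b A), inferInstance⟩
  let g : ∀ A, (reindex p u).obj ((fiberMap P p I).obj A) ⟶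
      (fiberMap P p J).obj ((reindex (indecProjFib p) u).obj A) := fun A =>
    ⟨Functor.IsCartesian.map p u (b A) (c A), inferInstance⟩
  have hf : ∀ A, (f A).1 ≫ c A = b A := fun A => Functor.IsCartesian.fac p u (c A) (b A)
  have hg : ∀ A, (g A).1 ≫ b A = c A := fun A => Functor.IsCartesian.fac p u (b A) (c A)
  refine ⟨NatIso.ofComponents (fun A => ⟨f A, g A, ?_, ?_⟩) ?_⟩
  · refine fiber_hom_ext_of_cart (u := u) (b A) ?_
    change ((f A).1 ≫ (g A).1) ≫ b A = 𝟙 _ ≫ b A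
    rw [assoc, hg, hf, id_comp]
  · refine fiber_hom_ext_of_cart (u := u) (c A) ?_
    change ((g A).1 ≫ (f A).1) ≫ c A = 𝟙 _ ≫ c A
    rw [assoc, hf, hg, id_comp]
  · intro A B k
    refine fiber_hom_ext_of_cart (u := u) (c B) ?_
    have h₁ : P.map ((reindex (indecProjFib p) u).map k).1 ≫ b B = b A ≫ P.map k.1 :=
      (P.map_comp _ _).symm.trans ((congrArg (fun m => P.map m)
        (reindex_map_lift (p := indecProjFib p) u k)).trans (P.map_comp _ _))
    have h₂ := reindex_map_lift (p := p) u ((fiberMap P p I).map k)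
    change (P.map ((reindex (indecProjFib p) u).map k).1 ≫ (f B).1) ≫ c B =
      ((f A).1 ≫ ((reindex p u).map ((fiberMap P p I).map k)).1) ≫ c B
    exact (assoc _ _ _).trans ((congrArg (P.map _ ≫ ·) (hf B)).trans (h₁.trans
      ((congrArg (· ≫ P.map k.1) (hf A)).symm.trans ((assoc _ _ _).trans
        ((congrArg ((f A).1 ≫ ·) h₂.symm).trans (assoc _ _ _).symm)))))

/-- By closure, the fully faithful inclusion of fibers creates finite limits. Since it also reflects
them and commutes with reindexing, preservation by reindexing is inherited from `p`. -/
lemma isFiniteLimitPrestack_indecProjFib [Regular R] [IsFiniteLimitPrestack p]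
    (h : IndecProjClosedUnderFiniteLimits p) : IsFiniteLimitPrestack (indecProjFib p) := by
  have := isPrestack_indecProjFib (p := p)
  have key : ∀ (I : R) (K : Type) [SmallCategory K] [FinCategory K],
      HasLimitsOfShape K ((indecProjFib p).Fiber I) ∧
        PreservesLimitsOfShape K (fiberMap (indecProj p).ι p I) := by
    intro I K _ _
    have := h I K
    have := IsFiniteLimitPrestack.hasFiniteLimits (p := p) I
    have cr : ∀ F : K ⥤ (indecProjFib p).Fiber I,
        Nonempty (CreatesLimit F (fiberMap (indecProj p).ι p I)) := fun F => by
      have hL := ObjectProperty.prop_limit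
        ((indecProj p).inverseImage (Functor.Fiber.fiberInclusion : p.Fiber I ⥤ X))
        (F ⋙ fiberMap (indecProj p).ι p I) (fun k => (F.obj k).1.2)
      let L : (indecProjFib p).Fiber I :=
        ⟨⟨(limit (F ⋙ fiberMap (indecProj p).ι p I)).1, hL⟩,
          (limit (F ⋙ fiberMap (indecProj p).ι p I)).2⟩
      exact ⟨createsLimitOfFullyFaithfulOfIso L (Iso.refl _)⟩
    refine ⟨⟨fun F => ?_⟩, ⟨fun {F} => ?_⟩⟩
    · have := (cr F).some
      exact hasLimit_of_created F (fiberMap (indecProj p).ι p I)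
    · have := (cr F).some
      infer_instance
  refine { hasFiniteLimits := fun I => ⟨fun K _ _ => (key I K).1⟩,
           preservesFiniteLimits := fun {J I} u => ⟨fun K _ _ => ?_⟩ }
  have := (key I K).2
  have := IsFiniteLimitPrestack.preservesFiniteLimits (p := p) u
  obtain ⟨i⟩ := exists_reindex_indecProjFib_iso (p := p) u
  have : PreservesLimitsOfShape K
      (reindex (indecProjFib p) u ⋙ fiberMap (indecProj p).ι p J) :=
    preservesLimitsOfShape_of_natIso i.symm
  exact preservesLimitsOfShape_of_reflects_of_preserves _ (fiberMap (indecProj p).ι p J)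

end IndecProjLimits

/-! ### Covering maps: cocartesian maps followed by vertical regular epimorphisms -/

section CoverMap

variable {R : Type u₁} [Category.{v₁} R] {X : Type u₂} [Category.{v₂} X] {p : X ⥤ R}

/-- A cocartesian map followed by a vertical regular epimorphism. -/
def IsCoverMap (p : X ⥤ R) {A B : X} (q : A ⟶ B) : Prop :=
  ∃ (S : X) (s : A ⟶ S) (e : S ⟶ B), IsCocart p s ∧ IsVerticalRegularEpi p e ∧ s ≫ e = q

lemma IsVerticalRegularEpi.id (A : X) : IsVerticalRegularEpi p (𝟙 A) := by
  have h : p.IsHomLift (𝟙 (p.obj A)) (𝟙 A) := inferInstance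
  exact ⟨p.obj A, h, inferInstanceAs (IsRegularEpi (𝟙 (Functor.Fiber.mk (p := p) (rfl : p.obj A = p.obj A))))⟩

lemma IsCocart.isCoverMap {A B : X} {s : A ⟶ B} (hs : IsCocart p s) : IsCoverMap p s :=
  ⟨B, s, 𝟙 B, hs, IsVerticalRegularEpi.id B, comp_id s⟩

lemma isHomLift_unique {I J : R} {u v : J ⟶ I} {A B : X} {f : A ⟶ B} (hu : p.IsHomLift u f)
    (hv : p.IsHomLift v f) : u = v :=
  (IsHomLift.fac p u f).trans (IsHomLift.fac p v f).symm

lemma map_eq_of_isHomLift {I J : R} {u : J ⟶ I} {A B : X} {f g : A ⟶ B} (hf : p.IsHomLift u f)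
    (hg : p.IsHomLift u g) : p.map f = p.map g :=
  (IsHomLift.fac' p u f).trans (IsHomLift.fac' p u g).symm

/-- Indecomposable projectives lift locally along covering maps. -/
lemma IsCoverMap.exists_lift {A B T : X} {q : A ⟶ B} (hq : IsCoverMap p q) (hT : indecProj p T)
    (x : T ⟶ B) : ∃ (T' : X) (t : T' ⟶ T) (a : T' ⟶ A), IsCoverCart p t ∧ a ≫ q = t ≫ x := by
  obtain ⟨S, s, e, hs, he, rfl⟩ := hq
  obtain ⟨T', t, g, ht, hg⟩ := hT.2 (𝟙 T) x e (IsCart.of_isIso _) he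
  obtain ⟨a, ha, -⟩ := hT.1 t g s ht.2 hs
  exact ⟨T', t, a, ht, by rw [← assoc, ha, hg]⟩

/-- The coequalizer property in the fiber extends to maps over an arbitrary `w`, because these are
vertical maps into the reindexing of `Y` along `w`. -/
lemma IsVerticalRegularEpi.existsUnique_desc [p.IsFibered] {S B Y : X} {e : S ⟶ B}
    (he : IsVerticalRegularEpi p e) (f : S ⟶ Y) (w : p.obj B ⟶ p.obj Y)
    (hw : p.map e ≫ w = p.map f)
    (h : ∀ ⦃T : X⦄ (k₁ k₂ : T ⟶ S), k₁ ≫ e = k₂ ≫ e → k₁ ≫ f = k₂ ≫ f) :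
    ∃! g : B ⟶ Y, p.map g = w ∧ e ≫ g = f := by
  obtain ⟨I, hI, hreg⟩ := he
  obtain rfl : p.obj B = I := IsHomLift.codomain_eq p (𝟙 I) e
  obtain ⟨Y', y, hy, hy'⟩ := exists_cart Y w
  have hy'' := isStronglyCartesian_of_isHomLift hy hy'
  have hpe : p.map e = eqToHom (IsHomLift.domain_eq p (𝟙 (p.obj B)) e) := by
    simpa using IsHomLift.fac' p (𝟙 (p.obj B)) e
  have hf : p.IsHomLift (𝟙 (p.obj B) ≫ w) f := by
    refine IsHomLift.of_fac' p _ _ (IsHomLift.domain_eq p (𝟙 (p.obj B)) e) rfl ?_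
    rw [← hw, hpe]
    simp
  have hf' : p.IsHomLift w f := by rwa [id_comp] at hf
  let Y₀ : p.Fiber (p.obj B) := ⟨Y', IsHomLift.domain_eq p w y⟩
  let S₀ : p.Fiber (p.obj B) := ⟨S, IsHomLift.domain_eq p (𝟙 (p.obj B)) e⟩
  let B₀ : p.Fiber (p.obj B) := ⟨B, rfl⟩
  let e₀ : S₀ ⟶ B₀ := ⟨e, hI⟩
  replace hreg : IsRegularEpi e₀ := hreg
  let f₀ : S₀ ⟶ Y₀ := ⟨Functor.IsCartesian.map p w y f, inferInstance⟩
  have hf₀ : f₀.1 ≫ y = f := Functor.IsCartesian.fac p w y f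
  have hcoeq : IsRegularEpi.left e₀ ≫ f₀ = IsRegularEpi.right e₀ ≫ f₀ := by
    refine fiber_hom_ext_of_cart (u := w) y ?_
    change ((IsRegularEpi.left e₀).1 ≫ f₀.1) ≫ y = ((IsRegularEpi.right e₀).1 ≫ f₀.1) ≫ y
    rw [assoc, assoc, hf₀]
    exact h _ _ (congrArg Subtype.val (IsRegularEpi.w e₀))
  have hg₀ : e ≫ (IsRegularEpi.desc e₀ f₀ hcoeq).1 = f₀.1 :=
    congrArg Subtype.val (IsRegularEpi.fac e₀ f₀ hcoeq)
  have hg₀' := (IsRegularEpi.desc e₀ f₀ hcoeq).2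
  have hgl : p.IsHomLift w ((IsRegularEpi.desc e₀ f₀ hcoeq).1 ≫ y) := inferInstance
  refine ⟨(IsRegularEpi.desc e₀ f₀ hcoeq).1 ≫ y, ⟨isHomLift_iff_map_eq.1 hgl, ?_⟩, ?_⟩
  · rw [← assoc, hg₀, hf₀]
  · rintro g ⟨hg, hg'⟩
    have hgl' : p.IsHomLift w g := isHomLift_iff_map_eq.2 hg
    let g₀ : B₀ ⟶ Y₀ := ⟨Functor.IsCartesian.map p w y g, inferInstance⟩
    have hg₁ : g₀.1 ≫ y = g := Functor.IsCartesian.fac p w y g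
    have : g₀ = IsRegularEpi.desc e₀ f₀ hcoeq := by
      refine IsRegularEpi.uniq e₀ f₀ hcoeq g₀ ?_
      refine fiber_hom_ext_of_cart (u := w) y ?_
      change (e ≫ g₀.1) ≫ y = f₀.1 ≫ y
      rw [assoc, hg₁, hf₀, hg']
    rw [← hg₁, this]

lemma IsCoverMap.hom_ext [p.IsFibered] {A B Y : X} {q : A ⟶ B} (hq : IsCoverMap p q)
    {g g' : B ⟶ Y} (h : p.map g = p.map g') (h' : q ≫ g = q ≫ g') : g = g' := by
  obtain ⟨S, s, e, hs, he, rfl⟩ := hq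
  refine (he.existsUnique_desc (e ≫ g') (p.map g') (p.map_comp _ _).symm
    (fun T k₁ k₂ hk => by rw [← assoc, hk, assoc])).unique ⟨h, hs.hom_ext ?_ ?_⟩ ⟨rfl, rfl⟩
  · rw [p.map_comp, h, p.map_comp]
  · simpa only [assoc] using h'

lemma CoveredByIndecProj.exists_coverMap (hcov : CoveredByIndecProj p) (Z : X) :
    ∃ (A : X) (q : A ⟶ Z), indecProj p A ∧ IsCoverMap p q := by
  obtain ⟨A, S, s, e, hA, hs, he⟩ := hcov Z
  exact ⟨A, s ≫ e, hA, S, s, e, hs, he, rfl⟩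

/-- Descent of morphisms along covering maps can be tested on indecomposable projectives, provided
that there are enough of them. -/
lemma IsCoverMap.existsUnique_desc [p.IsFibered] (hcov : CoveredByIndecProj p) {A B Y : X}
    {q : A ⟶ B} (hq : IsCoverMap p q) (f : A ⟶ Y) {I J : R} {u : p.obj A ⟶ I} {w : I ⟶ J}
    (hu : p.IsHomLift u q) (hf : p.IsHomLift (u ≫ w) f)
    (h : ∀ ⦃T : X⦄, indecProj p T → ∀ x y : T ⟶ A, x ≫ q = y ≫ q → x ≫ f = y ≫ f) :
    ∃! g : B ⟶ Y, p.IsHomLift w g ∧ q ≫ g = f := by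
  obtain rfl : p.obj B = I := IsHomLift.codomain_eq p u q
  obtain rfl : p.obj Y = J := IsHomLift.codomain_eq p (u ≫ w) f
  obtain rfl : p.map q = u := isHomLift_iff_map_eq.1 hu
  have hw : p.map f = p.map q ≫ w := isHomLift_iff_map_eq.1 hf
  refine existsUnique_of_exists_of_unique ?_ fun g g' ⟨hg, hg'⟩ ⟨hk, hk'⟩ =>
    hq.hom_ext (map_eq_of_isHomLift hg hk) (hg'.trans hk'.symm)
  have hq' := hq
  obtain ⟨S, s, e, hs, he, rfl⟩ := hq
  rw [p.map_comp, assoc] at hw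
  obtain ⟨f', hf₁, hf₂⟩ := hs.exists_desc f (p.map e ≫ w) hw.symm
  obtain ⟨g, ⟨hg₁, hg₂⟩, -⟩ := he.existsUnique_desc f' w hf₁.symm fun W k₁ k₂ hk => by
    -- On an indecomposable projective cover of `W` the pair lifts through `s` to `A`, where `h`
    -- applies.
    obtain ⟨C, c, hC, hc⟩ := hcov.exists_coverMap W
    obtain ⟨m₁, hm₁, -⟩ := hC.1 (𝟙 C) (c ≫ k₁) s (IsCart.of_isIso _) hs
    obtain ⟨m₂, hm₂, -⟩ := hC.1 (𝟙 C) (c ≫ k₂) s (IsCart.of_isIso _) hs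
    refine hc.hom_ext ?_ ?_
    · rw [p.map_comp, p.map_comp, hf₁, ← assoc, ← assoc, ← p.map_comp, ← p.map_comp, hk]
    · have := h hC m₁ m₂ (by rw [← assoc, hm₁, ← assoc, hm₂, assoc, hk, ← assoc])
      rw [← assoc, ← hm₁, ← assoc, ← hm₂, assoc, assoc, hf₂, this]
  exact ⟨g, isHomLift_iff_map_eq.2 hg₁, by rw [assoc, hg₂, hf₂]⟩

lemma isHomLift_of_epi_comp {A B C : X} {t : A ⟶ B} {f : B ⟶ C} {I : R} {v : p.obj B ⟶ I}
    [Epi (p.map t)] (h : p.IsHomLift (p.map t ≫ v) (t ≫ f)) : p.IsHomLift v f := by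
  obtain rfl : p.obj C = I := IsHomLift.codomain_eq p (p.map t ≫ v) (t ≫ f)
  rw [isHomLift_iff_map_eq, p.map_comp, cancel_epi] at h
  exact isHomLift_iff_map_eq.2 h

end CoverMap

/-! ### Presentations of objects by presheaves on the indecomposable projectives -/

section Presentation

variable {R : Type u₁} [Category.{v₁} R] [Regular R] {X : Type u₂} [Category.{v₂} X] {p : X ⥤ R}

/-- `q` exhibits `Z` as the quotient of the internal sum of `A.obj` along `A.struct` by `A.rel`. -/
structure IsPresentation (A : Presheaf (indecProjFib p)) {Z : X} (q : A.obj.obj ⟶ Z) : Prop where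
  isHomLift : p.IsHomLift A.struct q
  isCoverMap : IsCoverMap p q
  holds_iff : ∀ {T : (indecProj p).FullSubcategory} (x y : T ⟶ A.obj),
    A.rel.Holds (indecProjFib p) x y ↔ x.hom ≫ q = y.hom ≫ q

/-- The relation is carried by an indecomposable projective covering the weak kernel pair of `q`.
Pairs identified by `q` factor through the kernel pair, and then locally through the cover, since
their source is an indecomposable projective. -/
lemma exists_presheaf_presentation [IsFiniteLimitPrestack p] (hcov : CoveredByIndecProj p) (Z : X) :
    ∃ (A : Presheaf (indecProjFib p)) (q : A.obj.obj ⟶ Z), IsPresentation A q := by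
  obtain ⟨A, q, hA, hq⟩ := hcov.exists_coverMap Z
  obtain ⟨W, a, b, hab, hW⟩ := IsFiniteLimitPrestack.exists_weakPullback (p := p) q q
  obtain ⟨D, c, hD, hc⟩ := hcov.exists_coverMap W
  let A₀ : (indecProj p).FullSubcategory := ⟨A, hA⟩
  let ρ : SieveRel A₀ A₀ :=
    { dom := ⟨D, hD⟩
      fst := ObjectProperty.homMk (c ≫ a)
      snd := ObjectProperty.homMk (c ≫ b) }
  have hρ : ∀ {T : (indecProj p).FullSubcategory} (x y : T ⟶ A₀),
      ρ.Holds (indecProjFib p) x y ↔ x.hom ≫ q = y.hom ≫ q := by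
    intro T x y
    constructor
    · rintro ⟨T', t, k, ht, h₁, h₂⟩
      replace ht := (isCoverCart_indecProjFib_iff t).1 ht
      have h₁' : k.hom ≫ c ≫ a = t.hom ≫ x.hom := congrArg InducedCategory.Hom.hom h₁
      have h₂' : k.hom ≫ c ≫ b = t.hom ≫ y.hom := congrArg InducedCategory.Hom.hom h₂
      refine ht.cancel ?_
      rw [← reassoc_of% h₁', ← reassoc_of% h₂', hab]
    · intro h
      obtain ⟨z, hz₁, hz₂⟩ := hW x.hom y.hom h
      obtain ⟨T', t, k, ht, hk⟩ := hc.exists_lift T.2 z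
      let T₀ : (indecProj p).FullSubcategory := ⟨T', indecProj_of_cart t ht.2 T.2⟩
      let t₀ : T₀ ⟶ T := ObjectProperty.homMk t
      let k₀ : T₀ ⟶ ρ.dom := ObjectProperty.homMk k
      refine ⟨T₀, t₀, k₀, (isCoverCart_indecProjFib_iff t₀).2 ht, ObjectProperty.hom_ext _ ?_,
        ObjectProperty.hom_ext _ ?_⟩
      · change k ≫ c ≫ a = t ≫ x.hom
        rw [← assoc, hk, assoc, hz₁]
      · change k ≫ c ≫ b = t ≫ y.hom
        rw [← assoc, hk, assoc, hz₂]
  refine ⟨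
    { base := p.obj Z
      obj := A₀
      struct := p.map q
      rel := ρ
      rel_struct := ?_
      refl := fun x => (hρ x x).2 rfl
      symm := fun {T x y} h => (hρ y x).2 ((hρ x y).1 h).symm
      trans := fun {T x y z} h h' => (hρ x z).2 (((hρ x y).1 h).trans ((hρ y z).1 h')) }, q,
    isHomLift_iff_map_eq.2 rfl, hq, hρ⟩
  change p.map (c ≫ a) ≫ p.map q = p.map (c ≫ b) ≫ p.map q
  rw [← p.map_comp, ← p.map_comp, assoc, assoc, hab]

/-! ### Morphisms of objects versus morphisms of their presentations. -/

section Maps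

variable [IsPrestack p] {A B C : Presheaf (indecProjFib p)} {Z W V : X} {q : A.obj.obj ⟶ Z}
  {r : B.obj.obj ⟶ W} {s : C.obj.obj ⟶ V}

/-- `φ : A ⟶ B` and `h : Z ⟶ W` correspond to each other under presentations `q` of `Z` by `A` and
`r` of `W` by `B`. -/
structure Tracks (q : A.obj.obj ⟶ Z) (r : B.obj.obj ⟶ W) (φ : A ⟶ B) (h : Z ⟶ W) : Prop where
  isHomLift : p.IsHomLift (baseMap φ) h
  comm : ∀ {T : (indecProj p).FullSubcategory} (a : T ⟶ A.obj) (b : T ⟶ B.obj),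
    el A a ≫ φ = el B b → a.hom ≫ q ≫ h = b.hom ≫ r

lemma IsPresentation.holds_iff_el (hq : IsPresentation A q) {T : (indecProj p).FullSubcategory}
    (x y : T ⟶ A.obj) : el A x = el A y ↔ x.hom ≫ q = y.hom ≫ q :=
  (el_eq_el_iff A x y).trans (hq.holds_iff x y)

lemma IsPresentation.tracks_id (hq : IsPresentation A q) : Tracks q q (𝟙 A) (𝟙 Z) := by
  have := hq.isHomLift
  refine ⟨IsHomLift.id (IsHomLift.codomain_eq p A.struct q), fun a b h => ?_⟩
  rw [comp_id] at h
  rw [comp_id]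
  exact (hq.holds_iff_el a b).1 h

lemma Tracks.comp {φ : A ⟶ B} {ψ : B ⟶ C} {h : Z ⟶ W} {k : W ⟶ V} (hφ : Tracks q r φ h)
    (hψ : Tracks r s ψ k) : Tracks q s (φ ≫ ψ) (h ≫ k) := by
  have h₁ := hφ.isHomLift
  have h₂ := hψ.isHomLift
  refine ⟨?_, fun {T} a c hac => ?_⟩
  · rw [baseMap_comp]
    infer_instance
  · obtain ⟨T', t, b, ht, hb⟩ := exists_el (el A a ≫ φ)
    have h₃ := hφ.comm (t ≫ a) b (by rw [← yMap_comp_el, assoc, hb])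
    have h₄ := hψ.comm b (t ≫ c) (by rw [← hb, assoc, assoc, hac, yMap_comp_el])
    refine ((isCoverCart_indecProjFib_iff t).1 ht).cancel ?_
    simp only [ObjectProperty.FullSubcategory.comp_hom, assoc] at h₃ h₄
    rw [← h₄, ← reassoc_of% h₃]

lemma Tracks.hom_unique (hq : IsPresentation A q) {φ : A ⟶ B} {h h' : Z ⟶ W}
    (hh : Tracks q r φ h) (hh' : Tracks q r φ h') : h = h' := by
  obtain ⟨T, t, b, ht, hb⟩ := exists_el_of_hom φ
  refine hq.isCoverMap.hom_ext (map_eq_of_isHomLift hh.isHomLift hh'.isHomLift)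
    (((isCoverCart_indecProjFib_iff t).1 ht).cancel ?_)
  rw [hh.comm t b hb, hh'.comm t b hb]

lemma Tracks.presheaf_hom_unique (hr : IsPresentation B r) {φ φ' : A ⟶ B} {h : Z ⟶ W}
    (hφ : Tracks q r φ h) (hφ' : Tracks q r φ' h) : φ = φ' := by
  obtain ⟨T, t, b, ht, hb⟩ := exists_el_of_hom φ
  obtain ⟨T', t', b', ht', hb'⟩ := exists_el (el A t ≫ φ')
  refine hom_ext_of_el (isHomLift_unique hφ.isHomLift hφ'.isHomLift) ht (yoneda_cancel ht' ?_)
  rw [hb, hb', yMap_comp_el, hr.holds_iff_el]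
  rw [← assoc, yMap_comp_el] at hb'
  have h₁ := hφ.comm t b hb
  have h₂ := hφ'.comm _ _ hb'
  simp only [ObjectProperty.FullSubcategory.comp_hom, assoc] at h₂ ⊢
  rw [← h₂, ← h₁]

/-- `q ≫ h` starts at an indecomposable projective, so it lifts locally along `r`. The local lift
respects the relations because these are detected by `q` and `r`. -/
lemma IsPresentation.exists_presheaf_hom (hq : IsPresentation A q) (hr : IsPresentation B r)
    (w : A.base ⟶ B.base) (h : Z ⟶ W) (hw : p.IsHomLift w h) :
    ∃ φ : A ⟶ B, baseMap φ = w ∧ Tracks q r φ h := by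
  have hql := hq.isHomLift
  have hrl := hr.isHomLift
  obtain ⟨T, t, b, ht, hb⟩ := hr.isCoverMap.exists_lift A.obj.2 (q ≫ h)
  let T₀ : (indecProj p).FullSubcategory := ⟨T, indecProj_of_cart t ht.2 A.obj.2⟩
  let t₀ : T₀ ⟶ A.obj := ObjectProperty.homMk t
  let b₀ : T₀ ⟶ B.obj := ObjectProperty.homMk b
  have ht₀ : IsCoverCart (indecProjFib p) t₀ := (isCoverCart_indecProjFib_iff t₀).2 ht
  have hxb : ∀ {U : (indecProj p).FullSubcategory} (x : U ⟶ T₀),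
      (x ≫ b₀).hom ≫ r = (x ≫ t₀).hom ≫ q ≫ h := fun x => by
    change (x.hom ≫ b) ≫ r = (x.hom ≫ t) ≫ q ≫ h
    rw [assoc, hb, assoc]
  obtain ⟨φ, hφ, hφ'⟩ := exists_hom_of_el ht₀ w (el B b₀) (by
      have h₁ : p.IsHomLift (p.map b ≫ B.struct) (b ≫ r) := inferInstance
      have h₂ : p.IsHomLift (p.map t ≫ A.struct ≫ w) (b ≫ r) := by
        rw [hb]
        infer_instance
      exact isHomLift_unique h₁ h₂) (fun U x y hxy => by
        rw [yMap_comp_el, yMap_comp_el, hr.holds_iff_el, hxb, hxb, ← assoc,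
          (hq.holds_iff _ _).1 hxy, assoc])
  refine ⟨φ, hφ, hφ.symm ▸ hw, fun {U} a c hac => ?_⟩
  obtain ⟨V, e, x, he, hx⟩ := ht₀.exists_pullback a
  refine ((isCoverCart_indecProjFib_iff e).1 he).cancel ?_
  have h₁ : el B (x ≫ b₀) = el B (e ≫ c) := by
    rw [← yMap_comp_el, ← hφ', yMap_comp_el_assoc, hx, ← yMap_comp_el, assoc, hac, yMap_comp_el]
  rw [hr.holds_iff_el, hxb, hx] at h₁
  simpa only [ObjectProperty.FullSubcategory.comp_hom, assoc] using h₁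

/-- Two descents: the local description of `φ`, composed with `r`, descends along the
cover-cartesian `t` to a map from `A.obj`. That map then descends along `q`, as tested on
indecomposable projectives. -/
lemma IsPresentation.exists_hom (hcov : CoveredByIndecProj p) (hq : IsPresentation A q)
    (hr : IsPresentation B r) (φ : A ⟶ B) : ∃ h : Z ⟶ W, Tracks q r φ h := by
  have hql := hq.isHomLift
  have hrl := hr.isHomLift
  obtain ⟨T, t, b, ht, hb⟩ := exists_el_of_hom φ
  have ht' := (isCoverCart_indecProjFib_iff t).1 ht
  have hxb : ∀ {U : (indecProj p).FullSubcategory} (x : U ⟶ T),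
      el B (x ≫ b) = el A (x ≫ t) ≫ φ := fun x => by
    rw [← yMap_comp_el, ← hb, yMap_comp_el_assoc]
  obtain ⟨f, hf, -⟩ := ht'.existsUnique_desc (b.hom ≫ r) fun U x y hx _ hxy => by
    let U₀ : (indecProj p).FullSubcategory := ⟨U, indecProj_of_cart x hx T.2⟩
    let x₀ : U₀ ⟶ T := ObjectProperty.homMk x
    let y₀ : U₀ ⟶ T := ObjectProperty.homMk y
    have hxy₀ : x₀ ≫ t = y₀ ≫ t := ObjectProperty.hom_ext _ hxy
    have := (hr.holds_iff_el (x₀ ≫ b) (y₀ ≫ b)).1 (by rw [hxb, hxb, hxy₀])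
    simp only [ObjectProperty.FullSubcategory.comp_hom, assoc] at this
    exact this
  have key : ∀ {U : (indecProj p).FullSubcategory} (a : U ⟶ A.obj) (c : U ⟶ B.obj),
      el A a ≫ φ = el B c → a.hom ≫ f = c.hom ≫ r := fun {U} a c hac => by
    obtain ⟨V, e, x, he, hx⟩ := ht.exists_pullback a
    refine ((isCoverCart_indecProjFib_iff e).1 he).cancel ?_
    have h₁ : el B (x ≫ b) = el B (e ≫ c) := by
      rw [hxb, hx, ← yMap_comp_el, assoc, hac, yMap_comp_el]
    rw [hr.holds_iff_el] at h₁
    have hx' : x.hom ≫ t.hom = e.hom ≫ a.hom := congrArg InducedCategory.Hom.hom hx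
    simp only [ObjectProperty.FullSubcategory.comp_hom, assoc] at h₁
    rw [← assoc, ← hx', assoc, hf, h₁]
  have hbase : p.map t.hom ≫ A.struct ≫ baseMap φ = p.map b.hom ≫ B.struct := by
    have := congrArg (fun k => baseMap k) hb
    simp only [baseMap_comp, baseMap_el, assoc] at this
    exact this
  have hfl : p.IsHomLift (A.struct ≫ baseMap φ) f := by
    have h₁ : p.IsHomLift (p.map b.hom ≫ B.struct) (b.hom ≫ r) := inferInstance
    rw [← hbase, ← hf] at h₁
    have := ht'.1
    exact isHomLift_of_epi_comp h₁
  obtain ⟨h, ⟨hh, hh'⟩, -⟩ := hq.isCoverMap.existsUnique_desc hcov f hql hfl fun U hU x y hxy => by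
    let U₀ : (indecProj p).FullSubcategory := ⟨U, hU⟩
    let x₀ : U₀ ⟶ A.obj := ObjectProperty.homMk x
    let y₀ : U₀ ⟶ A.obj := ObjectProperty.homMk y
    obtain ⟨V, e, c, he, hc⟩ := exists_el (el A x₀ ≫ φ)
    have h₁ := key (e ≫ x₀) c (by rw [← yMap_comp_el, assoc, hc])
    have h₂ := key (e ≫ y₀) c (by
      rw [← yMap_comp_el, assoc, ← (hq.holds_iff_el x₀ y₀).2 hxy, hc])
    refine ((isCoverCart_indecProjFib_iff e).1 he).cancel ?_
    have h₃ := h₁.trans h₂.symm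
    simp only [ObjectProperty.FullSubcategory.comp_hom, assoc] at h₃
    exact h₃
  exact ⟨h, hh, fun a c hac => by rw [hh', key a c hac]⟩

end Maps

end Presentation

/-! ### Every presheaf on the indecomposable projectives presents an object -/

section Exactness

variable {R : Type u₁} [Category.{v₁} R] {X : Type u₂} [Category.{v₂} X] {p : X ⥤ R}

/-- Exactness supplies some `q` with the given kernel pair. Passing to the coequalizer makes it a
regular epimorphism without changing the kernel pair. -/
lemma exists_quotient_of_equivalenceRelation {E : Type u₃} [Category.{v₃} E] [IsExactCategory E]
    {S A : E} (r₁ r₂ : S ⟶ A) [IsEquivalenceRelation r₁ r₂] :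
    ∃ (B : E) (π : A ⟶ B), IsRegularEpi π ∧ IsKernelPair π r₁ r₂ := by
  obtain ⟨B, q, hq⟩ := IsExactCategory.exists_isKernelPair r₁ r₂
  have := Regular.hasCoequalizer_of_isKernelPair hq
  refine ⟨coequalizer r₁ r₂, coequalizer.π r₁ r₂, inferInstance,
    IsKernelPair.cancel_right (f₂ := coequalizer.desc q hq.w) (coequalizer.condition r₁ r₂) ?_⟩
  rwa [coequalizer.π_desc]

lemma exists_relation_image {E : Type u₃} [Category.{v₃} E] [Regular E] {D S : E} (r₁ r₂ : D ⟶ S) :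
    ∃ (I : E) (ε : D ⟶ I) (ρ₁ ρ₂ : I ⟶ S), IsRegularEpi ε ∧ ε ≫ ρ₁ = r₁ ∧ ε ≫ ρ₂ = r₂ ∧
      JointlyMono₂ ρ₁ ρ₂ := by
  let F := Regular.strongEpiMonoFactorisation (prod.lift r₁ r₂)
  have hF : F.e ≫ F.m = prod.lift r₁ r₂ := F.fac
  refine ⟨F.I, F.e, F.m ≫ prod.fst, F.m ≫ prod.snd,
    inferInstanceAs (IsRegularEpi (Regular.strongEpiMonoFactorisation _).e), ?_, ?_,
    ⟨fun Y f g h₁ h₂ => ?_⟩⟩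
  · rw [← assoc, hF, prod.lift_fst]
  · rw [← assoc, hF, prod.lift_snd]
  · rw [← cancel_mono F.m]
    ext
    · simpa using h₁
    · simpa using h₂

lemma isHomLift_fiber {I : R} (E : p.Fiber I) {U : X} (u : U ⟶ E.1) :
    p.IsHomLift (p.map u ≫ eqToHom E.2) u := by
  obtain ⟨E, rfl⟩ := E
  rw [eqToHom_refl, comp_id]
  infer_instance

lemma isHomLift_of_comp_fiber {I J : R} {E S : p.Fiber I} (ρ : E ⟶ S) {U : X} {u : U ⟶ E.1}
    {t : J ⟶ I} (h : p.IsHomLift t (u ≫ ρ.1)) : p.IsHomLift t u := by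
  obtain rfl : p.obj U = J := IsHomLift.domain_eq p t (u ≫ ρ.1)
  have h₁ := isHomLift_fiber E u
  have h₂ := ρ.2
  obtain rfl : p.map u ≫ eqToHom E.2 = t :=
    isHomLift_unique (f := u ≫ ρ.1) inferInstance h
  exact h₁

/-! ### Monic pairs and kernel pairs of a fiber, tested on the total category. -/

section Opfibration

variable (H : ∀ (A : X) {I : R} (u : p.obj A ⟶ I), ∃ (B : X) (s : A ⟶ B),
  p.IsStronglyCocartesian u s)

-- A cocartesian lift turns maps into a fiber from any object of the total category into vertical
-- ones, so properties of the fiber can be tested on such maps.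
include H in
lemma exists_fiber_factor {T : X} {I : R} (t : p.obj T ⟶ I) :
    ∃ (T' : p.Fiber I) (σ : T ⟶ T'.1),
      (∀ {Z : p.Fiber I} (f : T ⟶ Z.1), p.IsHomLift t f → ∃ f' : T' ⟶ Z, σ ≫ f'.1 = f) ∧
      ∀ {Z : p.Fiber I} (f g : T' ⟶ Z), σ ≫ f.1 = σ ≫ g.1 → f = g := by
  obtain ⟨B, σ, hσ⟩ := H T t
  exact ⟨⟨B, IsHomLift.codomain_eq p t σ⟩, σ, fun f hf =>
    ⟨⟨Functor.IsCocartesian.map p t σ f, inferInstance⟩, Functor.IsCocartesian.fac p t σ f⟩,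
    fun f g h => fiber_hom_ext_of_cocart (B := ⟨B, IsHomLift.codomain_eq p t σ⟩) (u := t) σ h⟩

include H in
lemma hom_ext_of_jointlyMono {I : R} {E S : p.Fiber I} {ρ₁ ρ₂ : E ⟶ S} [JointlyMono₂ ρ₁ ρ₂] {U : X}
    {u u' : U ⟶ E.1} (h₁ : u ≫ ρ₁.1 = u' ≫ ρ₁.1) (h₂ : u ≫ ρ₂.1 = u' ≫ ρ₂.1) : u = u' := by
  have hu := isHomLift_fiber E u
  have := ρ₁.2
  have hu' : p.IsHomLift (p.map u ≫ eqToHom E.2) u' :=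
    isHomLift_of_comp_fiber ρ₁ (h₁ ▸ inferInstance)
  obtain ⟨U', σ, hσ, hσ'⟩ := exists_fiber_factor H (p.map u ≫ eqToHom E.2)
  obtain ⟨v, rfl⟩ := hσ u hu
  obtain ⟨v', rfl⟩ := hσ u' hu'
  rw [assoc, assoc] at h₁ h₂
  rw [JointlyMono₂.right_cancellation (p₁ := ρ₁) (p₂ := ρ₂) v v' (hσ' _ _ h₁) (hσ' _ _ h₂)]

include H in
lemma exists_lift_kernelPair {I : R} {E S B : p.Fiber I} {ρ₁ ρ₂ : E ⟶ S} {π : S ⟶ B}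
    (hπ : IsKernelPair π ρ₁ ρ₂) {T : X} (x y : T ⟶ S.1) (h : x ≫ π.1 = y ≫ π.1) :
    ∃ z : T ⟶ E.1, z ≫ ρ₁.1 = x ∧ z ≫ ρ₂.1 = y := by
  have hx := isHomLift_fiber S x
  have := π.2
  have hy : p.IsHomLift (p.map x ≫ eqToHom S.2) y :=
    isHomLift_of_comp_fiber π (h ▸ inferInstance)
  obtain ⟨T', σ, hσ, hσ'⟩ := exists_fiber_factor H (p.map x ≫ eqToHom S.2)
  obtain ⟨x', rfl⟩ := hσ x hx
  obtain ⟨y', rfl⟩ := hσ y hy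
  rw [assoc, assoc] at h
  have h' : x' ≫ π = y' ≫ π := hσ' _ _ h
  refine ⟨σ ≫ (hπ.lift x' y' h').1, ?_, ?_⟩
  · rw [assoc]
    exact congrArg (fun m => σ ≫ m.1) (hπ.lift_fst x' y' h')
  · rw [assoc]
    exact congrArg (fun m => σ ≫ m.1) (hπ.lift_snd x' y' h')

end Opfibration

/-- The lift `z` on the cover descends to `U` because joint monicity makes it agree on pairs
identified by `c`. -/
lemma exists_lift_relation [p.IsFibered] (hcov : CoveredByIndecProj p)
    (H : ∀ (A : X) {I : R} (u : p.obj A ⟶ I), ∃ (B : X) (s : A ⟶ B), p.IsStronglyCocartesian u s)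
    {I : R} {S E U : p.Fiber I} (ρ₁ ρ₂ : E ⟶ S) [JointlyMono₂ ρ₁ ρ₂]
    {C : X} (c : C ⟶ U.1) (hc : IsCoverMap p c) (a b : U ⟶ S) (z : C ⟶ E.1)
    (h₁ : z ≫ ρ₁.1 = c ≫ a.1) (h₂ : z ≫ ρ₂.1 = c ≫ b.1) : ∃ u : U ⟶ E, u ≫ ρ₁ = a ∧ u ≫ ρ₂ = b := by
  have ha := a.2
  have hb := b.2
  have hρ₁ := ρ₁.2
  have hρ₂ := ρ₂.2
  have hcl := isHomLift_fiber U c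
  have hz : p.IsHomLift ((p.map c ≫ eqToHom U.2) ≫ 𝟙 I) z := by
    rw [comp_id]
    exact isHomLift_of_comp_fiber ρ₁ (h₁ ▸ inferInstance)
  obtain ⟨g, ⟨hg, hg'⟩, -⟩ := hc.existsUnique_desc hcov z hcl hz fun T _ x y hxy =>
    hom_ext_of_jointlyMono H (ρ₁ := ρ₁) (ρ₂ := ρ₂)
      (by rw [assoc, h₁, ← assoc, hxy, assoc, assoc, h₁])
      (by rw [assoc, h₂, ← assoc, hxy, assoc, assoc, h₂])
  refine ⟨⟨g, hg⟩, Subtype.ext ?_, Subtype.ext ?_⟩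
  · exact hc.hom_ext (map_eq_of_isHomLift (u := 𝟙 I) (f := g ≫ ρ₁.1) inferInstance ha)
      ((assoc _ _ _).symm.trans ((congrArg (· ≫ ρ₁.1) hg').trans h₁))
  · exact hc.hom_ext (map_eq_of_isHomLift (u := 𝟙 I) (f := g ≫ ρ₂.1) inferInstance hb)
      ((assoc _ _ _).symm.trans ((congrArg (· ≫ ρ₂.1) hg').trans h₂))

variable [Regular R]

/-- The relation of a presheaf on the indecomposable projectives is represented by a jointly monic
pair in the fiber, on the sum over which the presheaf is a quotient. -/
lemma exists_relation_of_presheaf [IsFiberedPretopos p] (A : Presheaf (indecProjFib p)) :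
    ∃ (S E : p.Fiber A.base) (s : A.obj.obj ⟶ S.1) (ρ₁ ρ₂ : E ⟶ S)
      (c : A.rel.dom.obj ⟶ E.1), p.IsStronglyCocartesian A.struct s ∧ JointlyMono₂ ρ₁ ρ₂ ∧
      IsCoverMap p c ∧ c ≫ ρ₁.1 = A.rel.fst.hom ≫ s ∧ c ≫ ρ₂.1 = A.rel.snd.hom ≫ s ∧
      ∀ {T : (indecProj p).FullSubcategory} (x y : T ⟶ A.obj),
        A.rel.Holds (indecProjFib p) x y ↔
          ∃ z : T.obj ⟶ E.1, z ≫ ρ₁.1 = x.hom ≫ s ∧ z ≫ ρ₂.1 = y.hom ≫ s := by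
  have H : ∀ (A : X) {I : R} (u : p.obj A ⟶ I), ∃ (B : X) (s : A ⟶ B),
    p.IsStronglyCocartesian u s := IsFiberedPretopos.exists_cocart
  have := IsFiberedPretopos.exact (p := p) A.base
  obtain ⟨S, s, hs⟩ := H A.obj.obj A.struct
  -- The carrier of the relation is summed along its common base map. The two legs then land in the
  -- sum `S`, and their image is the relation `E`.
  obtain ⟨D, d, hd⟩ := H A.rel.dom.obj (p.map A.rel.fst.hom ≫ A.struct)
  let S₀ : p.Fiber A.base := ⟨S, IsHomLift.codomain_eq p A.struct s⟩
  let D₀ : p.Fiber A.base := ⟨D, IsHomLift.codomain_eq p (p.map A.rel.fst.hom ≫ A.struct) d⟩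
  have h₁ : p.IsHomLift (p.map A.rel.fst.hom ≫ A.struct) (A.rel.fst.hom ≫ s) := inferInstance
  have h₂ : p.IsHomLift (p.map A.rel.fst.hom ≫ A.struct) (A.rel.snd.hom ≫ s) := by
    have h₃ : p.IsHomLift (p.map A.rel.snd.hom ≫ A.struct) (A.rel.snd.hom ≫ s) := inferInstance
    have h₄ : p.map A.rel.fst.hom ≫ A.struct = p.map A.rel.snd.hom ≫ A.struct := A.rel_struct
    rwa [h₄]
  let r₁ : D₀ ⟶ S₀ := ⟨Functor.IsCocartesian.map p (p.map A.rel.fst.hom ≫ A.struct) d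
    (A.rel.fst.hom ≫ s), inferInstance⟩
  let r₂ : D₀ ⟶ S₀ := ⟨Functor.IsCocartesian.map p (p.map A.rel.fst.hom ≫ A.struct) d
    (A.rel.snd.hom ≫ s), inferInstance⟩
  have hr₁ : d ≫ r₁.1 = A.rel.fst.hom ≫ s := Functor.IsCocartesian.fac p (p.map A.rel.fst.hom ≫ A.struct) d _
  have hr₂ : d ≫ r₂.1 = A.rel.snd.hom ≫ s := Functor.IsCocartesian.fac p (p.map A.rel.fst.hom ≫ A.struct) d _
  obtain ⟨E, ε, ρ₁, ρ₂, hε, hε₁, hε₂, hρ⟩ := exists_relation_image r₁ r₂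
  have hc : IsCoverMap p (d ≫ ε.1) := ⟨D, d, ε.1, IsCocart.of_lift hd, ⟨A.base, ε.2, hε⟩, rfl⟩
  have hc₁ : (d ≫ ε.1) ≫ ρ₁.1 = A.rel.fst.hom ≫ s := by
    rw [assoc, ← hr₁]
    exact congrArg (fun m => d ≫ m.1) hε₁
  have hc₂ : (d ≫ ε.1) ≫ ρ₂.1 = A.rel.snd.hom ≫ s := by
    rw [assoc, ← hr₂]
    exact congrArg (fun m => d ≫ m.1) hε₂
  refine ⟨S₀, E, s, ρ₁, ρ₂, d ≫ ε.1, hs, hρ, hc, hc₁, hc₂, fun {T} x y => ⟨?_, ?_⟩⟩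
  · rintro ⟨T', t, k, ht, hk₁, hk₂⟩
    replace ht := (isCoverCart_indecProjFib_iff t).1 ht
    have hk₁' : k.hom ≫ A.rel.fst.hom = t.hom ≫ x.hom := congrArg InducedCategory.Hom.hom hk₁
    have hk₂' : k.hom ≫ A.rel.snd.hom = t.hom ≫ y.hom := congrArg InducedCategory.Hom.hom hk₂
    -- Joint monicity turns the local factorization into one defined on all of `T`.
    obtain ⟨z, hz, -⟩ := ht.existsUnique_desc (k.hom ≫ d ≫ ε.1) fun U u v _ _ huv =>
      hom_ext_of_jointlyMono H (ρ₁ := ρ₁) (ρ₂ := ρ₂)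
        (by simp only [assoc] at hc₁ ⊢
            rw [hc₁, reassoc_of% hk₁', reassoc_of% huv])
        (by simp only [assoc] at hc₂ ⊢
            rw [hc₂, reassoc_of% hk₂', reassoc_of% huv])
    refine ⟨z, ht.cancel ?_, ht.cancel ?_⟩
    · rw [← assoc, hz, assoc, hc₁, reassoc_of% hk₁']
    · rw [← assoc, hz, assoc, hc₂, reassoc_of% hk₂']
  · rintro ⟨z, hz₁, hz₂⟩
    obtain ⟨T', t, k, ht, hk⟩ := hc.exists_lift T.2 z
    let T₀ : (indecProj p).FullSubcategory := ⟨T', indecProj_of_cart t ht.2 T.2⟩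
    let t₀ : T₀ ⟶ T := ObjectProperty.homMk t
    let k₀ : T₀ ⟶ A.rel.dom := ObjectProperty.homMk k
    have hs' : IsCocart p s := IsCocart.of_lift hs
    refine ⟨T₀, t₀, k₀, (isCoverCart_indecProjFib_iff t₀).2 ht, ObjectProperty.hom_ext _ ?_,
      ObjectProperty.hom_ext _ ?_⟩
    -- The legs agree after `s`, hence agree, by uniqueness of liftings along a cocartesian map.
    · refine (T₀.2.1 (𝟙 _) (t ≫ z ≫ ρ₁.1) s (IsCart.of_isIso _) hs').unique ?_ ?_
      · change (k ≫ A.rel.fst.hom) ≫ s = _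
        rw [assoc, ← hc₁, ← assoc, hk, assoc]
      · change (t ≫ x.hom) ≫ s = _
        rw [assoc, hz₁]
    · refine (T₀.2.1 (𝟙 _) (t ≫ z ≫ ρ₂.1) s (IsCart.of_isIso _) hs').unique ?_ ?_
      · change (k ≫ A.rel.snd.hom) ≫ s = _
        rw [assoc, ← hc₂, ← assoc, hk, assoc]
      · change (t ≫ y.hom) ≫ s = _
        rw [assoc, hz₂]

/-- The laws for the relation on elements become structure maps in the fiber: each is realized on an
indecomposable projective cover and descended by `exists_lift_relation`. Exactness then provides the
quotient. -/
lemma exists_presentation_of_presheaf [IsFiberedPretopos p] (hcov : CoveredByIndecProj p)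
    (A : Presheaf (indecProjFib p)) : ∃ (Z : X) (q : A.obj.obj ⟶ Z), IsPresentation A q := by
  have H : ∀ (A : X) {I : R} (u : p.obj A ⟶ I), ∃ (B : X) (s : A ⟶ B),
    p.IsStronglyCocartesian u s := IsFiberedPretopos.exists_cocart
  have := IsFiberedPretopos.exact (p := p) A.base
  obtain ⟨S, E, s, ρ₁, ρ₂, c, hs, hρ, hc, hc₁, hc₂, hK⟩ := exists_relation_of_presheaf A
  have hs' : IsCocart p s := IsCocart.of_lift hs
  have hrel : A.rel.Holds (indecProjFib p) A.rel.fst A.rel.snd :=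
    ⟨_, 𝟙 _, 𝟙 _, IsCoverCart.id _, rfl, rfl⟩
  obtain ⟨e, he₁, he₂⟩ : ∃ e : S ⟶ E, e ≫ ρ₁ = 𝟙 S ∧ e ≫ ρ₂ = 𝟙 S := by
    obtain ⟨z, hz₁, hz₂⟩ := (hK (𝟙 A.obj) (𝟙 A.obj)).1 (A.refl _)
    exact exists_lift_relation hcov H ρ₁ ρ₂ s hs'.isCoverMap (𝟙 S) (𝟙 S) z
      (hz₁.trans ((id_comp _).trans (comp_id _).symm))
      (hz₂.trans ((id_comp _).trans (comp_id _).symm))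
  obtain ⟨i, hi₁, hi₂⟩ : ∃ i : E ⟶ E, i ≫ ρ₁ = ρ₂ ∧ i ≫ ρ₂ = ρ₁ := by
    obtain ⟨z, hz₁, hz₂⟩ := (hK A.rel.snd A.rel.fst).1 (A.symm hrel)
    exact exists_lift_relation hcov H ρ₁ ρ₂ c hc ρ₂ ρ₁ z (hz₁.trans hc₂.symm)
      (hz₂.trans hc₁.symm)
  obtain ⟨m, hm₁, hm₂⟩ : ∃ m : pullback ρ₂ ρ₁ ⟶ E,
      m ≫ ρ₁ = pullback.fst ρ₂ ρ₁ ≫ ρ₁ ∧ m ≫ ρ₂ = pullback.snd ρ₂ ρ₁ ≫ ρ₂ := by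
    obtain ⟨C, k, hC, hk⟩ := hcov.exists_coverMap (pullback ρ₂ ρ₁).1
    let C₀ : (indecProj p).FullSubcategory := ⟨C, hC⟩
    have lift : ∀ g : pullback ρ₂ ρ₁ ⟶ S, ∃ x : C₀ ⟶ A.obj, x.hom ≫ s = k ≫ g.1 := fun g => by
      obtain ⟨x, hx, -⟩ := hC.1 (𝟙 C) (k ≫ g.1) s (IsCart.of_isIso _) hs'
      exact ⟨ObjectProperty.homMk x, hx⟩
    obtain ⟨x₁, hx₁⟩ := lift (pullback.fst ρ₂ ρ₁ ≫ ρ₁)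
    obtain ⟨x₂, hx₂⟩ := lift (pullback.fst ρ₂ ρ₁ ≫ ρ₂)
    obtain ⟨x₃, hx₃⟩ := lift (pullback.snd ρ₂ ρ₁ ≫ ρ₂)
    -- A single lift of the middle component serves both relations, by the pullback condition.
    have hx₂' : x₂.hom ≫ s = k ≫ (pullback.snd ρ₂ ρ₁ ≫ ρ₁).1 :=
      hx₂.trans (congrArg (fun m : pullback ρ₂ ρ₁ ⟶ S => k ≫ m.1)
        (pullback.condition (f := ρ₂) (g := ρ₁)))
    have h₁ := (hK x₁ x₂).2 ⟨k ≫ (pullback.fst ρ₂ ρ₁).1, (assoc _ _ _).trans hx₁.symm,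
      (assoc _ _ _).trans hx₂.symm⟩
    have h₂ := (hK x₂ x₃).2 ⟨k ≫ (pullback.snd ρ₂ ρ₁).1, (assoc _ _ _).trans hx₂'.symm,
      (assoc _ _ _).trans hx₃.symm⟩
    obtain ⟨z, hz₁, hz₂⟩ := (hK x₁ x₃).1 (A.trans h₁ h₂)
    exact exists_lift_relation hcov H ρ₁ ρ₂ k hk _ _ z (hz₁.trans hx₁) (hz₂.trans hx₃)
  have hE : IsEquivalenceRelation ρ₁ ρ₂ := ⟨⟨
    { right_cancellation := hρ.right_cancellation
      r := e
      reflexivity₁ := he₁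
      reflexivity₂ := he₂
      s := i
      symmetry₁ := hi₁
      symmetry₂ := hi₂
      c := PullbackCone.mk _ _ pullback.condition
      isLimit := pullbackIsPullback ρ₂ ρ₁
      t := m
      transitivity₁ := hm₁
      transitivity₂ := hm₂ }⟩⟩
  obtain ⟨B, π, hπ, hπ'⟩ := exists_quotient_of_equivalenceRelation ρ₁ ρ₂
  have hπl := π.2
  refine ⟨B.1, s ≫ π.1, inferInstance, ⟨S.1, s, π.1, hs', ⟨A.base, hπl, hπ⟩, rfl⟩,
    fun {T} x y => (hK x y).trans ⟨?_, fun h => ?_⟩⟩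
  · rintro ⟨z, hz₁, hz₂⟩
    rw [← assoc, ← assoc, ← hz₁, ← hz₂, assoc, assoc]
    exact congrArg (fun m => z ≫ m.1) hπ'.w
  · exact exists_lift_kernelPair H hπ' _ _ (by rw [assoc, assoc, h])

end Exactness

/-! ### Recognition of fibrations of presheaves -/

section FullyFaithful

variable {R : Type u₁} [Category.{v₁} R] {X : Type u₂} [Category.{v₂} X]
  {Y : Type u₃} [Category.{v₃} Y]

/-- A fully faithful functor over the base which is vertically essentially surjective is an
equivalence of fibrations. -/
lemma VerticallyEssSurj.fibrationsEquivalent {F : X ⥤ Y} {q : Y ⥤ R} [F.Full] [F.Faithful]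
    (h : VerticallyEssSurj F q) : FibrationsEquivalent (F ⋙ q) q := by
  choose A i hi using h
  let G : Y ⥤ X :=
    { obj := A
      map := fun {B B'} f => F.preimage ((i B).hom ≫ f ≫ (i B').inv)
      map_id := fun B => F.map_injective (by simp)
      map_comp := fun f g => F.map_injective (by simp) }
  let ε : G ⋙ F ≅ 𝟭 Y := NatIso.ofComponents i (fun f => by simp [G])
  let η : F ⋙ G ≅ 𝟭 X := NatIso.ofComponents (fun B => F.preimageIso (i (F.obj B)))
    (fun f => F.map_injective (by simp [G]))
  let e : X ≌ Y := CategoryTheory.Equivalence.mk F G η.symm ε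
  have hF : F.IsEquivalence := e.isEquivalence_functor
  have hG : G.IsEquivalence := e.isEquivalence_inverse
  -- `G` lies strictly over the base because the chosen isomorphisms are vertical, so their images
  -- in the base are `eqToHom`s.
  have hGq : G ⋙ F ⋙ q = q := Functor.ext_of_iso (Functor.isoWhiskerRight ε q)
    (fun B => IsHomLift.domain_eq q (𝟙 (q.obj B)) (i B).hom) fun B => by
      have h := IsHomLift.fac' q (𝟙 (q.obj B)) (i B).hom
      rw [id_comp, eqToHom_trans] at h
      exact h
  let F' : BasedFunctor (BasedCategory.ofFunctor (F ⋙ q)) (BasedCategory.ofFunctor q) := ⟨F, rfl⟩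
  let G' : BasedFunctor (BasedCategory.ofFunctor q) (BasedCategory.ofFunctor (F ⋙ q)) := ⟨G, hGq⟩
  refine ⟨F', G', fun B B' f hf => hf.map_of_isEquivalence, fun B B' f hf => ?_,
    ⟨BasedNatIso.mkNatIso η fun B => isHomLift_comp_iff.2 ?_⟩,
    ⟨BasedNatIso.mkNatIso ε fun B => hi B⟩⟩
  · have hf' : IsCart (G ⋙ F ⋙ q) f := by rwa [hGq]
    exact hf'.map_of_isEquivalence
  · exact (F.map_preimage (i (F.obj B)).hom).symm ▸ hi (F.obj B)

end FullyFaithful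

/-! ### The presentation functor and the resulting equivalence. -/

section Recognition

variable {R : Type u₁} [Category.{v₁} R] {X : Type u₂} [Category.{v₂} X] {p : X ⥤ R}

lemma isHomLift_eqToHom_id {Z : X} {I J : R} (hI : p.obj Z = I) (h : I = J) :
    p.IsHomLift (eqToHom h) (𝟙 Z) := by
  subst h
  exact IsHomLift.id hI

variable [Regular R]

/-- A choice of a presentation by a presheaf on the indecomposable projectives for every object. -/
lemma exists_presentationFunctor [IsFiniteLimitPrestack p] (hcov : CoveredByIndecProj p) :
    ∃ (F : X ⥤ Presheaf (indecProjFib p)) (q : ∀ Z, (F.obj Z).obj.obj ⟶ Z),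
      F ⋙ presheafFib (indecProjFib p) = p ∧ (∀ Z, IsPresentation (F.obj Z) (q Z)) ∧
      ∀ {Z W : X} (h : Z ⟶ W), Tracks (q Z) (q W) (F.map h) h := by
  choose A q hq using exists_presheaf_presentation (p := p) hcov
  have hA : ∀ Z, (A Z).base = p.obj Z := fun Z => by
    have := (hq Z).isHomLift
    exact (IsHomLift.codomain_eq p (A Z).struct (q Z)).symm
  choose φ hφ hφ' using fun {Z W : X} (h : Z ⟶ W) =>
    (hq Z).exists_presheaf_hom (hq W) (eqToHom (hA Z) ≫ p.map h ≫ eqToHom (hA W).symm) h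
      inferInstance
  let F : X ⥤ Presheaf (indecProjFib p) :=
    { obj := A
      map := φ
      map_id := fun Z => Tracks.presheaf_hom_unique (hq Z) (hφ' (𝟙 Z)) (hq Z).tracks_id
      map_comp := fun {_ _ W} f g =>
        Tracks.presheaf_hom_unique (hq W) (hφ' (f ≫ g)) ((hφ' f).comp (hφ' g)) }
  exact ⟨F, q, CategoryTheory.Functor.ext hA fun Z W h => hφ h, hq, hφ'⟩

/-- Full faithfulness is the matching of morphisms with morphisms of presentations. Every presheaf
presents some object, and two presentations of one object are vertically isomorphic, which gives
essential surjectivity. -/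
lemma fibrationsEquivalent_presheafFib_indecProjFib [IsFiberedPretopos p]
    (hcov : CoveredByIndecProj p) :
    FibrationsEquivalent p (presheafFib (indecProjFib p)) := by
  obtain ⟨F, q, hF, hq, hFq⟩ := exists_presentationFunctor hcov
  have hfull : F.Full := ⟨fun {Z W} φ => by
    obtain ⟨h, hh⟩ := (hq Z).exists_hom hcov (hq W) φ
    exact ⟨h, Tracks.presheaf_hom_unique (hq W) (hFq h) hh⟩⟩
  have hfaithful : F.Faithful := ⟨fun {Z W} h h' hh =>
    Tracks.hom_unique (hq Z) (hFq h) (hh ▸ hFq h')⟩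
  have hsurj : VerticallyEssSurj F (presheafFib (indecProjFib p)) := fun B => by
    obtain ⟨Z, r, hr⟩ := exists_presentation_of_presheaf hcov B
    have hrl := hr.isHomLift
    have hql := (hq Z).isHomLift
    have hB : p.obj Z = B.base := IsHomLift.codomain_eq p B.struct r
    have hA : p.obj Z = (F.obj Z).base := IsHomLift.codomain_eq p (F.obj Z).struct (q Z)
    obtain ⟨φ, hφ, hφ'⟩ := (hq Z).exists_presheaf_hom hr (eqToHom (hA.symm.trans hB)) (𝟙 Z)
      (isHomLift_eqToHom_id hA _)
    obtain ⟨ψ, -, hψ'⟩ := hr.exists_presheaf_hom (hq Z) (eqToHom (hB.symm.trans hA)) (𝟙 Z)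
      (isHomLift_eqToHom_id hB _)
    refine ⟨Z, ⟨φ, ψ, ?_, ?_⟩, ?_⟩
    · refine Tracks.presheaf_hom_unique (hq Z) ?_ (hq Z).tracks_id
      simpa using hφ'.comp hψ'
    · refine Tracks.presheaf_hom_unique hr ?_ hr.tracks_id
      simpa using hψ'.comp hφ'
    · exact IsHomLift.of_fac' (presheafFib (indecProjFib p)) _ φ (hA.symm.trans hB) rfl
        (hφ.trans ((congrArg (eqToHom _ ≫ ·) (id_comp _)).trans (eqToHom_trans _ _)).symm)
  have := hsurj.fibrationsEquivalent
  rwa [hF] at this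

end Recognition

end FibPresheaf

theorem lemma3p1p16 {R : Type u₁} [Category.{v₁} R] [Regular R] :
    -- (i) presheaves on a finite-limit pre-stack
    (∀ {C : Type u₂} [Category.{v₂} C] (p : C ⥤ R) [FibPresheaf.IsFiniteLimitPrestack p],
      -- (a) representables are indecomposable projectives
      (∀ c : C, FibPresheaf.IsIndec (FibPresheaf.presheafFib p)
          ((FibPresheaf.yonedaFunctor p).obj c) ∧
        FibPresheaf.IsProj (FibPresheaf.presheafFib p) ((FibPresheaf.yonedaFunctor p).obj c)) ∧
      -- (b) indecomposable projectives admit cover-cartesian maps from representables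
      (∀ A : FibPresheaf.Presheaf p, FibPresheaf.IsIndec (FibPresheaf.presheafFib p) A →
        FibPresheaf.IsProj (FibPresheaf.presheafFib p) A →
        ∃ (c : C) (e : (FibPresheaf.yonedaFunctor p).obj c ⟶ A),
          FibPresheaf.IsCoverCart (FibPresheaf.presheafFib p) e) ∧
      -- in other words: the co-restriction of the Yoneda embedding is a weak equivalence
      (∃ h : ∀ c : C, FibPresheaf.indecProj (FibPresheaf.presheafFib p)
          ((FibPresheaf.yonedaFunctor p).obj c),
        FibPresheaf.IsWeakEquivalence (FibPresheaf.yonedaCorestrict p h))) ∧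
    -- (ii) characterization of fibrations of presheaves among fibered pretoposes
    (∀ {X : Type u₃} [Category.{v₃} X] (p : X ⥤ R) [FibPresheaf.IsFiberedPretopos p],
      (∃ _ : FibPresheaf.IsFiniteLimitPrestack (FibPresheaf.indecProjFib p),
        FibPresheaf.FibrationsEquivalent p
          (FibPresheaf.presheafFib (FibPresheaf.indecProjFib p))) ↔
      (FibPresheaf.IndecProjClosedUnderFiniteLimits p ∧ FibPresheaf.CoveredByIndecProj p)) := by
  refine ⟨fun p _ => ⟨fun c => ⟨FibPresheaf.isIndec_representable c,
    FibPresheaf.isProj_representable c⟩,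
    fun A h₁ h₂ => FibPresheaf.exists_coverCart_of_indecProj ⟨h₁, h₂⟩,
    ⟨fun c => FibPresheaf.indecProj_representable c,
      FibPresheaf.isWeakEquivalence_yonedaCorestrict _⟩⟩, fun p _ => ⟨?_, ?_⟩⟩
  -- Both conditions hold for presheaves on any finite-limit pre-stack and are transported along the
  -- equivalence.
  · rintro ⟨_, h⟩
    exact ⟨h.indecProjClosedUnderFiniteLimits
      FibPresheaf.indecProjClosedUnderFiniteLimits_presheafFib,
      h.coveredByIndecProj FibPresheaf.coveredByIndecProj_presheafFib⟩
  · rintro ⟨hlim, hcov⟩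
    exact ⟨FibPresheaf.isFiniteLimitPrestack_indecProjFib hlim,
      FibPresheaf.fibrationsEquivalent_presheafFib_indecProjFib hcov⟩
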